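/- Fix $\alpha\in(1/2,1)$. The $\alpha$-supercritical causal triangulation of the half-plane (SCTHP) is the random triangulation of $\mathbb{R}_+\times\mathbb{R}$ with vertex set $\mathbb{N}\times\mathbb{Z}$ ($0\in\mathbb{N}$) obtained by stacking independent layers: for each $j\in\mathbb{Z}$, the strip between heights $j$ and $j+1$ is divided, from left to right starting at the left boundary edge $(0,j)\to(0,j+1)$, into triangles, each of which, independently of all others, is top-oriented (it has a side on the line of height $j+1$) with probability $\alpha$ and bottom-oriented (it has a side on the line of height $j$) with probability $1-\alpha$. Given this map, each non-horizontal edge, directed from bottom to top, is independently open with probability $p\in[0,1]$ and closed otherwise; horizontal edges play no role. Let $\widetilde{\mathbb{P}}_p$ be the annealed law (average over the map and the percolation), let $\widetilde{\mathcal{C}}$ be the set of vertices that can be reached from the origin $(0,0)$ by directed open paths, let $|\widetilde{\mathcal{C}}|$ be its number of vertices, and let $\widetilde{\Theta}(p)=\widetilde{\mathbb{P}}_p(|\widetilde{\mathcal{C}}|=\infty)$. Set $$m=\frac{\alpha}{1-\alpha},\qquad \eta=\frac{1}{m+1}\sum_{n\ge 0}\frac{m-1}{m^{n+1}-1},\qquad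 p_c=\frac{\eta}{1+\eta}.$$ Theorem. The following three estimates hold. (i) For every $p\in[0,p_c)$ there is $c=c(p)\in(0,1)$ such that $\widetilde{\mathbb{P}}_p(|\widetilde{\mathcal{C}}|\ge n)=O(c^n)$ as $n\to\infty$. (ii) There is $A>0$ such that $\widetilde{\mathbb{P}}_{p_c}(|\widetilde{\mathcal{C}}|\ge n)\sim A\,n^{-1/2}$ as $n\to\infty$. (iii) There is $a>0$ such that $\widetilde{\Theta}(p)\sim a\,(p-p_c)$ as $p\downarrow p_c$. (The constants $c$, $A$, $a$ may depend on the fixed parameter $\alpha$.) -/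

import Mathlib

open MeasureTheory ProbabilityTheory Filter Topology Asymptotics

namespace SCTHP

/-- Vertices `(i, j)` of a causal triangulation of the half-plane `ℝ₊ × ℝ`:
`i` is the rank from the left inside a horizontal line, `j` is the height. -/
abbrev Vertex : Type := ℕ × ℤ

/-- The origin vertex. -/
def origin : Vertex := (0, 0)

/-- A causal triangulation of the half-plane, given by the orientations of its triangles:
`θ (j, t)` is `true` if the `t`-th triangle (from the left, starting at `t = 0`) of the layer
between heights `j` and `j + 1` is top-oriented, and `false` if it is bottom-oriented. -/
abbrev Triangulation : Type := ℤ × ℕ → Bool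

/-- The non-horizontal edges of one layer whose triangles have orientations `s`, from left to right.
Edge `t` joins the vertex of rank `(layerEdge s t).1` on the lower line to the vertex of rank
`(layerEdge s t).2` on the upper line. Edge `0` lies on the left boundary, and the `t`-th
triangle is bordered by edges `t` and `t + 1`. If this triangle is top-oriented it has a side on
the upper line, so that the upper endpoint moves by one to the right; if it is bottom-oriented it
has a side on the lower line, so that the lower endpoint moves by one to the right. -/
def layerEdge (s : ℕ → Bool) : ℕ → ℕ × ℕ
  | 0 => (0, 0)
  | t + 1 =>
    if s t = true then ((layerEdge s t).1, (layerEdge s t).2 + 1)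
    else ((layerEdge s t).1 + 1, (layerEdge s t).2)

/-- The edge of label `e = (j, t)`, i.e. the `t`-th non-horizontal edge between heights `j` and
`j + 1` in the triangulation `θ`, directed from bottom to top: a pair (tail, head). -/
def edge (θ : Triangulation) (e : ℤ × ℕ) : Vertex × Vertex :=
  (((layerEdge (fun t => θ (e.1, t)) e.2).1, e.1),
    ((layerEdge (fun t => θ (e.1, t)) e.2).2, e.1 + 1))

theorem layerEdge_add (s : ℕ → Bool) (t : ℕ) :
    (layerEdge s t).1 + (layerEdge s t).2 = t := by
  induction t with
  | zero => rfl
  | succ t ih =>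
    simp only [layerEdge]
    split <;> simp only <;> omega

/-- Different labels are different edges: the labels `(j, t)` are in bijection with the
non-horizontal edges of the map. -/
theorem edge_injective (θ : Triangulation) : Function.Injective (edge θ) := by
  rintro ⟨j, t⟩ ⟨j', t'⟩ h
  simp only [edge, Prod.mk.injEq] at h
  obtain ⟨⟨h1, rfl⟩, h2, -⟩ := h
  have a := layerEdge_add (fun u => θ (j, u)) t
  have b := layerEdge_add (fun u => θ (j, u)) t'
  have : t = t' := by omega
  rw [this]

/-- A bond percolation configuration: `ω e` is `true` if the edge of label `e` is open.
Horizontal edges play no role and carry no state. -/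
abbrev Config : Type := ℤ × ℕ → Bool

/-- There is an open edge of `θ` directed from `v` to `w`. -/
def OpenStep (θ : Triangulation) (ω : Config) (v w : Vertex) : Prop :=
  ∃ e : ℤ × ℕ, ω e = true ∧ edge θ e = (v, w)

/-- The directed percolation cluster of the origin: all vertices that can be reached from the
origin by a finite (possibly empty) directed path of open edges. -/
def cluster (θ : Triangulation) (ω : Config) : Set Vertex :=
  {v | Relation.ReflTransGen (OpenStep θ ω) origin v}

/-- The law of a family of i.i.d. Bernoulli variables of parameter `q ∈ [0, 1]`
(a real `q` outside `[0, 1]` is replaced by the nearest point of `[0, 1]`). -/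
noncomputable def iidBernoulli (q : ℝ) : Measure (ℤ × ℕ → Bool) :=
  Measure.infinitePi fun _ : ℤ × ℕ =>
    bernoulliMeasure true false (Set.projIcc (0 : ℝ) 1 zero_le_one q)

/-- The annealed law: all triangles are top-oriented with probability `α` independently
of each other, and, given the map, its non-horizontal edges are open with probability `p`
independently of each other. -/
noncomputable def annealed (α p : ℝ) : Measure (Triangulation × Config) :=
  (iidBernoulli α).prod (iidBernoulli p)

/-- The annealed probability that the cluster of the origin has at least `n` vertices. -/
noncomputable def tail (α p : ℝ) (n : ℕ) : ℝ :=
  (annealed α p).real {x | (n : ℕ∞) ≤ (cluster x.1 x.2).encard}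

/-- The annealed probability that the cluster of the origin is infinite. -/
noncomputable def percProb (α p : ℝ) : ℝ :=
  (annealed α p).real {x | (cluster x.1 x.2).Infinite}

/-- The mean `m = α / (1 - α)` of the geometric law `k ↦ α ^ k * (1 - α)`. -/
noncomputable def offspringMean (α : ℝ) : ℝ := α / (1 - α)

/-- `η = (1 / (m + 1)) * ∑_{n ≥ 0} (m - 1) / (m ^ (n + 1) - 1)`. -/
noncomputable def eta (α : ℝ) : ℝ :=
  1 / (offspringMean α + 1) *
    ∑' n : ℕ, (offspringMean α - 1) / (offspringMean α ^ (n + 1) - 1)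

/-- The critical parameter `p_c = η / (1 + η)`. -/
noncomputable def criticalParam (α : ℝ) : ℝ := eta α / (1 + eta α)

end SCTHP

namespace SCTHP

open scoped ENNReal

/-! ### Product measures -/

section Product

variable {ι κ X Y : Type*} [MeasurableSpace X] [MeasurableSpace Y]

/-! The cluster is explored along the left boundary of the undiscovered region, and the exploration
carries a random walk. In coordinates where the current edge is the boundary edge from `(0, 0)` to
`(0, 1)`, the state is a height `h`: the boundary vertices at heights `-h, ..., 0` (`stack h`) are
known to be in the cluster. If the current edge is open, its head joins the stack and `h` grows by
one. If it is closed and the triangle on its right is top-oriented, its head is cut off, with part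
of the layers above, and `h` is unchanged. If it is closed and the triangle is bottom-oriented, its
tail is cut off, together with vertices below it. The latter form a branching process going down
whose offspring law is geometric of mean `(1 - α) / α < 1`; it dies after `depth` generations, and
`h` decreases by `depth`. What remains is a fresh half-plane (`measurePreserving_glue`), so the
height performs a walk with i.i.d. steps `dh ≤ 1`, and the cluster is finite once the walk is
negative. In law, the map is rebuilt from independent environments, one per step, glued by `chain`.

Generating functions of a geometric law are linear fractional, so their iterates are explicit:
`P(depth > n) = (m - 1) / (m ^ (n + 1) - 1)`. Hence the mean step is `p - (1 - p) η = (1 + η) (p -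
p_c)` (`integral_dh`). As the steps are at most one, the ballot theorem (`integral_staysPos`) gives
`P(S_k ≥ 0 for k ≤ n) = E[max S_{n+1} 0] / ((n + 1) p)`. This probability, `survival`, is of order
`n ^ (-1/2)` at zero drift by the central limit theorem, and converges to drift over `p` for
nonnegative drift. For negative drift it is exponentially small by Chernoff's bound.

It remains to pass from the duration of the exploration to the volume of the cluster. A step
swallows at most `volume` vertices, a variable with exponential moments; with Chernoff's bound this
gives (i). For a lower bound, `found` counts the swallowed vertices reached by explored edges from
the lower boundary; it does not depend on `h`, so successive blocks of steps have i.i.d. counts of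
positive mean. Long survival thus forces a large cluster, and for `p_c < p < 1` the percolation
probability equals the limit of `survival`, that is `(1 + η) (p - p_c) / p`, which gives (iii).

For (ii) the upper and lower counts must agree to leading order. A swallowed vertex not yet found
may still be reached later from boundary vertices above the current edge. A renewal, a top step that
shifts all higher layers (possible because the branching process going up is supercritical),
excludes this. The undecided volume `pending` therefore has a mean bounded uniformly in the block
length `l`. The scaled tail is squeezed between quantities whose squares differ by `O(1 / l)`, and
its limit exists (`exists_tendsto_of_forall_sqrt_div`). -/

theorem eq_prod_infinitePi {μ : ι → Measure X} {ν : κ → Measure Y}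
    [∀ i, IsProbabilityMeasure (μ i)] [∀ i, IsProbabilityMeasure (ν i)]
    {ρ : Measure ((ι → X) × (κ → Y))}
    (h : ∀ (s : Finset ι) (t : ι → Set X) (s' : Finset κ) (t' : κ → Set Y),
      (∀ i, MeasurableSet (t i)) → (∀ i, MeasurableSet (t' i)) →
      ρ (Set.pi s t ×ˢ Set.pi s' t') = (∏ i ∈ s, μ i (t i)) * ∏ i ∈ s', ν i (t' i)) :
    ρ = (Measure.infinitePi μ).prod (Measure.infinitePi ν) := by
  symm
  refine Measure.prod_eq_generateFrom generateFrom_squareCylinders generateFrom_squareCylinders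
    (isPiSystem_squareCylinders (fun _ => MeasurableSpace.isPiSystem_measurableSet) (by simp))
    (isPiSystem_squareCylinders (fun _ => MeasurableSpace.isPiSystem_measurableSet) (by simp))
    ?_ ?_ ?_
  · exact ⟨fun _ => Set.univ, fun _ => ⟨∅, fun _ => Set.univ, fun _ _ => MeasurableSet.univ,
      by simp⟩, by simp, Set.iUnion_const _⟩
  · exact ⟨fun _ => Set.univ, fun _ => ⟨∅, fun _ => Set.univ, fun _ _ => MeasurableSet.univ,
      by simp⟩, by simp, Set.iUnion_const _⟩
  · rintro _ ⟨s, t, ht, rfl⟩ _ ⟨s', t', ht', rfl⟩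
    have ht : ∀ i, MeasurableSet (t i) := fun i => ht i trivial
    have ht' : ∀ i, MeasurableSet (t' i) := fun i => ht' i trivial
    rw [h s t s' t' ht ht', Measure.infinitePi_pi _ (fun i _ => ht i),
      Measure.infinitePi_pi _ (fun i _ => ht' i)]

theorem measurePreserving_reindex (μ : ι → Measure X) [∀ i, IsProbabilityMeasure (μ i)]
    {f : κ → ι} (hf : Function.Injective f) :
    MeasurePreserving (fun (x : ι → X) k => x (f k)) (Measure.infinitePi μ)
      (Measure.infinitePi fun k => μ (f k)) :=
  ⟨by fun_prop, Measure.map_infinitePi_infinitePi_of_inj hf⟩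

theorem measurePreserving_split_sum (μ : ι ⊕ κ → Measure X) [∀ i, IsProbabilityMeasure (μ i)] :
    MeasurePreserving (fun x : ι ⊕ κ → X => (fun i => x (.inl i), fun i => x (.inr i)))
      (Measure.infinitePi μ)
      ((Measure.infinitePi fun i => μ (.inl i)).prod (Measure.infinitePi fun i => μ (.inr i))) := by
  have hm : Measurable (fun x : ι ⊕ κ → X => (fun i => x (.inl i), fun i => x (.inr i))) := by
    fun_prop
  refine ⟨hm, eq_prod_infinitePi fun s t s' t' ht ht' => ?_⟩
  rw [Measure.map_apply hm ((MeasurableSet.pi s.countable_toSet fun i _ => ht i).prod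
    (MeasurableSet.pi s'.countable_toSet fun i _ => ht' i))]
  have : (fun x : ι ⊕ κ → X => (fun i => x (.inl i), fun i => x (.inr i))) ⁻¹'
      (Set.pi s t ×ˢ Set.pi s' t') = Set.pi (s.disjSum s' : Finset (ι ⊕ κ)) (Sum.elim t t') := by
    ext x
    simp [Set.mem_pi]
  rw [this, Measure.infinitePi_pi]
  · simp
  · rintro (i | i) _
    exacts [ht i, ht' i]

theorem measurePreserving_split {A B : Type*} (μ : ι → Measure X)
    [∀ i, IsProbabilityMeasure (μ i)] {f : A → ι} {g : B → ι}
    (h : Function.Injective (Sum.elim f g)) :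
    MeasurePreserving (fun x : ι → X => (fun i => x (f i), fun i => x (g i)))
      (Measure.infinitePi μ)
      ((Measure.infinitePi fun i => μ (f i)).prod (Measure.infinitePi fun i => μ (g i))) :=
  (measurePreserving_split_sum fun i => μ (Sum.elim f g i)).comp (measurePreserving_reindex μ h)

theorem measurePreserving_unzip (μ : ι → Measure X) (ν : ι → Measure Y)
    [∀ i, IsProbabilityMeasure (μ i)] [∀ i, IsProbabilityMeasure (ν i)] :
    MeasurePreserving (fun x : ι → X × Y => (fun i => (x i).1, fun i => (x i).2))
      (Measure.infinitePi fun i => (μ i).prod (ν i))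
      ((Measure.infinitePi μ).prod (Measure.infinitePi ν)) := by
  classical
  have hm : Measurable (fun x : ι → X × Y => (fun i => (x i).1, fun i => (x i).2)) := by
    fun_prop
  refine ⟨hm, eq_prod_infinitePi fun s t s' t' ht ht' => ?_⟩
  rw [Measure.map_apply hm ((MeasurableSet.pi s.countable_toSet fun i _ => ht i).prod
    (MeasurableSet.pi s'.countable_toSet fun i _ => ht' i))]
  have : (fun x : ι → X × Y => (fun i => (x i).1, fun i => (x i).2)) ⁻¹'
      (Set.pi s t ×ˢ Set.pi s' t') = Set.pi (s ∪ s' : Finset ι)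
        (fun i => (if i ∈ s then t i else Set.univ) ×ˢ (if i ∈ s' then t' i else Set.univ)) := by
    ext x
    simp only [Set.mem_preimage, Set.mem_prod, Set.mem_pi, SetLike.mem_coe, Finset.mem_union]
    constructor
    · rintro ⟨h1, h2⟩ i -
      constructor <;> split_ifs with h <;> simp_all
    · intro h
      refine ⟨fun i hi => ?_, fun i hi => ?_⟩
      · simpa [hi] using (h i (.inl hi)).1
      · simpa [hi] using (h i (.inr hi)).2
  rw [this, Measure.infinitePi_pi]
  · simp_rw [Measure.prod_prod]
    rw [Finset.prod_mul_distrib]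
    congr 1
    · rw [← Finset.prod_subset (Finset.subset_union_left (s₁ := s) (s₂ := s'))]
      · exact Finset.prod_congr rfl fun i hi => by simp [hi]
      · intro i _ hi; simp [hi]
    · rw [← Finset.prod_subset (Finset.subset_union_right (s₁ := s) (s₂ := s'))]
      · exact Finset.prod_congr rfl fun i hi => by simp [hi]
      · intro i _ hi; simp [hi]
  · intro i _
    refine MeasurableSet.prod ?_ ?_ <;> split_ifs <;> simp [ht, ht']

theorem eq_infinitePi_nat {μ : Measure X} [IsProbabilityMeasure μ] {ρ : Measure (ℕ → X)}
    (h : ∀ (n : ℕ) (t : ℕ → Set X), (∀ i, MeasurableSet (t i)) →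
      ρ {x | ∀ i < n, x i ∈ t i} = ∏ i ∈ Finset.range n, μ (t i)) :
    ρ = Measure.infinitePi fun _ : ℕ => μ := by
  classical
  refine Measure.eq_infinitePi _ fun s t ht => ?_
  obtain ⟨n, hn⟩ := s.exists_nat_subset_range
  have := h n (fun i => if i ∈ s then t i else Set.univ) (fun i => by split_ifs <;> simp [ht])
  rw [← Finset.prod_subset hn (fun i _ hi => by simp [hi])] at this
  rw [Finset.prod_congr rfl (g := fun i => μ (t i)) (fun i hi => by rw [if_pos hi])] at this
  rw [← this]
  congr 1
  ext x
  simp only [Set.mem_pi, SetLike.mem_coe, Set.mem_ofPred_eq]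
  constructor
  · intro hx i _
    split_ifs with hi
    exacts [hx i hi, trivial]
  · intro hx i hi
    simpa [hi] using hx i (Finset.mem_range.1 (hn hi))

end Product

/-! ### Head and tail of a sequence -/

section Cons

variable {X : Type*}

/-- The sequence `x` preceded by `a`. -/
def cons (a : X) (x : ℕ → X) : ℕ → X
  | 0 => a
  | n + 1 => x n

def shift (x : ℕ → X) : ℕ → X := fun n => x (n + 1)

@[simp] theorem cons_zero (a : X) (x : ℕ → X) : cons a x 0 = a := rfl
@[simp] theorem cons_succ (a : X) (x : ℕ → X) (n : ℕ) : cons a x (n + 1) = x n := rfl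
@[simp] theorem shift_apply (x : ℕ → X) (n : ℕ) : shift x n = x (n + 1) := rfl
@[simp] theorem cons_shift (x : ℕ → X) : cons (x 0) (shift x) = x := by
  ext n; cases n <;> rfl

variable [MeasurableSpace X]

@[fun_prop]
theorem measurable_shift : Measurable (shift : (ℕ → X) → ℕ → X) := by
  unfold shift; fun_prop

@[fun_prop]
theorem measurable_cons {Y : Type*} [MeasurableSpace Y] {f : Y → X} {g : Y → ℕ → X}
    (hf : Measurable f) (hg : Measurable g) : Measurable fun y => cons (f y) (g y) := by
  rw [measurable_pi_iff]
  rintro (_ | n)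
  · exact hf
  · exact (measurable_pi_apply n).comp hg

theorem measurePreserving_headTail (μ : Measure X) [IsProbabilityMeasure μ] :
    MeasurePreserving (fun x : ℕ → X => (x 0, shift x)) (Measure.infinitePi fun _ => μ)
      (μ.prod (Measure.infinitePi fun _ => μ)) := by
  have h1 := measurePreserving_split (fun _ : ℕ => μ) (f := fun _ : Unit => 0)
    (g := fun n : ℕ => n + 1) (by rintro (a | a) (b | b) h <;> simp_all)
  exact ((measurePreserving_eval_infinitePi (fun _ : Unit => μ) ()).prod
    (MeasurePreserving.id _)).comp h1

theorem measurePreserving_cons (μ : Measure X) [IsProbabilityMeasure μ] :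
    MeasurePreserving (fun q : X × (ℕ → X) => cons q.1 q.2)
      (μ.prod (Measure.infinitePi fun _ => μ)) (Measure.infinitePi fun _ => μ) := by
  refine ⟨by fun_prop, ?_⟩
  rw [← (measurePreserving_headTail μ).map_eq, Measure.map_map (by fun_prop) (by fun_prop)]
  convert Measure.map_id using 2
  ext x : 1
  simp

end Cons

/-! ### Sequential construction of independent sequences -/

section Run

variable {Ω X D : Type*}

/-- The sequence produced by a machine with states in `D`, reading its input in `Ω`. -/
def run (out : D → Ω → X) (nxt : D → Ω → D) (rest : D → Ω → Ω) : D → Ω → ℕ → X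
  | d, ω, 0 => out d ω
  | d, ω, n + 1 => run out nxt rest (nxt d ω) (rest d ω) n

variable [MeasurableSpace Ω] [MeasurableSpace X] [MeasurableSpace D] [Countable D]
  [MeasurableSingletonClass D]
  {out : D → Ω → X} {nxt : D → Ω → D} {rest : D → Ω → Ω}

theorem measurable_run_apply (ho : ∀ d, Measurable (out d)) (hn : ∀ d, Measurable (nxt d))
    (hr : ∀ d, Measurable (rest d)) (n : ℕ) (d : D) :
    Measurable fun ω => run out nxt rest d ω n := by
  induction n generalizing d with
  | zero => exact ho d
  | succ n ih =>
    have : Measurable fun q : D × Ω => run out nxt rest q.1 q.2 n :=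
      measurable_from_prod_countable_right fun d => ih d
    exact this.comp ((hn d).prodMk (hr d))

/-- A stopping rule may depend on what has been read, as long as the pair (output, next state) is
independent of the remaining input. The probability of the later outputs is the same from every
state, so the state can be summed out. -/
theorem measurePreserving_run {Q : Measure Ω} {μ : Measure X} [IsProbabilityMeasure Q]
    [IsProbabilityMeasure μ] (ho : ∀ d, MeasurePreserving (out d) Q μ)
    (hn : ∀ d, Measurable (nxt d)) (hr : ∀ d, MeasurePreserving (rest d) Q Q)
    (hind : ∀ d, IndepFun (fun ω => (out d ω, nxt d ω)) (rest d) Q) (d : D) :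
    MeasurePreserving (run out nxt rest d) Q (Measure.infinitePi fun _ : ℕ => μ) := by
  have hmeas := measurable_run_apply (fun d => (ho d).measurable) hn (fun d => (hr d).measurable)
  have hset : ∀ (n : ℕ) (t : ℕ → Set X), (∀ i, MeasurableSet (t i)) → ∀ d,
      MeasurableSet {ω | ∀ i < n, run out nxt rest d ω i ∈ t i} := fun n t ht d => by
    simp only [Set.ofPred_forall]
    exact MeasurableSet.iInter fun i => MeasurableSet.iInter fun _ => hmeas i d (ht i)
  have key : ∀ (n : ℕ) (t : ℕ → Set X), (∀ i, MeasurableSet (t i)) → ∀ d,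
      Q {ω | ∀ i < n, run out nxt rest d ω i ∈ t i} = ∏ i ∈ Finset.range n, μ (t i) := by
    intro n
    induction n with
    | zero => intro t _ d; simp
    | succ n ih =>
      intro t ht d
      -- The countably many values `e` of the next state decompose the event. On each piece the
      -- remaining input is read from the fixed state `e`, and independence applies.
      have hdec : {ω | ∀ i < n + 1, run out nxt rest d ω i ∈ t i} =
          ⋃ e : D, ((fun ω => (out d ω, nxt d ω)) ⁻¹' (t 0 ×ˢ {e})) ∩
            (rest d) ⁻¹' {ω | ∀ i < n, run out nxt rest e ω i ∈ t (i + 1)} := by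
        ext ω
        simp only [Set.mem_ofPred_eq, Set.mem_iUnion, Set.mem_inter_iff, Set.mem_preimage,
          Set.mem_prod, Set.mem_singleton_iff]
        constructor
        · intro h
          exact ⟨nxt d ω, ⟨h 0 (by omega), rfl⟩, fun i hi => h (i + 1) (by omega)⟩
        · rintro ⟨e, ⟨h0, rfl⟩, h⟩ i hi
          cases i with
          | zero => exact h0
          | succ i => exact h i (by omega)
      have hm1 : ∀ e, MeasurableSet ((fun ω => (out d ω, nxt d ω)) ⁻¹' (t 0 ×ˢ {e})) := fun e =>
        ((ho d).measurable.prodMk (hn d)) ((ht 0).prod (measurableSet_singleton e))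
      have ht' : ∀ i, MeasurableSet (t (i + 1)) := fun i => ht (i + 1)
      rw [hdec, measure_iUnion]
      · have : ∀ e, Q (((fun ω => (out d ω, nxt d ω)) ⁻¹' (t 0 ×ˢ {e})) ∩
            (rest d) ⁻¹' {ω | ∀ i < n, run out nxt rest e ω i ∈ t (i + 1)}) =
            Q ((fun ω => (out d ω, nxt d ω)) ⁻¹' (t 0 ×ˢ {e})) *
              ∏ i ∈ Finset.range n, μ (t (i + 1)) := fun e => by
          rw [(hind d).measure_inter_preimage_eq_mul _ _
            ((ht 0).prod (measurableSet_singleton e)) (hset n _ ht' e),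
            (hr d).measure_preimage (hset n _ ht' e).nullMeasurableSet, ih _ ht' e]
        simp_rw [this]
        rw [ENNReal.tsum_mul_right, ← measure_iUnion _ hm1, Finset.prod_range_succ', mul_comm]
        · congr 1
          rw [← (ho d).measure_preimage (ht 0).nullMeasurableSet]
          congr 1
          ext ω
          simp
        · intro e e' hee
          simp only [Function.onFun, Set.disjoint_left]
          rintro ω ⟨_, h1⟩ ⟨_, h2⟩
          exact hee (h1.symm.trans h2)
      · intro e e' hee
        simp only [Function.onFun, Set.disjoint_left]
        rintro ω ⟨⟨_, h1⟩, _⟩ ⟨⟨_, h2⟩, _⟩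
        exact hee (h1.symm.trans h2)
      · exact fun e => (hm1 e).inter ((hr d).measurable (hset n _ ht' e))
  have hm : Measurable (run out nxt rest d) := measurable_pi_iff.2 fun n => hmeas n d
  refine ⟨hm, eq_infinitePi_nat fun n t ht => ?_⟩
  rw [Measure.map_apply hm, ← key n t ht d]
  · rfl
  · simp only [Set.ofPred_forall]
    exact MeasurableSet.iInter fun i => MeasurableSet.iInter fun _ => measurable_pi_apply i (ht i)

end Run

/-! ### Rearranging products -/

section Rearrange

variable {A B C : Type*} [MeasurableSpace A] [MeasurableSpace B] [MeasurableSpace C]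

theorem measurePreserving_assoc (μ : Measure A) (ν : Measure B) (ρ : Measure C)
    [IsProbabilityMeasure μ] [IsProbabilityMeasure ν] [IsProbabilityMeasure ρ] :
    MeasurePreserving (fun q : (A × B) × C => (q.1.1, (q.1.2, q.2))) ((μ.prod ν).prod ρ)
      (μ.prod (ν.prod ρ)) := by
  refine ⟨by fun_prop, ?_⟩
  exact Measure.prodAssoc_prod

theorem measurePreserving_assoc_symm (μ : Measure A) (ν : Measure B) (ρ : Measure C)
    [IsProbabilityMeasure μ] [IsProbabilityMeasure ν] [IsProbabilityMeasure ρ] :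
    MeasurePreserving (fun q : A × B × C => ((q.1, q.2.1), q.2.2)) (μ.prod (ν.prod ρ))
      ((μ.prod ν).prod ρ) := by
  refine ⟨by fun_prop, ?_⟩
  rw [← (measurePreserving_assoc μ ν ρ).map_eq, Measure.map_map (by fun_prop) (by fun_prop)]
  exact Measure.map_id

theorem measurePreserving_leftComm (μ : Measure A) (ν : Measure B) (ρ : Measure C)
    [IsProbabilityMeasure μ] [IsProbabilityMeasure ν] [IsProbabilityMeasure ρ] :
    MeasurePreserving (fun q : A × B × C => (q.2.1, (q.1, q.2.2))) (μ.prod (ν.prod ρ))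
      (ν.prod (μ.prod ρ)) :=
  (measurePreserving_assoc ν μ ρ).comp ((Measure.measurePreserving_swap.prod
    (MeasurePreserving.id ρ)).comp (measurePreserving_assoc_symm μ ν ρ))

theorem indepFun_of_measurePreserving {Ω A' B' : Type*} [MeasurableSpace Ω] [MeasurableSpace A']
    [MeasurableSpace B'] {Q : Measure Ω} {μ : Measure A} {ν : Measure B} [IsProbabilityMeasure μ]
    [IsProbabilityMeasure ν] {f : Ω → A × B} (hf : MeasurePreserving f Q (μ.prod ν))
    {g : A → A'} {h : B → B'} (hg : Measurable g) (hh : Measurable h) :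
    IndepFun (fun ω => g (f ω).1) (fun ω => h (f ω).2) Q := by
  rw [indepFun_iff_measure_inter_preimage_eq_mul]
  intro s t hs ht
  have h1 := (indepFun_prod (μ := μ) (ν := ν) hg hh).measure_inter_preimage_eq_mul s t hs ht
  have hs' : MeasurableSet ((fun ω : A × B => g ω.1) ⁻¹' s) := (hg.comp measurable_fst) hs
  have ht' : MeasurableSet ((fun ω : A × B => h ω.2) ⁻¹' t) := (hh.comp measurable_snd) ht
  rw [← hf.measure_preimage hs'.nullMeasurableSet, ← hf.measure_preimage ht'.nullMeasurableSet,
    ← hf.measure_preimage (hs'.inter ht').nullMeasurableSet] at h1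
  exact h1

theorem measure_eq_lintegral_of_measurePreserving {μ : Measure A} {ν : Measure B}
    [IsProbabilityMeasure ν] {ρ : Measure C} {f : A × B → C} (hf : MeasurePreserving f (μ.prod ν) ρ) {S : Set C}
    (hS : MeasurableSet S) : ρ S = ∫⁻ a, ν {b | f (a, b) ∈ S} ∂μ := by
  rw [← hf.measure_preimage hS.nullMeasurableSet, Measure.prod_apply (hf.measurable hS)]
  rfl

end Rearrange

/-! ### Layers -/

/-- The triangles and the edges of a layer, from left to right. -/
abbrev Layer : Type := ℕ → Bool × Bool

abbrev Env : Type := ℤ → Layer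

/-- The Bernoulli law of parameter `q`. -/
noncomputable def bit (q : ℝ) : Measure Bool :=
  bernoulliMeasure true false (Set.projIcc (0 : ℝ) 1 zero_le_one q)

instance (q : ℝ) : IsProbabilityMeasure (bit q) := by unfold bit; infer_instance

noncomputable def pairLaw (α p : ℝ) : Measure (Bool × Bool) := (bit α).prod (bit p)

instance (α p : ℝ) : IsProbabilityMeasure (pairLaw α p) := by unfold pairLaw; infer_instance

/-- The law of a layer: orientations and states of the edges. -/
noncomputable def layerLaw (α p : ℝ) : Measure Layer := Measure.infinitePi fun _ => pairLaw α p

instance (α p : ℝ) : IsProbabilityMeasure (layerLaw α p) := by unfold layerLaw; infer_instance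

noncomputable def layersLaw (α p : ℝ) : Measure (ℕ → Layer) :=
  Measure.infinitePi fun _ => layerLaw α p

instance (α p : ℝ) : IsProbabilityMeasure (layersLaw α p) := by unfold layersLaw; infer_instance

/-- The law of the environment. -/
noncomputable def envLaw (α p : ℝ) : Measure Env := Measure.infinitePi fun _ => layerLaw α p

instance (α p : ℝ) : IsProbabilityMeasure (envLaw α p) := by unfold envLaw; infer_instance

/-- The number of triangles of orientation `c` among the first `t` triangles. -/
def cnt (c : Bool) (x : Layer) (t : ℕ) : ℕ := Nat.count (fun i => (x i).1 = c) t

/-- The number of triangles preceding the `d`-th triangle of orientation `c`, included. -/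
noncomputable def hit (c : Bool) (d : ℕ) (x : Layer) : ℕ := sInf {t | cnt c x t = d}

/-- The number of triangles of orientation `!c` preceding the `d`-th one of orientation `c`. -/
noncomputable def skipped (c : Bool) (d : ℕ) (x : Layer) : ℕ := hit c d x - d

/-- The layer `x` up to its `d`-th triangle of orientation `c`, followed by the layer `x'`. -/
def concat (c : Bool) (d : ℕ) (x x' : Layer) : Layer :=
  run (fun d (q : Layer × Layer) => if d = 0 then q.2 0 else q.1 0)
    (fun d q => if d = 0 then 0 else if (q.1 0).1 = c then d - 1 else d)
    (fun d q => if d = 0 then (q.1, shift q.2) else (shift q.1, q.2)) d (x, x')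

theorem concat_zero (c : Bool) (x x' : Layer) : concat c 0 x x' = x' := by
  ext1 t
  unfold concat
  induction t generalizing x' with
  | zero => simp [run]
  | succ t ih => simpa [run] using ih (shift x')

theorem concat_succ (c : Bool) (d : ℕ) (x x' : Layer) : concat c (d + 1) x x' =
    cons (x 0) (concat c (if (x 0).1 = c then d else d + 1) (shift x) x') := by
  ext1 t
  cases t <;> simp [concat, run]

/-- This is a machine whose state is the number of triangles of orientation `c` still to be read: it
copies the first layer while the state is positive, then the second one. In each state the part left
unread is independent of the output. -/
theorem measurePreserving_concat (α p : ℝ) (c : Bool) (d : ℕ) :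
    MeasurePreserving (fun q : Layer × Layer => concat c d q.1 q.2)
      ((layerLaw α p).prod (layerLaw α p)) (layerLaw α p) := by
  have hd := measurePreserving_headTail (pairLaw α p)
  have h0 : MeasurePreserving (fun q : Layer × Layer => (q.2 0, (shift q.2, q.1)))
      ((layerLaw α p).prod (layerLaw α p))
      ((pairLaw α p).prod ((layerLaw α p).prod (layerLaw α p))) :=
    (measurePreserving_assoc _ _ _).comp ((hd.prod (MeasurePreserving.id _)).comp
      Measure.measurePreserving_swap)
  have h1 : MeasurePreserving (fun q : Layer × Layer => (q.1 0, (shift q.1, q.2)))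
      ((layerLaw α p).prod (layerLaw α p))
      ((pairLaw α p).prod ((layerLaw α p).prod (layerLaw α p))) :=
    (measurePreserving_assoc _ _ _).comp (hd.prod (MeasurePreserving.id _))
  refine measurePreserving_run (fun e => ?_) (fun e => ?_) (fun e => ?_) (fun e => ?_) d
  · by_cases he : e = 0
    · simpa [he, Function.comp_def] using measurePreserving_fst.comp h0
    · simpa [he, Function.comp_def] using measurePreserving_fst.comp h1
  · by_cases he : e = 0
    · simp [he]
    · simp only [he, if_false]
      exact Measurable.ite (measurableSet_eq_fun (by fun_prop) measurable_const)
        measurable_const measurable_const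
  · by_cases he : e = 0
    · simpa [he, Function.comp_def] using
        Measure.measurePreserving_swap.comp (measurePreserving_snd.comp h0)
    · simpa [he, Function.comp_def] using measurePreserving_snd.comp h1
  · by_cases he : e = 0
    · simpa [he] using indepFun_of_measurePreserving h0 (g := fun b => (b, (0 : ℕ)))
        (h := Prod.swap) (by fun_prop) (by fun_prop)
    · simpa [he] using indepFun_of_measurePreserving h1
        (g := fun b => (b, if b.1 = c then e - 1 else e))
        (h := id) (by fun_prop) (by fun_prop)

theorem measurable_cnt (c : Bool) (t : ℕ) : Measurable fun x : Layer => cnt c x t := by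
  unfold cnt
  induction t with
  | zero => simp
  | succ t ih =>
    simp only [Nat.count_succ]
    exact ih.add (Measurable.ite (measurableSet_eq_fun (by fun_prop) measurable_const)
        measurable_const measurable_const)

theorem measurable_sInf_nat {Ω : Type*} [MeasurableSpace Ω] {S : Ω → ℕ → Prop}
    (h : ∀ t, MeasurableSet {ω | S ω t}) : Measurable fun ω => sInf {t | S ω t} := by
  refine measurable_to_countable' fun k => ?_
  -- The second set of the union accounts for the convention `sInf ∅ = 0`.
  have : (fun ω => sInf {t | S ω t}) ⁻¹' {k} =
      {ω | S ω k ∧ ∀ i < k, ¬ S ω i} ∪ {ω | k = 0 ∧ ∀ i, ¬ S ω i} := by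
    ext ω
    simp only [Set.mem_preimage, Set.mem_singleton_iff, Set.mem_union, Set.mem_ofPred_eq]
    constructor
    · rintro rfl
      by_cases hne : {t | S ω t}.Nonempty
      · exact .inl ⟨Nat.sInf_mem hne, fun i hi => Nat.notMem_of_lt_sInf hi⟩
      · rw [Set.not_nonempty_iff_eq_empty] at hne
        refine .inr ⟨by simp [hne], fun i hi => ?_⟩
        have : i ∈ {t | S ω t} := hi
        simp [hne] at this
    · rintro (⟨h1, h2⟩ | ⟨rfl, h2⟩)
      · refine le_antisymm (Nat.sInf_le h1) (not_lt.1 fun hlt => h2 _ hlt ?_)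
        exact Nat.sInf_mem (s := {t | S ω t}) ⟨k, h1⟩
      · have : {t | S ω t} = ∅ := by ext i; simp [h2]
        simp [this]
  rw [this]
  refine MeasurableSet.union ((h k).inter ?_) (MeasurableSet.inter (.const _) ?_)
  · change MeasurableSet {ω | ∀ i < k, ¬ S ω i}
    simp only [Set.ofPred_forall]
    exact MeasurableSet.iInter fun i => MeasurableSet.iInter fun _ => (h i).compl
  · change MeasurableSet {ω | ∀ i, ¬ S ω i}
    simp only [Set.ofPred_forall]
    exact MeasurableSet.iInter fun i => (h i).compl

theorem measurable_hit (c : Bool) (d : ℕ) : Measurable (hit c d) :=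
  measurable_sInf_nat fun t => measurable_cnt c t (measurableSet_singleton d)

theorem measurable_skipped (c : Bool) (d : ℕ) : Measurable (skipped c d) :=
  (measurable_hit c d).sub measurable_const

/-- The successive shifts of the layers `U 0`, `U 1`, ... when the first one is shifted to its
`d`-th triangle of orientation `c`. -/
noncomputable def off (c : Bool) (d : ℕ) (U : ℕ → Layer) : ℕ → ℕ
  | 0 => d
  | n + 1 => skipped c (off c d U n) (U n)

theorem off_succ' (c : Bool) (d : ℕ) (U : ℕ → Layer) (n : ℕ) :
    off c d U (n + 1) = off c (skipped c d (U 0)) (shift U) n := by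
  induction n with
  | zero => rfl
  | succ n ih => rw [off, ih]; rfl

theorem measurable_off (c : Bool) (d n : ℕ) : Measurable fun U => off c d U n := by
  induction n with
  | zero => exact measurable_const
  | succ n ih =>
    have : Measurable fun q : ℕ × Layer => skipped c q.1 q.2 :=
      measurable_from_prod_countable_right fun d => measurable_skipped c d
    exact this.comp (ih.prodMk (measurable_pi_apply n))

/-- The layers `U' n` glued to the right of the explored parts of the layers `U n`. -/
noncomputable def glueSeq (c : Bool) (d : ℕ) (U U' : ℕ → Layer) (n : ℕ) : Layer :=
  concat c (off c d U n) (U n) (U' n)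

/-- A second machine, reading one pair of layers at a time: its state is the current shift, and the
next shift depends only on the explored part of the layer that has just been read. -/
theorem measurePreserving_glueSeq (α p : ℝ) (c : Bool) (d : ℕ) :
    MeasurePreserving (fun q : (ℕ → Layer) × (ℕ → Layer) => glueSeq c d q.1 q.2)
      ((layersLaw α p).prod (layersLaw α p)) (layersLaw α p) := by
  have hrun : (fun q : (ℕ → Layer) × (ℕ → Layer) => glueSeq c d q.1 q.2) =
      run (fun d (q : (ℕ → Layer) × (ℕ → Layer)) => concat c d (q.1 0) (q.2 0))
        (fun d q => skipped c d (q.1 0)) (fun _ q => (shift q.1, shift q.2)) d := by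
    ext1 ⟨U, U'⟩
    ext1 n
    induction n generalizing d U U' with
    | zero => rfl
    | succ n ih => simp only [run, ← ih, glueSeq, off_succ']; rfl
  rw [hrun]
  have hd := measurePreserving_headTail (layerLaw α p)
  have h1 : MeasurePreserving (fun q : (ℕ → Layer) × (ℕ → Layer) =>
      ((q.1 0, q.2 0), (shift q.1, shift q.2)))
      ((layersLaw α p).prod (layersLaw α p))
      (((layerLaw α p).prod (layerLaw α p)).prod ((layersLaw α p).prod (layersLaw α p))) :=
    (measurePreserving_assoc_symm _ _ _).comp (((MeasurePreserving.id _).prod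
      (measurePreserving_leftComm _ _ _)).comp
      ((measurePreserving_assoc _ _ _).comp (hd.prod hd)))
  refine measurePreserving_run (fun e => ?_) (fun e => ?_) (fun e => ?_) (fun e => ?_) d
  · exact (measurePreserving_concat α p c e).comp (measurePreserving_fst.comp h1)
  · exact (measurable_skipped c e).comp ((measurable_pi_apply 0).comp measurable_fst)
  · exact measurePreserving_snd.comp h1
  · exact indepFun_of_measurePreserving h1 (g := fun b => (concat c e b.1 b.2, skipped c e b.1))
      (h := id) ((measurePreserving_concat α p c e).measurable.prodMk
        ((measurable_skipped c e).comp measurable_fst)) measurable_id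

/-! ### Environments -/

def up (E : Env) : ℕ → Layer := fun n => E (n + 1)

/-- `down E n` is the layer just below height `-n`, and `up E n` the layer just above height `n +
1`. -/
def down (E : Env) : ℕ → Layer := fun n => E (-1 - n)

def assemble (x : Layer) (U D : ℕ → Layer) : Env
  | .ofNat 0 => x
  | .ofNat (n + 1) => U n
  | .negSucc n => D n

theorem assemble_zero (x : Layer) (U D : ℕ → Layer) : assemble x U D 0 = x := rfl

theorem assemble_pos (x : Layer) (U D : ℕ → Layer) (n : ℕ) : assemble x U D (n + 1) = U n := rfl

theorem assemble_neg (x : Layer) (U D : ℕ → Layer) (n : ℕ) : assemble x U D (-1 - n) = D n := by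
  rw [show (-1 - n : ℤ) = .negSucc n by omega]; rfl

@[simp] theorem down_assemble (x : Layer) (U D : ℕ → Layer) : down (assemble x U D) = D := by
  ext1 n; exact assemble_neg x U D n

theorem assemble_up_down (E : Env) : assemble (E 0) (up E) (down E) = E := by
  ext1 j
  rcases j with (_ | n) | n
  · rfl
  · rfl
  · change E (-1 - n) = _
    congr 1
    omega

@[fun_prop]
theorem measurable_assemble : Measurable fun q : Layer × (ℕ → Layer) × (ℕ → Layer) =>
    assemble q.1 q.2.1 q.2.2 := by
  refine measurable_pi_iff.2 fun j => ?_
  rcases j with (_ | n) | n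
  · exact measurable_fst
  · exact (measurable_pi_apply n).comp measurable_snd.fst
  · exact (measurable_pi_apply n).comp measurable_snd.snd

theorem measurePreserving_disassemble (α p : ℝ) :
    MeasurePreserving (fun E : Env => (E 0, (up E, down E))) (envLaw α p)
      ((layerLaw α p).prod ((layersLaw α p).prod (layersLaw α p))) := by
  have h1 := measurePreserving_split (fun _ : ℤ => layerLaw α p) (f := fun _ : Unit => 0)
    (g := Sum.elim (fun n : ℕ => (n + 1 : ℤ)) (fun n : ℕ => -1 - (n : ℤ)))
    (by rintro (a | a | a) (b | b | b) h <;> simp at h ⊢ <;> omega)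
  exact ((measurePreserving_eval_infinitePi (fun _ : Unit => layerLaw α p) ()).prod
    (measurePreserving_split_sum fun _ => layerLaw α p)).comp h1

theorem measurePreserving_assemble (α p : ℝ) :
    MeasurePreserving (fun q : Layer × (ℕ → Layer) × (ℕ → Layer) => assemble q.1 q.2.1 q.2.2)
      ((layerLaw α p).prod ((layersLaw α p).prod (layersLaw α p))) (envLaw α p) := by
  refine ⟨measurable_assemble, ?_⟩
  rw [← (measurePreserving_disassemble α p).map_eq, Measure.map_map measurable_assemble
    (measurePreserving_disassemble α p).measurable]
  convert Measure.map_id using 2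
  ext1 E
  exact assemble_up_down E

/-- The environment seen from height `k`. -/
def levelShift (k : ℤ) (E : Env) : Env := fun j => E (j + k)

theorem measurePreserving_levelShift (α p : ℝ) (k : ℤ) :
    MeasurePreserving (levelShift k) (envLaw α p) (envLaw α p) :=
  measurePreserving_reindex (fun _ : ℤ => layerLaw α p) (f := fun j => j + k)
    (add_left_injective k)

/-- The depth of the exploration downwards when the triangle to the right of the current edge is
bottom-oriented. -/
noncomputable def depth (D : ℕ → Layer) : ℕ := sInf {n | off true 1 D n = 0}

theorem measurable_depth : Measurable depth :=
  measurable_sInf_nat fun n => measurable_off true 1 n (measurableSet_singleton 0)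

/-- Open the first edge of layer `0`. -/
def openFirst (E : Env) : Env :=
  assemble (cons ((E 0 0).1, true) (shift (E 0))) (up E) (down E)

/-- The environment obtained from the explored part described by `u` and from the environment `E`
seen from the next position of the exploration. -/
noncomputable def glue (u E : Env) : Env :=
  if (u 0 0).2 = true then openFirst (levelShift (-1) E)
  else if (u 0 0).1 = true then
    assemble (cons (u 0 0) (E 0)) (glueSeq false 1 (up u) (up E)) (down E)
  else
    let E' := levelShift (depth (down u)) E
    assemble (cons (u 0 0) (E' 0)) (up E') (glueSeq true 1 (down u) (down E'))

theorem measurable_levelShift (k : ℤ) : Measurable (levelShift k) := by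
  unfold levelShift; fun_prop

theorem measurable_openFirst : Measurable openFirst := by
  have h : Measurable fun E : Env => (cons ((E 0 0).1, true) (shift (E 0)), (up E, down E)) := by
    unfold up down
    fun_prop
  exact measurable_assemble.comp h

theorem measurable_glue : Measurable fun q : Env × Env => glue q.1 q.2 := by
  have hb : Measurable fun q : Env × Env => q.1 0 0 := by fun_prop
  have hup : Measurable up := by unfold up; fun_prop
  have hdown : Measurable down := by unfold down; fun_prop
  have hglue : ∀ c, Measurable fun q : (ℕ → Layer) × (ℕ → Layer) => glueSeq c 1 q.1 q.2 :=
    fun c => (measurePreserving_glueSeq (1 / 2) (1 / 2) c 1).measurable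
  have hshift : Measurable fun q : Env × Env => levelShift (depth (down q.1)) q.2 := by
    have : Measurable fun q : ℕ × Env => levelShift q.1 q.2 :=
      measurable_from_prod_countable_right fun n => measurable_levelShift n
    exact this.comp ((measurable_depth.comp (hdown.comp measurable_fst)).prodMk measurable_snd)
  unfold glue
  refine Measurable.ite (measurableSet_eq_fun hb.snd measurable_const) ?_
    (Measurable.ite (measurableSet_eq_fun hb.fst measurable_const) ?_ ?_)
  · exact (measurable_openFirst.comp (measurable_levelShift _)).comp measurable_snd
  · exact measurable_assemble.comp ((measurable_cons hb ((measurable_pi_apply 0).comp measurable_snd)).prodMk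
      (((hglue false).comp ((hup.comp measurable_fst).prodMk (hup.comp measurable_snd))).prodMk
        (hdown.comp measurable_snd)))
  · exact measurable_assemble.comp ((measurable_cons hb ((measurable_pi_apply 0).comp hshift)).prodMk
      ((hup.comp hshift).prodMk ((hglue true).comp ((hdown.comp measurable_fst).prodMk
        (hdown.comp hshift)))))

/-- An environment is made of the first pair of layer `0` and of independent remaining parts. -/
theorem measurePreserving_assemble_cons (α p : ℝ) :
    MeasurePreserving (fun q : (Bool × Bool) × Layer × (ℕ → Layer) × (ℕ → Layer) =>
      assemble (cons q.1 q.2.1) q.2.2.1 q.2.2.2)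
      ((pairLaw α p).prod ((layerLaw α p).prod ((layersLaw α p).prod (layersLaw α p))))
      (envLaw α p) :=
  (measurePreserving_assemble α p).comp (((measurePreserving_cons (pairLaw α p)).prod
    (MeasurePreserving.id _)).comp (measurePreserving_assoc_symm _ _ _))

theorem envLaw_eq_lintegral (α p : ℝ) {A : Set Env} (hA : MeasurableSet A) :
    envLaw α p A = ∫⁻ b, ((layerLaw α p).prod ((layersLaw α p).prod (layersLaw α p)))
      {y | assemble (cons b y.1) y.2.1 y.2.2 ∈ A} ∂(pairLaw α p) :=
  measure_eq_lintegral_of_measurePreserving (measurePreserving_assemble_cons α p) hA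

theorem measurePreserving_record (α p : ℝ) :
    MeasurePreserving (fun E : Env => (E 0 0, (up E, down E))) (envLaw α p)
      ((pairLaw α p).prod ((layersLaw α p).prod (layersLaw α p))) :=
  ((measurePreserving_eval_infinitePi (fun _ : ℕ => pairLaw α p) 0).prod
    (MeasurePreserving.id _)).comp (measurePreserving_disassemble α p)

theorem measurePreserving_glue_top (α p : ℝ) :
    MeasurePreserving (fun q : ((ℕ → Layer) × (ℕ → Layer)) × Env =>
      (q.2 0, (glueSeq false 1 q.1.1 (up q.2), down q.2)))
      (((layersLaw α p).prod (layersLaw α p)).prod (envLaw α p))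
      ((layerLaw α p).prod ((layersLaw α p).prod (layersLaw α p))) :=
  ((MeasurePreserving.id _).prod ((measurePreserving_glueSeq α p false 1).prod
    (MeasurePreserving.id _))).comp (((MeasurePreserving.id _).prod
      (measurePreserving_assoc_symm _ _ _)).comp ((measurePreserving_leftComm _ _ _).comp
        (measurePreserving_fst.prod (measurePreserving_disassemble α p))))

/-- The recentring by `depth` is harmless because `depth` is a function of the explored layers,
independent of the unexplored environment, whose law is invariant under vertical shifts. -/
theorem measurePreserving_glue_bottom (α p : ℝ) :
    MeasurePreserving (fun q : ((ℕ → Layer) × (ℕ → Layer)) × Env =>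
      (levelShift (depth q.1.2) q.2 0, (up (levelShift (depth q.1.2) q.2),
        glueSeq true 1 q.1.2 (down (levelShift (depth q.1.2) q.2)))))
      (((layersLaw α p).prod (layersLaw α p)).prod (envLaw α p))
      ((layerLaw α p).prod ((layersLaw α p).prod (layersLaw α p))) := by
  have h1 : MeasurePreserving (fun q : ((ℕ → Layer) × (ℕ → Layer)) × Env =>
      (q.1.2, levelShift (depth q.1.2) q.2))
      (((layersLaw α p).prod (layersLaw α p)).prod (envLaw α p))
      ((layersLaw α p).prod (envLaw α p)) := by
    refine MeasurePreserving.skew_product (g := fun q => levelShift (depth q.2))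
      measurePreserving_snd ?_ (ae_of_all _ fun q => ?_)
    · have : Measurable fun q : ℕ × Env => levelShift q.1 q.2 :=
        measurable_from_prod_countable_right fun n => measurable_levelShift n
      exact this.comp ((measurable_depth.comp measurable_fst.snd).prodMk measurable_snd)
    · exact (measurePreserving_levelShift α p _).map_eq
  exact ((MeasurePreserving.id _).prod ((MeasurePreserving.id _).prod
    (measurePreserving_glueSeq α p true 1))).comp (((MeasurePreserving.id _).prod
      (measurePreserving_leftComm _ _ _)).comp ((measurePreserving_leftComm _ _ _).comp
        (((MeasurePreserving.id _).prod (measurePreserving_disassemble α p)).comp h1)))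

/-- The spatial Markov property. Conditionally on the first pair, a closed first edge leaves a rest
made of independent layers, prolonged at their stopping places. If the edge is open, the environment
seen from above keeps a fresh bit on the edge just crossed, which `openFirst` overwrites; the
orientation is also the fresh one. -/
theorem measurePreserving_glue (α p : ℝ) :
    MeasurePreserving (fun q : Env × Env => glue q.1 q.2) ((envLaw α p).prod (envLaw α p))
      (envLaw α p) := by
  refine ⟨measurable_glue, Measure.ext fun A hA => ?_⟩
  rw [Measure.map_apply measurable_glue hA]
  have hF := fun (A' : Set Env) (hA' : MeasurableSet A') => envLaw_eq_lintegral α p hA'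
  have hasm := measurePreserving_assemble_cons α p
  let g : ((Bool × Bool) × ((ℕ → Layer) × (ℕ → Layer))) × Env → Env := fun q =>
    if q.1.1.2 = true then openFirst (levelShift (-1) q.2)
    else if q.1.1.1 = true then
      assemble (cons q.1.1 (q.2 0)) (glueSeq false 1 q.1.2.1 (up q.2)) (down q.2)
    else assemble (cons q.1.1 (levelShift (depth q.1.2.2) q.2 0)) (up (levelShift (depth q.1.2.2) q.2))
      (glueSeq true 1 q.1.2.2 (down (levelShift (depth q.1.2.2) q.2)))
  have hasmb : ∀ b, Measurable fun y : Layer × (ℕ → Layer) × (ℕ → Layer) =>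
      assemble (cons b y.1) y.2.1 y.2.2 := fun b => hasm.measurable.comp measurable_prodMk_left
  have hg : ∀ b, Measurable fun q : ((ℕ → Layer) × (ℕ → Layer)) × Env => g ((b, q.1), q.2) := by
    rintro ⟨b1, b2⟩
    cases b2
    · cases b1
      · simpa [g, Function.comp_def] using (hasmb (false, false)).comp (measurePreserving_glue_bottom α p).measurable
      · simpa [g, Function.comp_def] using (hasmb (true, false)).comp (measurePreserving_glue_top α p).measurable
    · simpa [g, Function.comp_def] using
        (measurable_openFirst.comp (measurable_levelShift (-1))).comp measurable_snd
  have hgm : Measurable g := by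
    have : Measurable fun q : (Bool × Bool) × (((ℕ → Layer) × (ℕ → Layer)) × Env) =>
      g ((q.1, q.2.1), q.2.2) := measurable_from_prod_countable_right hg
    exact this.comp (measurePreserving_assoc (pairLaw α p) ((layersLaw α p).prod (layersLaw α p)) (envLaw α p)).measurable
  have h1 : (envLaw α p).prod (envLaw α p) ((fun q : Env × Env => glue q.1 q.2) ⁻¹' A) =
      ∫⁻ b, ((layersLaw α p).prod (layersLaw α p)).prod (envLaw α p) {q | g ((b, q.1), q.2) ∈ A} ∂(pairLaw α p) := by
    have e1 := ((measurePreserving_assoc (pairLaw α p) ((layersLaw α p).prod (layersLaw α p)) (envLaw α p)).comp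
      ((measurePreserving_record α p).prod (MeasurePreserving.id (envLaw α p))))
    have hS : MeasurableSet {q : (Bool × Bool) × (((ℕ → Layer) × (ℕ → Layer)) × Env) |
        g ((q.1, q.2.1), q.2.2) ∈ A} :=
      (measurable_from_prod_countable_right hg :
        Measurable fun q : (Bool × Bool) × (((ℕ → Layer) × (ℕ → Layer)) × Env) =>
          g ((q.1, q.2.1), q.2.2)) hA
    have e2 := e1.measure_preimage hS.nullMeasurableSet
    rw [Measure.prod_apply hS] at e2
    exact e2
  -- Both sides are integrals over the first pair. The state of the edge is made the outer variable,
  -- since only the open case needs an average over the orientation.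
  rw [h1, hF A hA, pairLaw, lintegral_prod_symm, lintegral_prod_symm]
  rotate_left
  · exact (measurable_of_countable _).aemeasurable
  · exact (measurable_of_countable _).aemeasurable
  refine lintegral_congr fun w => ?_
  cases w
  · refine lintegral_congr fun o => ?_
    cases o
    · have := (measurePreserving_glue_bottom α p).measure_preimage
        (hasmb (false, false) hA).nullMeasurableSet
      refine Eq.trans ?_ this
      congr 1
    · have := (measurePreserving_glue_top α p).measure_preimage
        (hasmb (true, false) hA).nullMeasurableSet
      refine Eq.trans ?_ this
      congr 1
  -- In the open case the left side does not depend on the orientation stored in `u`. The right side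
  -- is recovered by decomposing the fresh environment, whose bit plays no role once overwritten
  -- (`h3`).
  · have h2 : ∀ o, ((layersLaw α p).prod (layersLaw α p)).prod (envLaw α p) {q | g ((((o, true) : Bool × Bool), q.1), q.2) ∈ A} =
        envLaw α p (openFirst ⁻¹' A) := fun o => by
      rw [← ((measurePreserving_levelShift α p (-1)).comp
        (measurePreserving_snd (μ := (layersLaw α p).prod (layersLaw α p)))).measure_preimage
          (measurable_openFirst hA).nullMeasurableSet]
      congr 1
    simp_rw [h2]
    rw [lintegral_const, measure_univ, mul_one, hF _ (measurable_openFirst hA), pairLaw,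
      lintegral_prod _ (measurable_of_countable _).aemeasurable]
    refine lintegral_congr fun o => ?_
    have h3 : ∀ w, {y : Layer × (ℕ → Layer) × (ℕ → Layer) |
        assemble (cons ((o, w) : Bool × Bool) y.1) y.2.1 y.2.2 ∈ openFirst ⁻¹' A} =
        {y | assemble (cons ((o, true) : Bool × Bool) y.1) y.2.1 y.2.2 ∈ A} := fun w => by
      ext y
      simp only [Set.mem_ofPred_eq, Set.mem_preimage, openFirst, down_assemble]
      rfl
    simp_rw [h3]
    rw [lintegral_const, measure_univ, mul_one]

/-! ### Counting triangles -/

/-- Each orientation occurs infinitely often. -/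
def GoodLayer (x : Layer) : Prop := ∀ c d, ∃ t, cnt c x t = d

theorem cnt_mono (c : Bool) (x : Layer) : Monotone (cnt c x) := Nat.count_monotone _

theorem cnt_true_add_false (x : Layer) (t : ℕ) : cnt true x t + cnt false x t = t := by
  unfold cnt
  induction t with
  | zero => simp
  | succ t ih =>
    rw [Nat.count_succ, Nat.count_succ]
    cases (x t).1 <;> simp <;> omega

theorem cnt_add_not (c : Bool) (x : Layer) (t : ℕ) : cnt c x t + cnt (!c) x t = t := by
  have := cnt_true_add_false x t
  cases c <;> simp <;> omega

theorem cnt_hit {c : Bool} {x : Layer} (hx : GoodLayer x) (d : ℕ) : cnt c x (hit c d x) = d :=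
  Nat.sInf_mem (s := {t | cnt c x t = d}) (hx c d)

theorem cnt_lt_of_lt_hit {c : Bool} {x : Layer} (hx : GoodLayer x) {d t : ℕ}
    (ht : t < hit c d x) : cnt c x t < d := by
  have h1 : cnt c x t ≤ d := (cnt_mono c x ht.le).trans_eq (cnt_hit hx d)
  exact lt_of_le_of_ne h1 fun h => Nat.notMem_of_lt_sInf ht h

theorem cnt_not_hit {c : Bool} {x : Layer} (hx : GoodLayer x) (d : ℕ) :
    cnt (!c) x (hit c d x) = skipped c d x := by
  have := cnt_add_not c x (hit c d x)
  rw [cnt_hit hx] at this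
  unfold skipped
  omega

@[simp] theorem hit_zero (c : Bool) (x : Layer) : hit c 0 x = 0 :=
  Nat.le_zero.1 (Nat.sInf_le (by simp [cnt]))

@[simp] theorem skipped_zero (c : Bool) (x : Layer) : skipped c 0 x = 0 := by simp [skipped]

theorem cnt_succ_shift (c : Bool) (x : Layer) (t : ℕ) :
    cnt c x (t + 1) = cnt c (shift x) t + if (x 0).1 = c then 1 else 0 := by
  unfold cnt
  rw [Nat.count_succ']
  rfl

theorem GoodLayer.shift {x : Layer} (hx : GoodLayer x) : GoodLayer (shift x) := by
  intro c d
  obtain ⟨t, ht⟩ := hx c (d + 1)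
  cases t with
  | zero => simp [cnt] at ht
  | succ t =>
    rw [cnt_succ_shift] at ht
    by_cases h : (x 0).1 = c
    · exact ⟨t, by simpa [h] using ht⟩
    · simp only [h, if_false, add_zero] at ht
      have h2 : d ≤ cnt c (SCTHP.shift x) t := by omega
      by_contra hne
      push Not at hne
      have : ∀ s, cnt c (SCTHP.shift x) s < d ∨ d < cnt c (SCTHP.shift x) s := fun s => lt_or_gt_of_ne (hne s)
      -- The count starts at zero and grows by at most one, so it cannot jump over `d`.
      have h3 : ∀ s, cnt c (SCTHP.shift x) s < d := by
        intro s
        induction s with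
        | zero =>
          rcases this 0 with h | h
          · exact h
          · rw [show cnt c (SCTHP.shift x) 0 = 0 from Nat.count_zero _] at h; omega
        | succ s ih =>
          rcases this (s + 1) with h | h
          · exact h
          · have : cnt c (SCTHP.shift x) (s + 1) ≤ cnt c (SCTHP.shift x) s + 1 := by
              unfold cnt
              rw [Nat.count_succ]
              split_ifs <;> omega
            omega
      exact absurd (h3 t) (by omega)

theorem hit_succ {c : Bool} {x : Layer} (hx : GoodLayer x) (d : ℕ) :
    hit c (d + 1) x = 1 + hit c (if (x 0).1 = c then d else d + 1) (shift x) := by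
  have h0 : hit c (d + 1) x ≠ 0 := by
    intro h
    have := cnt_hit (c := c) hx (d + 1)
    rw [h] at this
    simp [cnt] at this
  set e := if (x 0).1 = c then d else d + 1 with he
  have h1 := cnt_succ_shift c x (hit c e (shift x))
  rw [cnt_hit hx.shift] at h1
  have h2 : cnt c x (hit c e (shift x) + 1) = d + 1 := by
    rw [h1, he]; split_ifs <;> rfl
  have h2' : hit c (d + 1) x ≤ hit c e (shift x) + 1 := Nat.sInf_le h2
  refine le_antisymm (by omega) ?_
  obtain ⟨k, hk⟩ := Nat.exists_eq_succ_of_ne_zero h0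
  have h3 := cnt_hit (c := c) hx (d + 1)
  rw [hk, Nat.succ_eq_add_one, cnt_succ_shift] at h3
  have h4 : cnt c (shift x) k = e := by
    rw [he]
    split_ifs with h <;> simp [h] at h3 <;> omega
  have : hit c e (shift x) ≤ k := Nat.sInf_le h4
  omega

theorem concat_apply {c : Bool} {x : Layer} (hx : GoodLayer x) (d : ℕ) (x' : Layer) (t : ℕ) :
    concat c d x x' t = if t < hit c d x then x t else x' (t - hit c d x) := by
  induction t generalizing d x with
  | zero =>
    cases d with
    | zero => simp [concat_zero]
    | succ d => simp [concat_succ, hit_succ hx]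
  | succ t ih =>
    cases d with
    | zero => simp [concat_zero]
    | succ d =>
      rw [concat_succ, cons_succ, ih hx.shift, hit_succ hx]
      simp only [shift_apply]
      split_ifs <;> first | rfl | omega | (congr 1; omega)

theorem layerEdge_eq_cnt (x : Layer) (t : ℕ) :
    layerEdge (fun i => (x i).1) t = (cnt false x t, cnt true x t) := by
  unfold cnt
  induction t with
  | zero => rfl
  | succ t ih =>
    rw [layerEdge, ih, Nat.count_succ, Nat.count_succ]
    cases h : (x t).1 <;> simp

/-! ### Open steps -/

/-- The open steps of the environment `E`. -/
def Step (E : Env) : Vertex → Vertex → Prop :=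
  OpenStep (fun e => (E e.1 e.2).1) (fun e => (E e.1 e.2).2)

theorem step_iff {E : Env} {v w : Vertex} : Step E v w ↔ ∃ j t, (E j t).2 = true ∧
    v = (cnt false (E j) t, j) ∧ w = (cnt true (E j) t, j + 1) := by
  unfold Step OpenStep edge
  simp only [layerEdge_eq_cnt, Prod.exists, Prod.mk.injEq]
  constructor
  · rintro ⟨j, t, h, h1, h2⟩; exact ⟨j, t, h, h1.symm, h2.symm⟩
  · rintro ⟨j, t, h, h1, h2⟩; exact ⟨j, t, h, h1.symm, h2.symm⟩

/-- The vertices of the left boundary at heights between `-h` and `0`. -/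
def stack (h : ℤ) : Set Vertex := {v | v.1 = 0 ∧ -h ≤ v.2 ∧ v.2 ≤ 0}

/-- The vertices that can be reached from `A` by following the relation `K`. -/
def reach (K : Vertex → Vertex → Prop) (A : Set Vertex) : Set Vertex :=
  {v | ∃ a ∈ A, Relation.ReflTransGen K a v}

/-- The cluster of the vertices of the left boundary at heights between `-h` and `0`. -/
def stackCluster (h : ℤ) (E : Env) : Set Vertex := reach (Step E) (stack h)

theorem subset_reach (K : Vertex → Vertex → Prop) (A : Set Vertex) : A ⊆ reach K A :=
  fun a ha => ⟨a, ha, .refl⟩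

theorem reach_step {K : Vertex → Vertex → Prop} {A : Set Vertex} {v w : Vertex}
    (hv : v ∈ reach K A) (h : K v w) : w ∈ reach K A := by
  obtain ⟨a, ha, hav⟩ := hv
  exact ⟨a, ha, hav.tail h⟩

theorem reach_subset {K : Vertex → Vertex → Prop} {A T : Set Vertex} (hA : A ⊆ T)
    (hK : ∀ v w, v ∈ reach K A → v ∈ T → K v w → w ∈ T) : reach K A ⊆ T := by
  rintro v ⟨a, ha, hav⟩
  induction hav with
  | refl => exact hA ha
  | tail h1 h2 ih => exact hK _ _ ⟨a, ha, h1⟩ ih h2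

theorem reach_mono {K K' : Vertex → Vertex → Prop} {A A' : Set Vertex} (hA : A ⊆ A')
    (hK : ∀ v w, K v w → K' v w) : reach K A ⊆ reach K' A' :=
  reach_subset (hA.trans (subset_reach _ _)) fun v w _ hv h => reach_step hv (hK v w h)

/-! ### One step of the exploration -/

/-- The first edge is open (`IsOpen1`), or it is closed and the first triangle is top-oriented
(`IsTop`) or bottom-oriented (`IsBottom`). -/
def IsOpen1 (u : Env) : Prop := (u 0 0).2 = true
def IsTop (u : Env) : Prop := (u 0 0).2 = false ∧ (u 0 0).1 = true
def IsBottom (u : Env) : Prop := (u 0 0).2 = false ∧ (u 0 0).1 = false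

theorem isOpen1_or (u : Env) : IsOpen1 u ∨ IsTop u ∨ IsBottom u := by
  unfold IsOpen1 IsTop IsBottom
  cases (u 0 0).2 <;> cases (u 0 0).1 <;> simp

/-- Every layer contains infinitely many triangles of each orientation, and the exploration
downwards is finite. -/
def Good (u : Env) : Prop := (∀ j, GoodLayer (u j)) ∧ ∃ n, off true 1 (down u) n = 0

open Classical in
/-- The variation of the height of the current edge. -/
noncomputable def dh (u : Env) : ℤ :=
  if IsOpen1 u then 1 else if IsTop u then 0 else -depth (down u)

open Classical in
/-- The shift of the first unexplored vertex at level `j`. -/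
noncomputable def offs (u : Env) (j : ℤ) : ℕ :=
  if IsOpen1 u then 0
  else if IsTop u then (if j ≤ 0 then 0 else off false 1 (up u) (j - 1).toNat)
  else (if 0 < j then 0 else off true 1 (down u) (-j).toNat)

open Classical in
/-- The number of explored edges in layer `j`. -/
noncomputable def hits (u : Env) (j : ℤ) : ℕ :=
  if j = 0 then 1
  else if IsOpen1 u then 0
  else if IsTop u then
    (if j < 0 then 0 else hit false (off false 1 (up u) (j - 1).toNat) (u j))
  else (if 0 < j then 0 else hit true (off true 1 (down u) (-1 - j).toNat) (u j))

/-- The inclusion of the vertices of the unexplored region. -/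
noncomputable def emb (u : Env) (v : Vertex) : Vertex := (v.1 + offs u (v.2 + dh u), v.2 + dh u)

/-- The open explored steps. -/
def Explored (u : Env) (v w : Vertex) : Prop := ∃ j t, t < hits u j ∧ (u j t).2 = true ∧
  v = (cnt false (u j) t, j) ∧ w = (cnt true (u j) t, j + 1)

/-- The number of vertices swallowed by a step downwards, at most. -/
noncomputable def volume (u : Env) : ℕ :=
  ∑ n ∈ Finset.range (depth (down u)), off true 1 (down u) n

theorem emb_injective (u : Env) : Function.Injective (emb u) := by
  rintro ⟨a, i⟩ ⟨b, j⟩ h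
  simp only [emb, Prod.mk.injEq] at h
  obtain ⟨h1, h2⟩ := h
  have : i = j := by omega
  subst this
  simpa using h1

theorem mem_range_emb {u : Env} {v : Vertex} : v ∈ Set.range (emb u) ↔ offs u v.2 ≤ v.1 := by
  constructor
  · rintro ⟨w, rfl⟩
    simp [emb]
  · intro h
    refine ⟨(v.1 - offs u v.2, v.2 - dh u), ?_⟩
    simp only [emb]
    ext
    · simp; omega
    · simp

/-! ### The three kinds of steps and their effect on the cluster -/

section Cases

variable {u : Env}

theorem IsTop.not_open (h : IsTop u) : ¬ IsOpen1 u := by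
  unfold IsOpen1; rw [h.1]; simp

theorem IsBottom.not_open (h : IsBottom u) : ¬ IsOpen1 u := by
  unfold IsOpen1; rw [h.1]; simp

theorem IsBottom.not_top (h : IsBottom u) : ¬ IsTop u := by
  unfold IsTop; rw [h.2]; simp

theorem IsOpen1.dh_eq (h : IsOpen1 u) : dh u = 1 := by simp [dh, h]
theorem IsTop.dh_eq (h : IsTop u) : dh u = 0 := by simp [dh, h, h.not_open]
theorem IsBottom.dh_eq (h : IsBottom u) : dh u = -depth (down u) := by
  simp [dh, h.not_top, h.not_open]

theorem IsOpen1.offs_eq (h : IsOpen1 u) (j : ℤ) : offs u j = 0 := by simp [offs, h]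
theorem IsTop.offs_nonpos (h : IsTop u) {j : ℤ} (hj : j ≤ 0) : offs u j = 0 := by
  simp [offs, h, h.not_open, hj]
theorem IsTop.offs_pos (h : IsTop u) (n : ℕ) : offs u (n + 1) = off false 1 (up u) n := by
  have : ¬ ((n : ℤ) + 1 ≤ 0) := by omega
  simp [offs, h, h.not_open, this]
theorem IsBottom.offs_pos (h : IsBottom u) {j : ℤ} (hj : 0 < j) : offs u j = 0 := by
  simp [offs, h.not_top, h.not_open, hj]
theorem IsBottom.offs_nonpos (h : IsBottom u) (n : ℕ) :
    offs u (-n) = off true 1 (down u) n := by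
  simp [offs, h.not_top, h.not_open]

theorem hits_zero (u : Env) : hits u 0 = 1 := by simp [hits]
theorem IsOpen1.hits_eq (h : IsOpen1 u) {j : ℤ} (hj : j ≠ 0) : hits u j = 0 := by
  simp [hits, h, hj]
theorem IsTop.hits_neg (h : IsTop u) {j : ℤ} (hj : j < 0) : hits u j = 0 := by
  simp [hits, h, h.not_open, hj, hj.ne]
theorem IsTop.hits_pos (h : IsTop u) (n : ℕ) :
    hits u (n + 1) = hit false (off false 1 (up u) n) (u (n + 1)) := by
  have h1 : ¬ ((n : ℤ) + 1 < 0) := by omega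
  have h2 : (n : ℤ) + 1 ≠ 0 := by omega
  simp [hits, h, h.not_open, h1, h2]
theorem IsBottom.hits_pos (h : IsBottom u) {j : ℤ} (hj : 0 < j) : hits u j = 0 := by
  simp [hits, h.not_top, h.not_open, hj, hj.ne']
theorem IsBottom.hits_neg (h : IsBottom u) (n : ℕ) :
    hits u (-1 - n) = hit true (off true 1 (down u) n) (u (-1 - n)) := by
  have h2 : -1 - (n : ℤ) ≠ 0 := by omega
  simp [hits, h.not_top, h.not_open, h2]

theorem int_cases (j : ℤ) : j = 0 ∨ (∃ n : ℕ, j = n + 1) ∨ ∃ n : ℕ, j = -1 - n := by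
  rcases lt_trichotomy j 0 with h | h | h
  · exact .inr (.inr ⟨(-1 - j).toNat, by omega⟩)
  · exact .inl h
  · exact .inr (.inl ⟨(j - 1).toNat, by omega⟩)

theorem IsOpen1.glue_eq (h : IsOpen1 u) (E : Env) : glue u E = openFirst (levelShift (-1) E) := by
  unfold IsOpen1 at h
  simp [glue, h]

theorem IsTop.glue_eq (h : IsTop u) (E : Env) : glue u E =
    assemble (cons (u 0 0) (E 0)) (glueSeq false 1 (up u) (up E)) (down E) := by
  simp [glue, h.1, h.2]

theorem IsBottom.glue_eq (h : IsBottom u) (E : Env) : glue u E =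
    assemble (cons (u 0 0) (levelShift (depth (down u)) E 0)) (up (levelShift (depth (down u)) E))
      (glueSeq true 1 (down u) (down (levelShift (depth (down u)) E))) := by
  simp [glue, h.1, h.2]

/-- The number of vertices on both sides of the explored part of a layer. -/
theorem cnt_hits (hu : Good u) (ho : ¬ IsOpen1 u) (j : ℤ) :
    cnt false (u j) (hits u j) = offs u j ∧ cnt true (u j) (hits u j) = offs u (j + 1) := by
  rcases isOpen1_or u with h | h | h
  · exact absurd h ho
  · rcases int_cases j with rfl | ⟨n, rfl⟩ | ⟨n, rfl⟩
    · rw [hits_zero, h.offs_nonpos le_rfl, show (0 : ℤ) + 1 = ((0 : ℕ) : ℤ) + 1 by simp, h.offs_pos]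
      simp [cnt, Nat.count_succ, h.2, off]
    · rw [h.hits_pos, h.offs_pos, show (n : ℤ) + 1 + 1 = ((n + 1 : ℕ) : ℤ) + 1 by simp, h.offs_pos,
        cnt_hit (hu.1 _)]
      exact ⟨rfl, cnt_not_hit (c := false) (hu.1 _) _⟩
    · rw [h.hits_neg (by omega), h.offs_nonpos (by omega), h.offs_nonpos (by omega)]
      simp [cnt]
  · rcases int_cases j with rfl | ⟨n, rfl⟩ | ⟨n, rfl⟩
    · have := h.offs_nonpos 0
      simp only [Nat.cast_zero, neg_zero] at this
      rw [hits_zero, this, h.offs_pos (by omega)]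
      simp [cnt, Nat.count_succ, h.2, off]
    · rw [h.hits_pos (by omega), h.offs_pos (by omega), h.offs_pos (by omega)]
      simp [cnt]
    · rw [h.hits_neg, show (-1 - n : ℤ) = -((n + 1 : ℕ) : ℤ) by push_cast; ring,
        show -((n + 1 : ℕ) : ℤ) + 1 = -(n : ℤ) by push_cast; ring, h.offs_nonpos, h.offs_nonpos,
        cnt_hit (hu.1 _)]
      refine ⟨?_, rfl⟩
      rw [show (-((n + 1 : ℕ) : ℤ)) = -1 - n by push_cast; ring]
      exact cnt_not_hit (c := true) (hu.1 _) _

theorem glue_apply (hu : Good u) (ho : ¬ IsOpen1 u) (E : Env) (j : ℤ) (t : ℕ) :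
    glue u E j t = if t < hits u j then u j t else E (j - dh u) (t - hits u j) := by
  rcases isOpen1_or u with h | h | h
  · exact absurd h ho
  · rw [h.glue_eq, h.dh_eq, sub_zero]
    rcases int_cases j with rfl | ⟨n, rfl⟩ | ⟨n, rfl⟩
    · rw [hits_zero, assemble_zero]
      cases t <;> simp
    · rw [assemble_pos, h.hits_pos, glueSeq, concat_apply (x := up u n) (hu.1 _)]
      rfl
    · rw [assemble_neg, h.hits_neg (by omega)]
      simp [down]
  · rw [h.glue_eq, h.dh_eq, sub_neg_eq_add]
    rcases int_cases j with rfl | ⟨n, rfl⟩ | ⟨n, rfl⟩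
    · rw [hits_zero, assemble_zero]
      cases t <;> simp [levelShift]
    · rw [assemble_pos, h.hits_pos (by omega)]
      simp [up, levelShift]
    · rw [assemble_neg, h.hits_neg, glueSeq, concat_apply (x := down u n) (hu.1 _)]
      rfl

theorem cnt_glue_le (hu : Good u) (ho : ¬ IsOpen1 u) (E : Env) (j : ℤ) (c : Bool) {t : ℕ}
    (ht : t ≤ hits u j) : cnt c (glue u E j) t = cnt c (u j) t := by
  induction t with
  | zero => simp [cnt]
  | succ t ih =>
    have h1 := ih (by omega)
    unfold cnt at h1 ⊢
    rw [Nat.count_succ, Nat.count_succ, h1, glue_apply hu ho E j t, if_pos (show t < hits u j by omega)]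

theorem cnt_glue_add (hu : Good u) (ho : ¬ IsOpen1 u) (E : Env) (j : ℤ) (c : Bool) (s : ℕ) :
    cnt c (glue u E j) (hits u j + s) = cnt c (u j) (hits u j) + cnt c (E (j - dh u)) s := by
  rw [← cnt_glue_le hu ho E j c le_rfl]
  unfold cnt
  rw [Nat.count_add]
  congr 1
  congr 1
  ext k
  rw [glue_apply hu ho, if_neg (by omega)]
  simp

theorem openFirst_fst (E : Env) (j : ℤ) (t : ℕ) : (openFirst E j t).1 = (E j t).1 := by
  rcases int_cases j with rfl | ⟨n, rfl⟩ | ⟨n, rfl⟩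
  · cases t <;> rfl
  · rfl
  · rw [openFirst, assemble_neg]; rfl

theorem openFirst_snd (E : Env) (j : ℤ) (t : ℕ) :
    (openFirst E j t).2 = if j = 0 ∧ t = 0 then true else (E j t).2 := by
  rcases int_cases j with rfl | ⟨n, rfl⟩ | ⟨n, rfl⟩
  · cases t <;> rfl
  · rw [if_neg (by omega)]; rfl
  · rw [openFirst, assemble_neg, if_neg (by omega)]; rfl

theorem IsOpen1.explored_iff (h : IsOpen1 u) {v w : Vertex} :
    Explored u v w ↔ v = (0, 0) ∧ w = (0, 1) := by
  constructor
  · rintro ⟨j, t, ht, -, hv, hw⟩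
    by_cases hj : j = 0
    · subst hj
      rw [hits_zero] at ht
      obtain rfl : t = 0 := by omega
      simpa [cnt] using And.intro hv hw
    · rw [h.hits_eq hj] at ht
      omega
  · rintro ⟨rfl, rfl⟩
    exact ⟨0, 0, by simp [hits_zero], h, by simp [cnt], by simp [cnt]⟩

/-- Each layer of the glued environment is an explored initial segment followed by a layer of `E`,
and the orientations counted along the first segment are exactly the offsets of `emb`. In the open
case the explored edge is also the image of an edge of `E`; its state in `E` is irrelevant because
the first alternative covers it. -/
theorem step_glue_iff (hu : Good u) {E : Env} {v w : Vertex} : Step (glue u E) v w ↔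
    Explored u v w ∨ ∃ v' w', Step E v' w' ∧ v = emb u v' ∧ w = emb u w' := by
  by_cases ho : IsOpen1 u
  · have hc : ∀ c j t, cnt c (openFirst (levelShift (-1) E) j) t = cnt c (E (j - 1)) t := by
      intro c j t
      unfold cnt
      congr 1
      ext k
      rw [openFirst_fst]
      rfl
    have hemb : ∀ v, emb u v = (v.1, v.2 + 1) := fun v => by
      simp [emb, ho.dh_eq, ho.offs_eq]
    rw [ho.glue_eq, ho.explored_iff, step_iff]
    simp only [hc, openFirst_snd, hemb, step_iff]
    constructor
    · rintro ⟨j, t, h1, h2, h3⟩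
      by_cases h : j = 0 ∧ t = 0
      · obtain ⟨rfl, rfl⟩ := h
        left
        simpa [cnt] using And.intro h2 h3
      · rw [if_neg h] at h1
        exact .inr ⟨_, _, ⟨j - 1, t, h1, rfl, rfl⟩, by simpa using h2, by simpa using h3⟩
    · rintro (⟨rfl, rfl⟩ | ⟨_, _, ⟨j, t, h1, rfl, rfl⟩, h2, h3⟩)
      · exact ⟨0, 0, by simp, by simp [cnt], by simp [cnt]⟩
      · refine ⟨j + 1, t, ?_, by simpa using h2, by simpa using h3⟩
        split_ifs
        · rfl
        · simpa [levelShift] using h1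
  · have hc := cnt_hits hu ho
    constructor
    · intro h
      obtain ⟨j, t, h1, h2, h3⟩ := step_iff.1 h
      rw [glue_apply hu ho] at h1
      by_cases ht : t < hits u j
      · rw [if_pos ht] at h1
        rw [cnt_glue_le hu ho _ _ _ ht.le] at h2 h3
        exact .inl ⟨j, t, ht, h1, h2, h3⟩
      · rw [if_neg ht] at h1
        obtain ⟨s, rfl⟩ := Nat.exists_eq_add_of_le (not_lt.1 ht)
        rw [cnt_glue_add hu ho] at h2 h3
        rw [Nat.add_sub_cancel_left] at h1
        refine .inr ⟨_, _, step_iff.2 ⟨j - dh u, s, h1, rfl, rfl⟩, ?_, ?_⟩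
        · rw [h2, (hc j).1, emb]
          simp [add_comm]
        · rw [h3, (hc j).2, emb]
          ext
          · simp only
            rw [show j - dh u + 1 + dh u = j + 1 by ring, add_comm]
          · simp only
            ring
    · rintro (⟨j, t, ht, h1, h2, h3⟩ | ⟨_, _, h, rfl, rfl⟩)
      · refine step_iff.2 ⟨j, t, ?_, ?_, ?_⟩
        · rw [glue_apply hu ho, if_pos ht, h1]
        · rw [cnt_glue_le hu ho _ _ _ ht.le, h2]
        · rw [cnt_glue_le hu ho _ _ _ ht.le, h3]
      · obtain ⟨j, t, h1, rfl, rfl⟩ := step_iff.1 h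
        refine step_iff.2 ⟨j + dh u, hits u (j + dh u) + t, ?_, ?_, ?_⟩
        · rw [glue_apply hu ho, if_neg (by omega)]
          simpa using h1
        · rw [cnt_glue_add hu ho, (hc _).1, emb]
          simp [add_comm]
        · rw [cnt_glue_add hu ho, (hc _).2, emb]
          ext
          · simp only
            rw [show j + 1 + dh u = j + dh u + 1 by ring, add_comm, add_sub_cancel_right]
          · simp only
            ring

theorem off_eq_zero_of_le {c : Bool} {d : ℕ} {U : ℕ → Layer} {n k : ℕ} (h : off c d U n = 0)
    (hk : n ≤ k) : off c d U k = 0 := by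
  induction k, hk using Nat.le_induction with
  | base => exact h
  | succ k _ ih => rw [off, ih, skipped_zero]

theorem Good.off_eq_zero_iff (hu : Good u) (n : ℕ) :
    off true 1 (down u) n = 0 ↔ depth (down u) ≤ n := by
  refine ⟨fun h => Nat.sInf_le h, fun h => off_eq_zero_of_le ?_ h⟩
  exact Nat.sInf_mem (s := {n | off true 1 (down u) n = 0}) hu.2

/-- The explored region that is left behind by a step downwards. -/
noncomputable def swallowed (u : Env) : Finset Vertex :=
  open Classical in
  if IsBottom u then (Finset.range (depth (down u))).biUnion fun n =>
    (Finset.range (off true 1 (down u) n)).image fun i => (i, -(n : ℤ))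
  else ∅

theorem card_swallowed_le (u : Env) : (swallowed u).card ≤ volume u := by
  unfold swallowed volume
  split_ifs
  · refine Finset.card_biUnion_le.trans (Finset.sum_le_sum fun n _ => ?_)
    exact Finset.card_image_le.trans (by simp)
  · simp

theorem IsBottom.mem_swallowed (h : IsBottom u) (i n : ℕ) :
    (i, -(n : ℤ)) ∈ swallowed u ↔ n < depth (down u) ∧ i < offs u (-n) := by
  rw [h.offs_nonpos]
  simp only [swallowed, h, if_true, Finset.mem_biUnion, Finset.mem_range, Finset.mem_image,
    Prod.mk.injEq, neg_inj, Nat.cast_inj]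
  constructor
  · rintro ⟨m, hm, i, hi, rfl, rfl⟩; exact ⟨hm, hi⟩
  · rintro ⟨hm, hi⟩; exact ⟨n, hm, i, hi, rfl, rfl⟩

theorem swallowed_eq_empty (h : ¬ IsBottom u) : swallowed u = ∅ := by simp [swallowed, h]

theorem notMem_range_of_mem_swallowed {v : Vertex} (hv : v ∈ swallowed u) :
    v ∉ Set.range (emb u) := by
  by_cases h : IsBottom u
  · have : ∃ n : ℕ, v.2 = -n := by
      simp only [swallowed, h, if_true, Finset.mem_biUnion, Finset.mem_image] at hv
      obtain ⟨n, -, i, -, rfl⟩ := hv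
      exact ⟨n, rfl⟩
    obtain ⟨n, hn⟩ := this
    have hv' : (v.1, -(n : ℤ)) ∈ swallowed u := by rw [← hn]; exact hv
    rw [h.mem_swallowed] at hv'
    rw [mem_range_emb, hn]
    omega
  · simp [swallowed_eq_empty h] at hv

theorem mem_stack {h : ℤ} {i : ℕ} {j : ℤ} : (i, j) ∈ stack h ↔ i = 0 ∧ -h ≤ j ∧ j ≤ 0 := Iff.rfl

theorem exists_eq_emb_stack (hu : Good u) {h j : ℤ} (hj : -h ≤ j) (hj0 : j ≤ 0)
    (ho : IsBottom u → j ≤ -depth (down u)) : (0, j) ∈ emb u '' stack (h + dh u) := by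
  have key : offs u j = 0 ∧ j - dh u ≤ 0 := by
    rcases isOpen1_or u with h' | h' | h'
    · exact ⟨h'.offs_eq j, by rw [h'.dh_eq]; omega⟩
    · exact ⟨h'.offs_nonpos hj0, by rw [h'.dh_eq]; omega⟩
    · have := ho h'
      obtain ⟨n, rfl⟩ : ∃ n : ℕ, j = -n := ⟨(-j).toNat, by omega⟩
      refine ⟨?_, by rw [h'.dh_eq]; omega⟩
      rw [h'.offs_nonpos, hu.off_eq_zero_iff]
      omega
  refine ⟨(0, j - dh u), mem_stack.2 ⟨rfl, by omega, key.2⟩, ?_⟩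
  simp [emb, key.1]

/-- Three facts are used: a stack vertex either remains on the new stack or is swallowed; no
explored open step leads out of this union; and the steps of `E` join unexplored vertices only. -/
theorem stackCluster_glue_subset (hu : Good u) {h : ℤ} (hh : 0 ≤ h) (E : Env) :
    stackCluster h (glue u E) ⊆ emb u '' stackCluster (h + dh u) E ∪ swallowed u := by
  refine reach_subset ?_ ?_
  · rintro ⟨i, j⟩ ⟨h1, h2, h3⟩
    simp only at h1 h2 h3
    subst h1
    by_cases hb : IsBottom u ∧ -(depth (down u) : ℤ) < j
    · right
      obtain ⟨n, rfl⟩ : ∃ n : ℕ, j = -n := ⟨(-j).toNat, by omega⟩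
      rw [Finset.mem_coe, hb.1.mem_swallowed, hb.1.offs_nonpos]
      have : n < depth (down u) := by omega
      exact ⟨this, Nat.pos_of_ne_zero fun h => by rw [hu.off_eq_zero_iff] at h; omega⟩
    · left
      refine Set.image_mono (subset_reach _ _)
        (exists_eq_emb_stack hu h2 h3 fun hb' => not_lt.1 fun hlt => hb ⟨hb', hlt⟩)
  · intro v w _ hv hstep
    rcases (step_glue_iff hu).1 hstep with hK | ⟨v', w', hs, rfl, rfl⟩
    · obtain ⟨j, t, ht, hω, rfl, rfl⟩ := hK
      rcases isOpen1_or u with h' | h' | h'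
      · have := h'.explored_iff.1 ⟨j, t, ht, hω, rfl, rfl⟩
        rw [this.2]
        refine .inl ⟨(0, 0), subset_reach _ _ (mem_stack.2 ⟨rfl, ?_, le_rfl⟩), ?_⟩
        · rw [h'.dh_eq]; omega
        · simp [emb, h'.dh_eq, h'.offs_eq]
      -- In a top step, explored edges of the upper layers start at vertices that are cut off, and
      -- no explored edge of these layers starts in the unexplored region. The only other explored
      -- edge is closed.
      · exfalso
        have hv' : (cnt false (u j) t, j) ∈ Set.range (emb u) := by
          rw [swallowed_eq_empty (fun hb => hb.not_top h')] at hv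
          rcases hv with ⟨x, -, hx⟩ | hv
          · exact ⟨x, hx⟩
          · simp at hv
        rw [mem_range_emb] at hv'
        simp only at hv'
        rcases int_cases j with rfl | ⟨n, rfl⟩ | ⟨n, rfl⟩
        · rw [hits_zero] at ht
          obtain rfl : t = 0 := by omega
          rw [h'.1] at hω
          simp at hω
        · rw [h'.hits_pos] at ht
          rw [h'.offs_pos] at hv'
          have := cnt_lt_of_lt_hit (hu.1 _) ht
          omega
        · rw [h'.hits_neg (by omega)] at ht
          omega
      -- In a bottom step, an edge explored before the last required top-oriented triangle has its
      -- head among the swallowed vertices. Its tail may lie on the new boundary, which is how such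
      -- vertices can be joined later.
      · right
        rcases int_cases j with rfl | ⟨n, rfl⟩ | ⟨n, rfl⟩
        · rw [hits_zero] at ht
          obtain rfl : t = 0 := by omega
          rw [h'.1] at hω
          simp at hω
        · rw [h'.hits_pos (by omega)] at ht
          omega
        · rw [h'.hits_neg] at ht
          rw [Finset.mem_coe, show (-1 - n + 1 : ℤ) = -n by ring, h'.mem_swallowed, h'.offs_nonpos]
          have := cnt_lt_of_lt_hit (hu.1 _) ht
          refine ⟨?_, this⟩
          by_contra hn
          rw [not_lt, ← hu.off_eq_zero_iff] at hn
          omega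
    · rcases hv with ⟨x, hx, hxe⟩ | hv
      · rw [emb_injective u hxe] at hx
        exact .inl ⟨w', reach_step hx hs, rfl⟩
      · exact absurd ⟨v', rfl⟩ (notMem_range_of_mem_swallowed hv)

/-- Only an open step adds a vertex to the stack, namely the head of the explored edge. In the other
cases the new stack is a part of the old one. -/
theorem emb_stack_subset (hu : Good u) {h : ℤ} (hh : 0 ≤ h) :
    emb u '' stack (h + dh u) ⊆ reach (Explored u) (stack h) := by
  rintro _ ⟨⟨i, j⟩, ⟨h1, h2, h3⟩, rfl⟩
  simp only at h1 h2 h3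
  subst h1
  rcases isOpen1_or u with h' | h' | h'
  · rw [h'.dh_eq] at h2
    have he : emb u (0, j) = (0, j + 1) := by simp [emb, h'.dh_eq, h'.offs_eq]
    rw [he]
    rcases h3.lt_or_eq with h3 | rfl
    · exact subset_reach _ _ (mem_stack.2 ⟨rfl, by omega, by omega⟩)
    · exact reach_step (subset_reach _ _ (mem_stack.2 ⟨rfl, by omega, le_rfl⟩))
        (h'.explored_iff.2 ⟨rfl, by simp⟩)
  · rw [h'.dh_eq] at h2
    refine subset_reach _ _ ?_
    have he : emb u (0, j) = (0, j) := by simp [emb, h'.dh_eq, h'.offs_nonpos h3]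
    rw [he]
    exact mem_stack.2 ⟨rfl, by omega, h3⟩
  · rw [h'.dh_eq] at h2
    refine subset_reach _ _ ?_
    obtain ⟨n, rfl⟩ : ∃ n : ℕ, j = -n := ⟨(-j).toNat, by omega⟩
    have h0 : offs u (-((n + depth (down u) : ℕ) : ℤ)) = 0 := by
      rw [h'.offs_nonpos, hu.off_eq_zero_iff]; omega
    have he : emb u (0, -(n : ℤ)) = (0, -((n + depth (down u) : ℕ) : ℤ)) := by
      have : (-(n : ℤ)) + dh u = -((n + depth (down u) : ℕ) : ℤ) := by
        rw [h'.dh_eq]; push_cast; ring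
      simp only [emb, this, h0]
    rw [he]
    exact mem_stack.2 ⟨rfl, by push_cast; omega, by omega⟩

/-- The depth of a downward step that keeps the height nonnegative is at most `h`, and beyond that
depth nothing is explored. -/
theorem neg_le_of_explored (hu : Good u) {h : ℤ} (hh : 0 ≤ h) (hd : 0 ≤ h + dh u) {v w : Vertex}
    (hK : Explored u v w) : -h ≤ v.2 := by
  rcases isOpen1_or u with h' | h' | h'
  · rw [(h'.explored_iff.1 hK).1]; simpa using hh
  · obtain ⟨j, t, ht, -, rfl, -⟩ := hK
    simp only
    by_contra hj
    rw [h'.hits_neg (by omega)] at ht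
    omega
  · obtain ⟨j, t, ht, -, rfl, -⟩ := hK
    simp only
    rw [h'.dh_eq] at hd
    rcases int_cases j with rfl | ⟨n, rfl⟩ | ⟨n, rfl⟩
    · omega
    · omega
    · rw [h'.hits_neg] at ht
      by_contra hn
      rw [(hu.off_eq_zero_iff n).2 (by omega), hit_zero] at ht
      omega

theorem mem_range_emb_of_lt (hu : Good u) {h : ℤ} (hh : 0 ≤ h) (hd : 0 ≤ h + dh u) {j : ℤ}
    (hj : j < -h) : ((0, j) : Vertex) ∈ Set.range (emb u) := by
  obtain ⟨x, -, hx⟩ := exists_eq_emb_stack (h := -j) (j := j) hu (by omega) (by omega)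
    fun hb => by rw [hb.dh_eq] at hd; omega
  exact ⟨x, hx⟩

/-- Tails of edges advance to the right along a layer, so an explored edge starts at the latest at
the first unexplored vertex of its level. -/
theorem fst_eq_zero_of_explored (hu : Good u) {v w : Vertex} (hK : Explored u (emb u v) w) :
    v.1 = 0 := by
  by_cases ho : IsOpen1 u
  · have := (ho.explored_iff.1 hK).1
    simp only [emb, Prod.mk.injEq] at this
    omega
  · obtain ⟨j, t, ht, -, hv, -⟩ := hK
    simp only [emb, Prod.mk.injEq] at hv
    have h1 := cnt_mono false (u j) ht.le
    rw [(cnt_hits hu ho j).1] at h1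
    rw [hv.2] at hv
    omega

/-- A step that shifts all the higher layers. -/
def Renews (u : Env) : Prop := IsTop u ∧ ∀ n, off false 1 (up u) n ≠ 0

theorem Renews.nonpos_of_offs (h : Renews u) {j : ℤ} (hj : offs u j = 0) : j ≤ 0 := by
  rcases int_cases j with rfl | ⟨n, rfl⟩ | ⟨n, rfl⟩
  · rfl
  · rw [h.1.offs_pos] at hj
    exact absurd hj (h.2 n)
  · omega

/-- Going up, the exploration of a layer stops at the bottom-oriented triangle that brings the tail
of the next edge to the first unexplored vertex; earlier tails are all cut off. -/
theorem Renews.not_explored (hu : Good u) (h : Renews u) {v w : Vertex} :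
    ¬ Explored u (emb u v) w := by
  rintro ⟨j, t, ht, hω, hv, -⟩
  simp only [emb, Prod.mk.injEq] at hv
  rw [hv.2] at hv
  rcases int_cases j with rfl | ⟨n, rfl⟩ | ⟨n, rfl⟩
  · rw [hits_zero] at ht
    obtain rfl : t = 0 := by omega
    rw [h.1.1] at hω
    simp at hω
  · rw [h.1.hits_pos] at ht
    rw [h.1.offs_pos] at hv
    have := cnt_lt_of_lt_hit (hu.1 _) ht
    omega
  · rw [h.1.hits_neg (by omega)] at ht
    omega

end Cases

/-! ### Several steps of the exploration -/

/-- The environment made of the steps `u 0`, ..., `u (n - 1)`, followed by `E`. -/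
noncomputable def chain : ℕ → (ℕ → Env) → Env → Env
  | 0, _, E => E
  | n + 1, u, E => glue (u 0) (chain n (shift u) E)

/-- The inclusion of the vertices of the region unexplored after `n` steps. -/
noncomputable def embN : ℕ → (ℕ → Env) → Vertex → Vertex
  | 0, _, v => v
  | n + 1, u, v => emb (u 0) (embN n (shift u) v)

/-- The open steps explored during the first `n` steps. -/
def ExploredN : ℕ → (ℕ → Env) → Vertex → Vertex → Prop
  | 0, _, _, _ => False
  | n + 1, u, v, w => Explored (u 0) v w ∨
      ∃ v' w', ExploredN n (shift u) v' w' ∧ v = emb (u 0) v' ∧ w = emb (u 0) w'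

/-- The height of the current edge, relative to its initial height, after `n` steps. -/
noncomputable def walk (n : ℕ) (u : ℕ → Env) : ℤ := ∑ k ∈ Finset.range n, dh (u k)

/-- The exploration started at height `h` stays at nonnegative heights during `n` steps. -/
def Alive : ℕ → (ℕ → Env) → ℤ → Prop
  | 0, _, h => 0 ≤ h
  | n + 1, u, h => 0 ≤ h ∧ Alive n (shift u) (h + dh (u 0))

/-- The total volume of `n` steps. -/
noncomputable def volumeN (n : ℕ) (u : ℕ → Env) : ℕ := ∑ k ∈ Finset.range n, volume (u k)

theorem walk_succ (n : ℕ) (u : ℕ → Env) : walk (n + 1) u = dh (u 0) + walk n (shift u) := by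
  unfold walk; rw [Finset.sum_range_succ', add_comm]; rfl

theorem volumeN_succ (n : ℕ) (u : ℕ → Env) :
    volumeN (n + 1) u = volume (u 0) + volumeN n (shift u) := by
  unfold volumeN; rw [Finset.sum_range_succ', add_comm]; rfl

theorem alive_iff {n : ℕ} {u : ℕ → Env} {h : ℤ} : Alive n u h ↔ ∀ k ≤ n, 0 ≤ h + walk k u := by
  induction n generalizing u h with
  | zero => simp [Alive, walk]
  | succ n ih =>
    rw [Alive, ih]
    constructor
    · rintro ⟨h0, h1⟩ (_ | k) hk
      · simpa [walk] using h0
      · rw [walk_succ]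
        have := h1 k (by omega)
        omega
    · intro H
      refine ⟨by simpa [walk] using H 0 (by omega), fun k hk => ?_⟩
      have := H (k + 1) (by omega)
      rw [walk_succ] at this
      omega

theorem Alive.nonneg {n : ℕ} {u : ℕ → Env} {h : ℤ} (ha : Alive n u h) : 0 ≤ h := by
  simpa [walk] using alive_iff.1 ha 0 (Nat.zero_le _)

theorem embN_injective (n : ℕ) (u : ℕ → Env) : Function.Injective (embN n u) := by
  induction n generalizing u with
  | zero => exact fun _ _ h => h
  | succ n ih => exact (emb_injective (u 0)).comp (ih (shift u))

/-! ### The cluster along a sequence of steps -/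

section Chain

variable {n : ℕ} {u : ℕ → Env} {h : ℤ} {E : Env}

theorem good_shift (hu : ∀ k, Good (u k)) : ∀ k, Good (shift u k) := fun k => hu (k + 1)

theorem step_chain_iff (hu : ∀ k, Good (u k)) {v w : Vertex} : Step (chain n u E) v w ↔
    ExploredN n u v w ∨ ∃ v' w', Step E v' w' ∧ v = embN n u v' ∧ w = embN n u w' := by
  induction n generalizing u v w with
  | zero => simp [chain, ExploredN, embN]
  | succ n ih =>
    rw [chain, step_glue_iff (hu 0), ExploredN]
    simp only [ih (good_shift hu), embN]
    constructor
    · rintro (h | ⟨v', w', h | ⟨v'', w'', h, rfl, rfl⟩, rfl, rfl⟩)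
      · exact .inl (.inl h)
      · exact .inl (.inr ⟨_, _, h, rfl, rfl⟩)
      · exact .inr ⟨_, _, h, rfl, rfl⟩
    · rintro ((h | ⟨v', w', h, rfl, rfl⟩) | ⟨v', w', h, rfl, rfl⟩)
      · exact .inl h
      · exact .inr ⟨_, _, .inl h, rfl, rfl⟩
      · exact .inr ⟨_, _, .inr ⟨_, _, h, rfl, rfl⟩, rfl, rfl⟩

theorem mem_stackCluster_of_embN (hu : ∀ k, Good (u k)) (ha : Alive n u h) {v : Vertex}
    (hv : embN n u v ∈ stackCluster h (chain n u E)) : v ∈ stackCluster (h + walk n u) E := by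
  induction n generalizing u h with
  | zero => simpa [chain, embN, walk] using hv
  | succ n ih =>
    rw [walk_succ, ← add_assoc]
    refine ih (good_shift hu) ha.2 ?_
    rcases stackCluster_glue_subset (hu 0) ha.nonneg _ hv with ⟨x, hx, hxe⟩ | hv
    · rwa [emb_injective _ hxe] at hx
    · exact absurd ⟨_, rfl⟩ (notMem_range_of_mem_swallowed hv)

theorem embN_stack_subset (hu : ∀ k, Good (u k)) (ha : Alive n u h) :
    embN n u '' stack (h + walk n u) ⊆ reach (ExploredN n u) (stack h) := by
  induction n generalizing u h with
  | zero =>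
    rintro _ ⟨v, hv, rfl⟩
    simp only [walk, Finset.range_zero, Finset.sum_empty, add_zero] at hv
    exact subset_reach _ _ hv
  | succ n ih =>
    rintro _ ⟨v, hv, rfl⟩
    rw [walk_succ, ← add_assoc] at hv
    obtain ⟨a, ha', hav⟩ := ih (good_shift hu) ha.2 ⟨v, hv, rfl⟩
    have h0 := reach_mono (K' := ExploredN (n + 1) u) subset_rfl (fun _ _ => Or.inl)
      (emb_stack_subset (hu 0) ha.nonneg ⟨a, ha', rfl⟩)
    rw [embN]
    generalize embN n (shift u) v = x at hav
    induction hav with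
    | refl => exact h0
    | tail _ h2 ih => exact reach_step ih (.inr ⟨_, _, h2, rfl, rfl⟩)

theorem embN_mem_stackCluster (hu : ∀ k, Good (u k)) (ha : Alive n u h) {v : Vertex}
    (hv : v ∈ stackCluster (h + walk n u) E) : embN n u v ∈ stackCluster h (chain n u E) := by
  obtain ⟨a, ha', hav⟩ := hv
  have h0 := reach_mono (K' := Step (chain n u E)) subset_rfl
    (fun _ _ h => (step_chain_iff hu).2 (.inl h)) (embN_stack_subset hu ha ⟨a, ha', rfl⟩)
  induction hav with
  | refl => exact h0
  | tail _ h2 ih => exact reach_step ih ((step_chain_iff hu).2 (.inr ⟨_, _, h2, rfl, rfl⟩))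

theorem neg_le_of_exploredN (hu : ∀ k, Good (u k)) (ha : Alive n u h) {v w : Vertex}
    (hK : ExploredN n u v w) : -h ≤ v.2 := by
  induction n generalizing u h v w with
  | zero => exact hK.elim
  | succ n ih =>
    rcases hK with hK | ⟨v', w', hK, rfl, rfl⟩
    · exact neg_le_of_explored (hu 0) ha.nonneg ha.2.nonneg hK
    · have := ih (good_shift hu) ha.2 hK
      simp only [emb]
      omega

theorem mem_range_embN_of_lt (hu : ∀ k, Good (u k)) (ha : Alive n u h) {j : ℤ} (hj : j < -h) :
    ((0, j) : Vertex) ∈ Set.range (embN n u) := by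
  induction n generalizing u h j with
  | zero => exact ⟨_, rfl⟩
  | succ n ih =>
    obtain ⟨⟨a, i⟩, hx⟩ := mem_range_emb_of_lt (hu 0) ha.nonneg ha.2.nonneg hj
    have hx' := hx
    simp only [emb, Prod.mk.injEq] at hx
    obtain rfl : a = 0 := by omega
    obtain ⟨y, hy⟩ := ih (good_shift hu) ha.2 (j := i) (by omega)
    exact ⟨y, by rw [embN, hy, hx']⟩

theorem fst_le_fst_embN (v : Vertex) : v.1 ≤ (embN n u v).1 := by
  induction n generalizing u with
  | zero => exact le_rfl
  | succ n ih => exact (ih (u := shift u)).trans (by simp [embN, emb])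

theorem fst_eq_zero_of_exploredN (hu : ∀ k, Good (u k)) {v w : Vertex}
    (hK : ExploredN n u (embN n u v) w) : v.1 = 0 := by
  induction n generalizing u w with
  | zero => exact hK.elim
  | succ n ih =>
    rcases hK with hK | ⟨v', w', hK, hv, rfl⟩
    · have := fst_eq_zero_of_explored (hu 0) hK
      have := fst_le_fst_embN (n := n) (u := shift u) v
      omega
    · rw [← emb_injective _ hv] at hK
      exact ih (good_shift hu) hK

theorem nonpos_of_renews (hr : Renews (u n)) {v : Vertex} (hv : (embN (n + 1) u v).1 = 0) :
    v.2 ≤ 0 := by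
  induction n generalizing u with
  | zero =>
    simp only [embN, emb] at hv
    rw [hr.1.dh_eq] at hv
    simpa using hr.nonpos_of_offs (j := v.2 + 0) (by omega)
  | succ n ih =>
    refine ih (u := shift u) hr ?_
    simp only [embN, emb] at hv ⊢
    omega

/-- Such an edge must come from an earlier step and start on the boundary left by that step. Columns
never decrease under `emb`, so the last step did not shift that vertex, whereas a renewal shifts
every positive height. -/
theorem snd_nonpos_of_exploredN (hu : ∀ k, Good (u k)) (hr : Renews (u n)) {v w : Vertex}
    (hK : ExploredN (n + 1) u (embN (n + 1) u v) w) : v.2 ≤ 0 := by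
  induction n generalizing u w with
  | zero =>
    rcases hK with hK | ⟨v', w', hK, -⟩
    · exact absurd hK (hr.not_explored (hu 0))
    · exact hK.elim
  | succ n ih =>
    rcases hK with hK | ⟨v', w', hK, hv, rfl⟩
    · exact nonpos_of_renews (u := shift u) hr (fst_eq_zero_of_explored (hu 0) hK)
    · rw [← emb_injective _ hv] at hK
      exact ih (u := shift u) (good_shift hu) hr hK

/-! ### Counting vertices -/

/-- The explored vertices that are known to be in the cluster after `n` steps. -/
def found (n : ℕ) (u : ℕ → Env) : Set Vertex :=
  reach (ExploredN n u) {v | v.1 = 0 ∧ v.2 ≤ 0} \ Set.range (embN n u)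

/-- While the walk is nonnegative, explored edges start at heights at least `-h`, and the boundary
vertices below `-h` are still unexplored. So the whole lower boundary can replace the stack, and
this frees `found` from its dependence on `h`. -/
theorem found_subset (hu : ∀ k, Good (u k)) (ha : Alive n u h) :
    found n u ⊆ reach (ExploredN n u) (stack h) \ Set.range (embN n u) := by
  rintro v ⟨⟨a, ⟨ha1, ha2⟩, hav⟩, hv⟩
  refine ⟨⟨a, ⟨ha1, ?_, ha2⟩, hav⟩, hv⟩
  by_contra hlt
  rcases hav.cases_head with rfl | ⟨b, hab, -⟩
  · refine hv ?_
    have := mem_range_embN_of_lt hu ha (j := a.2) (by omega)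
    rwa [← ha1] at this
  · have := neg_le_of_exploredN hu ha hab
    omega

/-- The exploration decides nothing more about the unexplored region than its new stack: no path
leaves this region and comes back to a vertex not already on that stack. -/
theorem stackCluster_inter_range (hu : ∀ k, Good (u k)) (ha : Alive n u h) :
    stackCluster h (chain n u E) ∩ Set.range (embN n u) =
      embN n u '' stackCluster (h + walk n u) E := by
  ext v
  constructor
  · rintro ⟨hv, w, rfl⟩
    exact ⟨w, mem_stackCluster_of_embN hu ha hv, rfl⟩
  · rintro ⟨w, hw, rfl⟩
    exact ⟨embN_mem_stackCluster hu ha hw, w, rfl⟩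

theorem encard_stackCluster_eq (hu : ∀ k, Good (u k)) (ha : Alive n u h) :
    (stackCluster h (chain n u E)).encard = (stackCluster (h + walk n u) E).encard +
      (stackCluster h (chain n u E) \ Set.range (embN n u)).encard := by
  rw [← Set.encard_sdiff_add_encard_inter _ (Set.range (embN n u)),
    stackCluster_inter_range hu ha, (embN_injective n u).encard_image, add_comm]

theorem le_encard_stackCluster (hu : ∀ k, Good (u k)) (ha : Alive n u h) :
    (stackCluster (h + walk n u) E).encard + (found n u).encard ≤
      (stackCluster h (chain n u E)).encard := by
  rw [encard_stackCluster_eq hu ha]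
  gcongr
  refine (found_subset hu ha).trans (Set.sdiff_subset_sdiff_left ?_)
  exact reach_mono subset_rfl fun _ _ h => (step_chain_iff hu).2 (.inl h)

/-- After a renewal, an explored edge starting at an unexplored vertex of the cluster starts on the
new stack. This stack was itself reached by explored edges, so later discoveries cannot add
swallowed vertices. -/
theorem encard_stackCluster_le_of_renews (hu : ∀ k, Good (u k)) (hr : Renews (u n))
    (ha : Alive (n + 1) u h) : (stackCluster h (chain (n + 1) u E)).encard ≤
      (stackCluster (h + walk (n + 1) u) E).encard + (found (n + 1) u).encard := by
  rw [encard_stackCluster_eq hu ha]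
  gcongr
  have key : stackCluster h (chain (n + 1) u E) ⊆
      reach (ExploredN (n + 1) u) (stack h) ∪ Set.range (embN (n + 1) u) := by
    refine reach_subset ((subset_reach _ _).trans Set.subset_union_left) ?_
    intro v w hvC hv hs
    rcases (step_chain_iff hu).1 hs with hK | ⟨v', w', -, rfl, rfl⟩
    · left
      rcases hv with hv | ⟨x, rfl⟩
      · exact reach_step hv hK
      · have h1 := fst_eq_zero_of_exploredN hu hK
        have h2 := snd_nonpos_of_exploredN hu hr hK
        have hx := mem_stackCluster_of_embN hu ha hvC
        refine reach_step (embN_stack_subset hu ha ⟨x, ⟨h1, ?_, h2⟩, rfl⟩) hK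
        -- Steps go up, hence the cluster of a stack never goes below its lowest vertex. This
        -- supplies the lower bound needed for membership in the stack.
        have hsub : stackCluster (h + walk (n + 1) u) E ⊆ {v | -(h + walk (n + 1) u) ≤ v.2} := by
          refine reach_subset (fun v hv => hv.2.1) fun a b _ ha' hab => ?_
          obtain ⟨j, t, -, rfl, rfl⟩ := step_iff.1 hab
          simp only [Set.mem_ofPred_eq] at ha' ⊢
          omega
        exact hsub hx
    · exact .inr ⟨_, rfl⟩
  rintro v ⟨hv, hvr⟩
  refine ⟨reach_mono (fun x hx => ?_) (fun _ _ h => h) ((key hv).resolve_right hvr), hvr⟩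
  exact ⟨hx.1, hx.2.2⟩

theorem stackCluster_eq_empty (hh : h < 0) : stackCluster h E = ∅ := by
  ext v
  simp only [stackCluster, reach, stack, Set.mem_ofPred_eq, Set.mem_empty_iff_false, iff_false]
  rintro ⟨a, ⟨-, h1, h2⟩, -⟩
  omega

theorem encard_stackCluster_glue_le {u : Env} (hu : Good u) (hh : 0 ≤ h) :
    (stackCluster h (glue u E)).encard ≤ (stackCluster (h + dh u) E).encard + volume u := by
  refine (Set.encard_le_encard (stackCluster_glue_subset hu hh E)).trans ?_
  refine (Set.encard_union_le _ _).trans ?_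
  rw [(emb_injective u).encard_image, Set.encard_coe_eq_coe_finsetCard]
  gcongr
  exact card_swallowed_le u

theorem encard_stackCluster_le_of_alive (hu : ∀ k, Good (u k)) (ha : Alive n u h) :
    (stackCluster h (chain n u E)).encard ≤
      (stackCluster (h + walk n u) E).encard + volumeN n u := by
  induction n generalizing u h with
  | zero => simp [chain, walk, volumeN]
  | succ n ih =>
    refine (encard_stackCluster_glue_le (hu 0) ha.nonneg).trans ?_
    rw [walk_succ, volumeN_succ, ← add_assoc]
    push_cast
    rw [add_comm (volume (u 0) : ℕ∞), ← add_assoc]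
    gcongr
    exact ih (good_shift hu) ha.2

/-- Each step loses at most its volume, and when the height becomes negative the stack, hence its
cluster, is empty. -/
theorem encard_stackCluster_le_of_not_alive (hu : ∀ k, Good (u k)) (hh : 0 ≤ h)
    (ha : ¬ Alive n u h) : (stackCluster h (chain n u E)).encard ≤ volumeN n u := by
  induction n generalizing u h with
  | zero => exact absurd hh ha
  | succ n ih =>
    refine (encard_stackCluster_glue_le (hu 0) hh).trans ?_
    rw [volumeN_succ]
    push_cast
    rw [add_comm]
    gcongr
    by_cases h1 : 0 ≤ h + dh (u 0)
    · exact ih (good_shift hu) h1 fun h2 => ha ⟨hh, h2⟩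
    · rw [stackCluster_eq_empty (not_le.1 h1)]
      simp

/-! ### Concatenation -/

def shiftN (a : ℕ) (u : ℕ → Env) : ℕ → Env := fun k => u (k + a)

theorem shiftN_succ (a : ℕ) (u : ℕ → Env) : shiftN (a + 1) u = shiftN a (shift u) := by
  ext1 k; simp only [shiftN, shift]; congr 1

theorem good_shiftN (hu : ∀ k, Good (u k)) (a : ℕ) : ∀ k, Good (shiftN a u k) := fun _ => hu _

theorem chain_add (a b : ℕ) (u : ℕ → Env) (E : Env) :
    chain (a + b) u E = chain a u (chain b (shiftN a u) E) := by
  induction a generalizing u with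
  | zero => simp [chain]; rfl
  | succ a ih => rw [Nat.add_right_comm, chain, ih, chain, shiftN_succ]

theorem embN_add (a b : ℕ) (u : ℕ → Env) (v : Vertex) :
    embN (a + b) u v = embN a u (embN b (shiftN a u) v) := by
  induction a generalizing u with
  | zero => simp [embN]; rfl
  | succ a ih => rw [Nat.add_right_comm, embN, ih, embN, shiftN_succ]

theorem walk_add (a b : ℕ) (u : ℕ → Env) : walk (a + b) u = walk a u + walk b (shiftN a u) := by
  simp [walk, shiftN, Finset.sum_range_add, add_comm]

theorem alive_add {a b : ℕ} :
    Alive (a + b) u h ↔ Alive a u h ∧ Alive b (shiftN a u) (h + walk a u) := by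
  simp only [alive_iff]
  constructor
  · intro H
    refine ⟨fun k hk => H k (by omega), fun k hk => ?_⟩
    rw [add_assoc, ← walk_add]
    exact H _ (by omega)
  · rintro ⟨H1, H2⟩ k hk
    rcases le_total k a with h | h
    · exact H1 k h
    · obtain ⟨i, rfl⟩ := Nat.exists_eq_add_of_le h
      have := H2 i (by omega)
      rwa [add_assoc, ← walk_add] at this

theorem exploredN_mono {a n : ℕ} (han : a ≤ n) {v w : Vertex} (hK : ExploredN a u v w) :
    ExploredN n u v w := by
  induction a generalizing u v w n with
  | zero => exact hK.elim
  | succ a ih =>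
    obtain ⟨n, rfl⟩ := Nat.exists_eq_add_of_lt (Nat.lt_of_succ_le han)
    rcases hK with hK | ⟨v', w', hK, rfl, rfl⟩
    · exact .inl hK
    · exact .inr ⟨_, _, ih (by omega) hK, rfl, rfl⟩

theorem found_mono {a n : ℕ} (han : a ≤ n) : found a u ⊆ found n u := by
  rintro v ⟨hv, hvr⟩
  refine ⟨reach_mono subset_rfl (fun _ _ => exploredN_mono han) hv, ?_⟩
  rintro ⟨x, rfl⟩
  obtain ⟨b, rfl⟩ := Nat.exists_eq_add_of_le han
  exact hvr ⟨_, (embN_add a b u x).symm⟩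

open Classical in
/-- The volume of the steps following the last renewal. -/
noncomputable def pending (n : ℕ) (u : ℕ → Env) : ℕ :=
  ∑ k ∈ Finset.range n, if ∀ i, k ≤ i → i < n → ¬ Renews (u i) then volume (u k) else 0

/-- The steps are cut at the last renewal: up to it every swallowed vertex of the cluster is found,
and after it each swallowed vertex is charged to the volume. -/
theorem encard_stackCluster_le_found_add_pending (hu : ∀ k, Good (u k)) (ha : Alive n u h) :
    (stackCluster h (chain n u E)).encard ≤
      (stackCluster (h + walk n u) E).encard + ((found n u).encard + pending n u) := by
  classical
  obtain ⟨a, han, hr, hlast⟩ : ∃ a ≤ n, (a = 0 ∨ ∃ b, a = b + 1 ∧ Renews (u b)) ∧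
      ∀ i, a ≤ i → i < n → ¬ Renews (u i) := by
    clear ha
    induction n with
    | zero => exact ⟨0, le_rfl, .inl rfl, fun i _ h => by omega⟩
    | succ n ih =>
      by_cases hn : Renews (u n)
      · exact ⟨n + 1, le_rfl, .inr ⟨n, rfl, hn⟩, fun i _ h => by omega⟩
      · obtain ⟨a, h1, h2, h3⟩ := ih
        refine ⟨a, by omega, h2, fun i hi hin => ?_⟩
        rcases Nat.lt_succ_iff_lt_or_eq.1 hin with h | rfl
        · exact h3 i hi h
        · exact hn
  obtain ⟨b, rfl⟩ := Nat.exists_eq_add_of_le han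
  have hp : volumeN b (shiftN a u) ≤ pending (a + b) u := by
    unfold pending volumeN
    rw [Finset.sum_range_add]
    refine le_trans (Finset.sum_le_sum fun k hk => ?_) (Nat.le_add_left _ _)
    rw [if_pos]
    · simp [shiftN, add_comm]
    · exact fun i hi hin => hlast i (by omega) hin
  rw [alive_add] at ha
  have h2 := encard_stackCluster_le_of_alive (E := E) (good_shiftN hu a) ha.2
  rw [chain_add, walk_add, ← add_assoc h]
  have h1 : (stackCluster h (chain a u (chain b (shiftN a u) E))).encard ≤
      (stackCluster (h + walk a u) (chain b (shiftN a u) E)).encard + (found a u).encard := by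
    rcases hr with rfl | ⟨c, rfl, hr⟩
    · simp [chain, walk]
    · exact encard_stackCluster_le_of_renews hu hr ha.1
  refine h1.trans ((add_le_add_left h2 _).trans ?_)
  rw [add_assoc, add_comm (volumeN b (shiftN a u) : ℕ∞)]
  gcongr
  exact found_mono (Nat.le_add_right a b)

theorem encard_stackCluster_diff_le (hu : ∀ k, Good (u k)) (ha : Alive n u h) :
    (stackCluster h (chain n u E) \ Set.range (embN n u)).encard ≤ volumeN n u := by
  induction n generalizing u h with
  | zero =>
    have : stackCluster h (chain 0 u E) \ Set.range (embN 0 u) = ∅ := by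
      ext v
      simp only [Set.mem_sdiff, Set.mem_empty_iff_false, iff_false, not_and, not_not]
      exact fun _ => ⟨v, rfl⟩
    simp [this]
  | succ n ih =>
    have hsub : stackCluster h (chain (n + 1) u E) \ Set.range (embN (n + 1) u) ⊆
        emb (u 0) '' (stackCluster (h + dh (u 0)) (chain n (shift u) E) \
          Set.range (embN n (shift u))) ∪ swallowed (u 0) := by
      rintro v ⟨hv, hvr⟩
      rcases stackCluster_glue_subset (hu 0) ha.nonneg _ hv with ⟨x, hx, rfl⟩ | hv
      · exact .inl ⟨x, ⟨hx, fun ⟨y, hy⟩ => hvr ⟨y, by rw [embN, hy]⟩⟩, rfl⟩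
      · exact .inr hv
    refine (Set.encard_le_encard hsub).trans ((Set.encard_union_le _ _).trans ?_)
    rw [(emb_injective (u 0)).encard_image, Set.encard_coe_eq_coe_finsetCard, volumeN_succ,
      add_comm]
    push_cast
    gcongr
    · exact card_swallowed_le (u 0)
    · exact ih (good_shift hu) ha.2

theorem exists_alive (n : ℕ) (u : ℕ → Env) : ∃ h, Alive n u h := by
  refine ⟨∑ k ∈ Finset.range (n + 1), |walk k u|, alive_iff.2 fun k hk => ?_⟩
  have := Finset.single_le_sum (f := fun k => |walk k u|) (fun i _ => abs_nonneg _)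
    (Finset.mem_range.2 (Nat.lt_succ_of_le hk))
  linarith [neg_abs_le (walk k u)]

/-- As `found` does not involve the height, it can be compared with the cluster of a stack so tall
that the walk stays nonnegative; the environment that follows is arbitrary. -/
theorem encard_found_le (hu : ∀ k, Good (u k)) : (found n u).encard ≤ volumeN n u := by
  obtain ⟨h, ha⟩ := exists_alive n u
  refine (Set.encard_le_encard ?_).trans
    (encard_stackCluster_diff_le (E := fun _ _ => (true, true)) hu ha)
  refine (found_subset hu ha).trans (Set.sdiff_subset_sdiff_left ?_)
  exact reach_mono subset_rfl fun _ _ h => (step_chain_iff hu).2 (.inl h)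

/-- A bottom step swallows the origin, which already belongs to the lower boundary. -/
theorem one_le_encard_found (hb : IsBottom (u 0)) :
    1 ≤ (found 1 u).encard := by
  rw [Set.one_le_encard_iff_nonempty]
  refine ⟨(0, 0), subset_reach _ _ ⟨rfl, le_rfl⟩, ?_⟩
  have h0 := hb.offs_nonpos 0
  simp only [Nat.cast_zero, neg_zero] at h0
  have : (0, 0) ∉ Set.range (emb (u 0)) := by
    rw [mem_range_emb, h0]
    simp [off]
  rintro ⟨x, hx⟩
  exact this ⟨x, hx⟩

end Chain

/-! ### The law of a layer -/

/-- The probability of the orientation `c`. -/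
noncomputable def weight (α : ℝ) (c : Bool) : ℝ≥0∞ := ENNReal.ofReal (if c then α else 1 - α)

theorem weight_ne_top (α : ℝ) (c : Bool) : weight α c ≠ ⊤ := ENNReal.ofReal_ne_top

theorem lintegral_bit {q : ℝ} (h0 : 0 ≤ q) (h1 : q ≤ 1) (c : Bool) (f : Bool → ℝ≥0∞) :
    ∫⁻ b, f b ∂(bit q) = weight q c * f c + weight q (!c) * f (!c) := by
  have h : (Set.projIcc (0 : ℝ) 1 zero_le_one q) = ⟨q, h0, h1⟩ := Set.projIcc_of_mem _ ⟨h0, h1⟩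
  have e : ∀ x : unitInterval, ((unitInterval.toNNReal x : NNReal) : ℝ≥0∞) = ENNReal.ofReal x := by
    intro x
    rw [ENNReal.ofReal, Real.toNNReal_of_nonneg x.2.1]
    rfl
  rw [bit, h, bernoulliMeasure_def, lintegral_add_measure, lintegral_smul_measure,
    lintegral_smul_measure, lintegral_dirac, lintegral_dirac]
  have e1 := e ⟨q, h0, h1⟩
  have e2 := e (unitInterval.symm ⟨q, h0, h1⟩)
  simp only [ENNReal.smul_def, smul_eq_mul, e1, e2, weight]
  cases c <;> simp [add_comm]

theorem lintegral_pairLaw_fst {α : ℝ} (h0 : 0 ≤ α) (h1 : α ≤ 1) (p : ℝ) (c : Bool)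
    (f : Bool → ℝ≥0∞) :
    ∫⁻ b, f b.1 ∂(pairLaw α p) = weight α c * f c + weight α (!c) * f (!c) := by
  rw [← lintegral_bit h0 h1]
  exact (measurePreserving_fst (μ := bit α) (ν := bit p)).lintegral_comp (measurable_of_countable f)

section

variable {α p : ℝ}

theorem lintegral_layerLaw (h0 : 0 ≤ α) (h1 : α ≤ 1) (c : Bool) {f g : Layer → ℝ≥0∞}
    (hf : Measurable f) (hg : Measurable g) :
    ∫⁻ x, (if (x 0).1 = c then f (shift x) else g (shift x)) ∂(layerLaw α p) =
      weight α c * ∫⁻ x, f x ∂(layerLaw α p) + weight α (!c) * ∫⁻ x, g x ∂(layerLaw α p) := by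
  have hm : Measurable fun q : (Bool × Bool) × Layer => if q.1.1 = c then f q.2 else g q.2 :=
    Measurable.ite (measurableSet_eq_fun (by fun_prop) measurable_const) (by fun_prop) (by fun_prop)
  rw [show layerLaw α p = Measure.infinitePi fun _ => pairLaw α p from rfl,
    (measurePreserving_headTail (pairLaw α p)).lintegral_comp hm,
    lintegral_prod _ hm.aemeasurable]
  have := lintegral_pairLaw_fst h0 h1 p c fun b =>
    if b = c then ∫⁻ x, f x ∂(layerLaw α p) else ∫⁻ x, g x ∂(layerLaw α p)
  simp only [if_true, Bool.not_eq_eq_eq_not, Bool.eq_not_self, if_false] at this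
  rw [show layerLaw α p = Measure.infinitePi fun _ => pairLaw α p from rfl] at this
  rw [← this]
  refine lintegral_congr fun b => ?_
  split_ifs <;> rfl

theorem pairLaw_ne (h0 : 0 ≤ α) (h1 : α ≤ 1) (c : Bool) :
    pairLaw α p {b | b.1 ≠ c} = weight α (!c) := by
  have := lintegral_pairLaw_fst h0 h1 p c fun b => if b = c then 0 else 1
  simp only [if_true, Bool.not_eq_eq_eq_not, Bool.eq_not_self, if_false, mul_zero, mul_one,
    zero_add] at this
  rw [← this, ← lintegral_indicator_one (Set.to_countable _).measurableSet]
  refine lintegral_congr fun b => ?_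
  by_cases h : b.1 = c <;> simp [h]

theorem goodLayer_of_frequently {x : Layer} (h : ∀ c t, ∃ i, t ≤ i ∧ (x i).1 = c) :
    GoodLayer x := by
  intro c d
  refine ⟨Nat.nth (fun i => (x i).1 = c) d, Nat.count_nth_of_infinite ?_ d⟩
  refine Set.infinite_of_not_bddAbove fun ⟨t, ht⟩ => ?_
  obtain ⟨i, hi, hc⟩ := h c (t + 1)
  have : i ≤ t := ht hc
  omega

theorem weight_lt_one (h0 : 0 < α) (h1 : α < 1) (c : Bool) : weight α c < 1 := by
  unfold weight
  rw [ENNReal.ofReal_lt_one]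
  split_ifs <;> linarith

theorem ae_goodLayer (h0 : 0 < α) (h1 : α < 1) : ∀ᵐ x ∂(layerLaw α p), GoodLayer x := by
  have key : ∀ᵐ x ∂(layerLaw α p), ∀ c t, ∃ i, t ≤ i ∧ (x i).1 = c := by
    rw [ae_all_iff]; intro c
    rw [ae_all_iff]; intro t
    rw [ae_iff]
    have hle : ∀ n, layerLaw α p {x | ¬ ∃ i, t ≤ i ∧ (x i).1 = c} ≤ weight α (!c) ^ n := by
      intro n
      have h2 : layerLaw α p (Set.pi (Finset.Ico t (t + n)) fun _ => {b | b.1 ≠ c}) =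
          weight α (!c) ^ n := by
        rw [layerLaw, Measure.infinitePi_pi _ fun i _ => (Set.to_countable _).measurableSet]
        simp [pairLaw_ne h0.le h1.le]
      rw [← h2]
      refine measure_mono fun x hx i hi => ?_
      simp only [Set.mem_ofPred_eq, not_exists, not_and] at hx ⊢
      exact hx i (by simp at hi; omega)
    refine le_antisymm (ge_of_tendsto' (ENNReal.tendsto_pow_atTop_nhds_zero_of_lt_one
      (weight_lt_one h0 h1 (!c))) hle) (zero_le)
  exact key.mono fun x hx => goodLayer_of_frequently hx

theorem GoodLayer.le_hit {x : Layer} (hx : GoodLayer x) (c : Bool) (d : ℕ) : d ≤ hit c d x := by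
  have := cnt_hit (c := c) hx d
  have h2 := cnt_add_not c x (hit c d x)
  omega

theorem skipped_succ {c : Bool} {x : Layer} (hx : GoodLayer x) (d : ℕ) :
    skipped c (d + 1) x =
      if (x 0).1 = c then skipped c d (shift x) else skipped c (d + 1) (shift x) + 1 := by
  have h1 := hx.shift.le_hit c d
  have h2 := hx.shift.le_hit c (d + 1)
  unfold skipped
  rw [hit_succ hx]
  split_ifs <;> omega

/-- The generating function of the number of triangles of orientation `!c` before the first one of
orientation `c`. -/
noncomputable def phi (α : ℝ) (c : Bool) (s : ℝ≥0∞) : ℝ≥0∞ := weight α c / (1 - weight α (!c) * s)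

theorem phi_ne_top {c : Bool} {s : ℝ≥0∞} (hs : weight α (!c) * s < 1) : phi α c s ≠ ⊤ :=
  ENNReal.div_ne_top (weight_ne_top α c) (tsub_pos_of_lt hs).ne'

theorem phi_mul {c : Bool} {s : ℝ≥0∞} (hs : weight α (!c) * s < 1) :
    phi α c s * (1 - weight α (!c) * s) = weight α c :=
  ENNReal.div_mul_cancel (tsub_pos_of_lt hs).ne' (ENNReal.sub_ne_top ENNReal.one_ne_top)

/-- The one-triangle recursion expresses the integral through itself, which is useless if it is
infinite. Truncating at `hit < n` turns it into an induction on `n`, for all `d` at once, and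
monotone convergence concludes. -/
theorem lintegral_pow_skipped_le (h0 : 0 < α) (h1 : α < 1) {c : Bool} {s : ℝ≥0∞}
    (hs : weight α (!c) * s < 1) (d : ℕ) :
    ∫⁻ x, s ^ skipped c d x ∂(layerLaw α p) ≤ phi α c s ^ d := by
  let F : ℕ → ℕ → Layer → ℝ≥0∞ := fun n d x => if hit c d x < n then s ^ skipped c d x else 0
  have hF : ∀ n d, Measurable (F n d) := fun n d =>
    Measurable.ite (measurable_hit c d measurableSet_Iio)
      (measurable_const.pow (measurable_skipped c d)) measurable_const
  have key : ∀ n d, ∫⁻ x, F n d x ∂(layerLaw α p) ≤ phi α c s ^ d := by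
    intro n
    induction n with
    | zero => intro d; simp [F]
    | succ n ih =>
      rintro (_ | d)
      · calc ∫⁻ x, F (n + 1) 0 x ∂(layerLaw α p) ≤ ∫⁻ x, 1 ∂(layerLaw α p) := by
              refine lintegral_mono fun x => ?_
              simp only [F, skipped_zero]
              split_ifs <;> simp
          _ = _ := by simp
      · have e : ∫⁻ x, F (n + 1) (d + 1) x ∂(layerLaw α p) = ∫⁻ x, (if (x 0).1 = c then
            F n d (shift x) else s * F n (d + 1) (shift x)) ∂(layerLaw α p) := by
          refine lintegral_congr_ae ?_
          filter_upwards [ae_goodLayer h0 h1] with x hx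
          simp only [F, skipped_succ hx, hit_succ hx]
          by_cases hc : (x 0).1 = c
          · simp only [hc, if_true, show ∀ a : ℕ, (1 + a < n + 1) ↔ a < n by omega]
          · simp only [hc, if_false, show ∀ a : ℕ, (1 + a < n + 1) ↔ a < n by omega]
            split_ifs
            · rw [pow_succ']
            · simp
        rw [e, lintegral_layerLaw h0.le h1.le c (hF n d) ((hF n (d + 1)).const_mul s),
          lintegral_const_mul _ (hF n (d + 1))]
        calc _ ≤ weight α c * phi α c s ^ d + weight α (!c) * (s * phi α c s ^ (d + 1)) := by
              gcongr
              · exact ih d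
              · exact ih (d + 1)
          -- `phi` is the fixed point of the recursion: `weight α c` is replaced by `phi * (1 -
          -- weight * s)`.
          _ = phi α c s ^ d * phi α c s *
              ((1 - weight α (!c) * s) + weight α (!c) * s) := by
              rw [mul_add, mul_assoc _ _ (1 - _), phi_mul hs]
              ring
          _ = _ := by rw [tsub_add_cancel_of_le hs.le, mul_one, pow_succ]
  have hsup : ∀ x, s ^ skipped c d x = ⨆ n, F n d x := by
    intro x
    refine le_antisymm ?_ (iSup_le fun n => ?_)
    · exact le_iSup_of_le (hit c d x + 1) (by simp [F])
    · simp only [F]; split_ifs <;> simp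
  simp_rw [hsup]
  rw [lintegral_iSup (fun n => hF n d)]
  · exact iSup_le fun n => key n d
  · intro a b hab x
    simp only [F]
    split_ifs
    · exact le_rfl
    · omega
    · exact zero_le
    · exact le_rfl

/-- Once the integral is known to be finite, the linear equation given by the first triangle can be
solved for it. The power `d` reflects a sum of `d` independent geometric variables. -/
theorem lintegral_pow_skipped (h0 : 0 < α) (h1 : α < 1) {c : Bool} {s : ℝ≥0∞}
    (hs : weight α (!c) * s < 1) (d : ℕ) :
    ∫⁻ x, s ^ skipped c d x ∂(layerLaw α p) = phi α c s ^ d := by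
  induction d with
  | zero => simp [skipped_zero]
  | succ d ih =>
    have hfin : ∫⁻ x, s ^ skipped c (d + 1) x ∂(layerLaw α p) ≠ ⊤ :=
      ((lintegral_pow_skipped_le h0 h1 hs _).trans_lt
        (ENNReal.pow_lt_top (phi_ne_top hs).lt_top)).ne
    have hm : ∀ d, Measurable fun x : Layer => s ^ skipped c d x := fun d =>
      measurable_const.pow (measurable_skipped c d)
    have e : ∫⁻ x, s ^ skipped c (d + 1) x ∂(layerLaw α p) = ∫⁻ x, (if (x 0).1 = c then
        s ^ skipped c d (shift x) else s * s ^ skipped c (d + 1) (shift x)) ∂(layerLaw α p) := by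
      refine lintegral_congr_ae ?_
      filter_upwards [ae_goodLayer h0 h1] with x hx
      rw [skipped_succ hx]
      split_ifs
      · rfl
      · rw [pow_succ']
    rw [lintegral_layerLaw h0.le h1.le c (hm d) ((hm (d + 1)).const_mul s),
      lintegral_const_mul _ (hm (d + 1)), ih, ← mul_assoc] at e
    have e2 : (∫⁻ x, s ^ skipped c (d + 1) x ∂(layerLaw α p)) * (1 - weight α (!c) * s) =
        weight α c * phi α c s ^ d := by
      rw [ENNReal.mul_sub (fun _ _ => hfin), mul_one, mul_comm _ (weight α (!c) * s)]
      exact ENNReal.sub_eq_of_eq_add (ENNReal.mul_ne_top (hs.trans ENNReal.one_lt_top).ne hfin) e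
    have e3 := (ENNReal.eq_div_iff (tsub_pos_of_lt hs).ne'
      (ENNReal.sub_ne_top ENNReal.one_ne_top)).2 ((mul_comm _ _).trans e2)
    rw [e3, pow_succ, mul_comm, mul_div_assoc]
    rfl

end

/-! ### The law of the successive shifts -/

section

variable {α p : ℝ}

theorem lintegral_layersLaw {f : Layer → (ℕ → Layer) → ℝ≥0∞}
    (hf : Measurable fun q : Layer × (ℕ → Layer) => f q.1 q.2) :
    ∫⁻ U, f (U 0) (shift U) ∂(layersLaw α p) =
      ∫⁻ x, ∫⁻ U, f x U ∂(layersLaw α p) ∂(layerLaw α p) := by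
  have := (measurePreserving_headTail (layerLaw α p)).lintegral_comp hf
  rw [lintegral_prod _ hf.aemeasurable] at this
  exact this

theorem measurable_off_prod (c : Bool) (n : ℕ) :
    Measurable fun q : ℕ × (ℕ → Layer) => off c q.1 q.2 n :=
  measurable_from_prod_countable_right fun d => measurable_off c d n

theorem measurable_off_skipped (c : Bool) (d n : ℕ) :
    Measurable fun q : Layer × (ℕ → Layer) => off c (skipped c d q.1) q.2 n :=
  (measurable_off_prod c n).comp
    (((measurable_skipped c d).comp measurable_fst).prodMk measurable_snd)

/-- The successive shifts form a branching process started from `d` individuals, whose generating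
functions are the iterates of `phi`. -/
theorem lintegral_pow_off (h0 : 0 < α) (h1 : α < 1) {c : Bool} {s : ℝ≥0∞} {h : ℕ → ℝ≥0∞}
    (hh0 : h 0 = s) (hh : ∀ n, h (n + 1) = phi α c (h n)) (hlt : ∀ n, weight α (!c) * h n < 1)
    (n d : ℕ) : ∫⁻ U, s ^ off c d U n ∂(layersLaw α p) = h n ^ d := by
  induction n generalizing d with
  | zero => simp [off, hh0]
  | succ n ih =>
    simp_rw [off_succ']
    rw [lintegral_layersLaw (f := fun x U => s ^ off c (skipped c d x) U n)
      (measurable_const.pow (measurable_off_skipped c d n))]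
    simp_rw [ih]
    rw [lintegral_pow_skipped h0 h1 (hlt n), hh]

theorem lintegral_skipped_le (h0 : 0 < α) (h1 : α < 1) {c : Bool} {s K : ℝ≥0∞}
    (hlt : weight α (!c) * K < 1) {F : ℕ → (ℕ → Layer) → ℝ≥0∞} (hF : ∀ d, Measurable (F d))
    (hle : ∀ d, ∫⁻ U, F d U ∂(layersLaw α p) ≤ K ^ d) (d : ℕ) :
    ∫⁻ U, s ^ d * F (skipped c d (U 0)) (shift U) ∂(layersLaw α p) ≤ (s * phi α c K) ^ d := by
  have hm : Measurable fun q : Layer × (ℕ → Layer) => F (skipped c d q.1) q.2 :=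
    (measurable_from_prod_countable_right hF : Measurable fun q : ℕ × (ℕ → Layer) => F q.1 q.2).comp
      (((measurable_skipped c d).comp measurable_fst).prodMk measurable_snd)
  rw [lintegral_layersLaw (f := fun x U => s ^ d * F (skipped c d x) U) (hm.const_mul _)]
  have hle' : ∀ x, ∫⁻ U, s ^ d * F (skipped c d x) U ∂(layersLaw α p) ≤
      s ^ d * K ^ skipped c d x := fun x => by
    rw [lintegral_const_mul _ (hF _)]
    exact mul_le_mul' le_rfl (hle _)
  refine (lintegral_mono hle').trans ?_
  rw [lintegral_const_mul _ (measurable_const.pow (measurable_skipped c d)),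
    lintegral_pow_skipped h0 h1 hlt, ← mul_pow]

/-- A supersolution `K` of the total progeny equation `K = s * phi K` makes `s ^ (past progeny) * K
^ (current generation)` a supermartingale. -/
theorem lintegral_pow_sum_off_le (h0 : 0 < α) (h1 : α < 1) {c : Bool} {s K : ℝ≥0∞}
    (hlt : weight α (!c) * K < 1) (hK : s * phi α c K ≤ K) (n d : ℕ) :
    ∫⁻ U, s ^ (∑ i ∈ Finset.range n, off c d U i) * K ^ off c d U n ∂(layersLaw α p) ≤ K ^ d := by
  induction n generalizing d with
  | zero => simp [off]
  | succ n ih =>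
    have e : ∀ U, s ^ (∑ i ∈ Finset.range (n + 1), off c d U i) * K ^ off c d U (n + 1) =
        s ^ d * (s ^ (∑ i ∈ Finset.range n, off c (skipped c d (U 0)) (shift U) i) *
          K ^ off c (skipped c d (U 0)) (shift U) n) := by
      intro U
      rw [Finset.sum_range_succ']
      simp_rw [off_succ']
      rw [pow_add, show off c d U 0 = d from rfl]
      ring
    simp_rw [e]
    exact (lintegral_skipped_le h0 h1 hlt (F := fun d U =>
      s ^ (∑ i ∈ Finset.range n, off c d U i) * K ^ off c d U n) (fun d =>
        (measurable_const.pow (Finset.measurable_sum _ fun i _ => measurable_off c d i)).mul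
          (measurable_const.pow (measurable_off c d n))) ih d).trans (pow_le_pow_left' hK d)

theorem phi_ofReal (h0 : 0 < α) (h1 : α < 1) (c : Bool) {s : ℝ} (hs : 0 ≤ s)
    (hlt : (if !c then α else 1 - α) * s < 1) : phi α c (ENNReal.ofReal s) =
      ENNReal.ofReal ((if c then α else 1 - α) / (1 - (if !c then α else 1 - α) * s)) := by
  have hw : 0 ≤ if !c then α else 1 - α := by split_ifs <;> linarith
  rw [phi, weight, weight, ENNReal.ofReal_div_of_pos (by linarith),
    ENNReal.ofReal_sub _ (mul_nonneg hw hs), ENNReal.ofReal_one, ENNReal.ofReal_mul hw]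

theorem weight_mul_ofReal_lt (h0 : 0 < α) (h1 : α < 1) (c : Bool) {s : ℝ}
    (hlt : (if c then α else 1 - α) * s < 1) : weight α c * ENNReal.ofReal s < 1 := by
  rw [weight, ← ENNReal.ofReal_mul (by split_ifs <;> linarith), ENNReal.ofReal_lt_one]
  exact hlt

/-- The probability that the depth exceeds `n`. -/
noncomputable def depthTail (α : ℝ) (n : ℕ) : ℝ :=
  (offspringMean α - 1) / (offspringMean α ^ (n + 1) - 1)

theorem one_lt_offspringMean (hα : 1 / 2 < α) (hα' : α < 1) : 1 < offspringMean α := by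
  rw [offspringMean, lt_div_iff₀ (by linarith)]
  linarith

theorem depthTail_pos (hα : 1 / 2 < α) (hα' : α < 1) (n : ℕ) : 0 < depthTail α n := by
  have := one_lt_offspringMean hα hα'
  exact div_pos (by linarith) (sub_pos.2 (one_lt_pow₀ this (by omega)))

theorem depthTail_le (hα : 1 / 2 < α) (hα' : α < 1) (n : ℕ) :
    depthTail α n ≤ (offspringMean α)⁻¹ ^ n := by
  have hm := one_lt_offspringMean hα hα'
  have h1 : 1 ≤ offspringMean α ^ n := one_le_pow₀ hm.le
  rw [depthTail, inv_pow, div_le_iff₀ (sub_pos.2 (one_lt_pow₀ hm (by omega))),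
    ← div_eq_inv_mul, le_div_iff₀ (by linarith), pow_succ]
  nlinarith

theorem depthTail_le_one (hα : 1 / 2 < α) (hα' : α < 1) (n : ℕ) : depthTail α n ≤ 1 :=
  (depthTail_le hα hα' n).trans (pow_le_one₀ (by have := one_lt_offspringMean hα hα'; positivity)
    (inv_le_one_of_one_le₀ (one_lt_offspringMean hα hα').le))

theorem summable_depthTail (hα : 1 / 2 < α) (hα' : α < 1) : Summable (depthTail α) :=
  Summable.of_nonneg_of_le (fun n => (depthTail_pos hα hα' n).le) (depthTail_le hα hα')
    (summable_geometric_of_lt_one (by have := one_lt_offspringMean hα hα'; positivity)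
      (inv_lt_one_of_one_lt₀ (one_lt_offspringMean hα hα')))

theorem depthTail_zero (hα : 1 / 2 < α) (hα' : α < 1) : depthTail α 0 = 1 := by
  have := one_lt_offspringMean hα hα'
  rw [depthTail, zero_add, pow_one, div_self (by linarith)]

/-- The closed form of `depthTail` satisfies the recursion of extinction probabilities: `1 -
depthTail α n` is the `n`-th iterate of the linear fractional map `phi`, started from zero. -/
theorem depthTail_succ (hα : 1 / 2 < α) (hα' : α < 1) (n : ℕ) :
    1 - depthTail α (n + 1) = α / (1 - (1 - α) * (1 - depthTail α n)) := by
  have hm := one_lt_offspringMean hα hα'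
  have h1 : 1 < offspringMean α ^ (n + 1) := one_lt_pow₀ hm (by omega)
  have h2 : α = offspringMean α * (1 - α) := by
    rw [offspringMean, div_mul_cancel₀]; linarith
  have e : offspringMean α ^ (n + 1 + 1) = offspringMean α * offspringMean α ^ (n + 1) := pow_succ' _ _
  unfold depthTail
  rw [e]
  generalize offspringMean α ^ (n + 1) = M at *
  generalize offspringMean α = m at *
  have h3 : m * M - 1 ≠ 0 := by nlinarith
  have h4 : M - 1 ≠ 0 := by linarith
  have h5 : 1 - (1 - α) * (1 - (m - 1) / (M - 1)) ≠ 0 := by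
    have : 0 < (m - 1) / (M - 1) := div_pos (by linarith) (by linarith)
    nlinarith
  rw [eq_div_iff h5]
  field_simp
  have h6 : α * (1 + m) = m := by linarith
  linear_combination (M - 1) * (1 - m) * h6

/-- At `s = 0` the convention `0 ^ 0 = 1` makes `s ^ off` the indicator of extinction. -/
theorem measure_off_eq_zero (hα : 1 / 2 < α) (hα' : α < 1) (n : ℕ) :
    layersLaw α p {U | off true 1 U n = 0} = ENNReal.ofReal (1 - depthTail α n) := by
  have hb : ∀ n, (1 - α) * (1 - depthTail α n) < 1 := fun n => by
    have := depthTail_pos hα hα' n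
    nlinarith
  have := lintegral_pow_off (p := p) (α := α) (by linarith) hα' (c := true) (s := 0)
    (h := fun n => ENNReal.ofReal (1 - depthTail α n)) (by simp [depthTail_zero hα hα'])
    (fun n => ?_) (fun n => ?_) n 1
  · rw [pow_one] at this
    have hS : MeasurableSet {U | off true 1 U n = 0} :=
      measurable_off true 1 n (measurableSet_singleton 0)
    rw [← this, ← lintegral_indicator_one hS]
    refine lintegral_congr fun U => ?_
    by_cases h : off true 1 U n = 0 <;> simp [Set.indicator, h]
  · rw [phi_ofReal (by linarith) hα' true (sub_nonneg.2 (depthTail_le_one hα hα' n))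
      (by simpa using hb n), depthTail_succ hα hα']
    simp
  · exact weight_mul_ofReal_lt (by linarith) hα' _ (by simpa using hb n)

theorem measure_off_ne_zero (hα : 1 / 2 < α) (hα' : α < 1) (n : ℕ) :
    layersLaw α p {U | off true 1 U n ≠ 0} = ENNReal.ofReal (depthTail α n) := by
  have hS : MeasurableSet {U | off true 1 U n = 0} :=
    measurable_off true 1 n (measurableSet_singleton 0)
  rw [show {U | off true 1 U n ≠ 0} = {U | off true 1 U n = 0}ᶜ from rfl,
    prob_compl_eq_one_sub hS, measure_off_eq_zero hα hα', ← ENNReal.ofReal_one,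
    ← ENNReal.ofReal_sub _ (sub_nonneg.2 (depthTail_le_one hα hα' n))]
  congr 1
  ring

theorem ae_exists_off_eq_zero (hα : 1 / 2 < α) (hα' : α < 1) :
    ∀ᵐ U ∂(layersLaw α p), ∃ n, off true 1 U n = 0 := by
  rw [ae_iff]
  have ht : Tendsto (fun n => ENNReal.ofReal (depthTail α n)) atTop (𝓝 0) := by
    rw [← ENNReal.ofReal_zero]
    exact ENNReal.tendsto_ofReal (summable_depthTail hα hα').tendsto_atTop_zero
  refine le_antisymm (ge_of_tendsto' ht fun n => ?_) zero_le
  rw [← measure_off_ne_zero hα hα' (p := p)]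
  refine measure_mono fun U hU => ?_
  simp only [Set.mem_ofPred_eq, not_exists] at hU ⊢
  exact hU n

theorem lt_depth_iff {D : ℕ → Layer} (hD : ∃ n, off true 1 D n = 0) (n : ℕ) :
    n < depth D ↔ off true 1 D n ≠ 0 := by
  constructor
  · exact fun h => Nat.notMem_of_lt_sInf (s := {n | off true 1 D n = 0}) h
  · intro h
    by_contra hlt
    exact h (off_eq_zero_of_le (Nat.sInf_mem (s := {n | off true 1 D n = 0}) hD) (not_lt.1 hlt))

theorem lintegral_depth (hα : 1 / 2 < α) (hα' : α < 1) :
    ∫⁻ D, (depth D : ℝ≥0∞) ∂(layersLaw α p) = ENNReal.ofReal (∑' n, depthTail α n) := by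
  have e : ∫⁻ D, (depth D : ℝ≥0∞) ∂(layersLaw α p) =
      ∫⁻ D, ∑' n, ({U | off true 1 U n ≠ 0} : Set _).indicator 1 D ∂(layersLaw α p) := by
    refine lintegral_congr_ae ?_
    filter_upwards [ae_exists_off_eq_zero hα hα'] with D hD
    rw [tsum_eq_sum (s := Finset.range (depth D))]
    · rw [Finset.sum_congr rfl (g := fun _ => (1 : ℝ≥0∞))]
      · simp
      · intro n hn
        have := (lt_depth_iff hD n).1 (Finset.mem_range.1 hn)
        simp [Set.indicator, this]
    · intro n hn
      have := fun h => hn (Finset.mem_range.2 ((lt_depth_iff hD n).2 h))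
      rw [Set.indicator_of_notMem]
      exact this
  have hS : ∀ n, MeasurableSet {U : ℕ → Layer | off true 1 U n ≠ 0} := fun n =>
    (measurable_off true 1 n (measurableSet_singleton 0)).compl
  rw [e, lintegral_tsum fun n => (measurable_one.indicator (hS n)).aemeasurable,
    ENNReal.ofReal_tsum_of_nonneg (fun n => (depthTail_pos hα hα' n).le) (summable_depthTail hα hα')]
  refine tsum_congr fun n => ?_
  rw [lintegral_indicator_one (hS n), measure_off_ne_zero hα hα']

/-- The equation `K = s * phi K` is quadratic in `K`. Its discriminant vanishes at `s = 1 / (4 α (1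
- α))`, with double root `K = 1 / (2 (1 - α))`, and this `s` exceeds one because `α ≠ 1/2`. -/
theorem exists_lintegral_pow_lt_top (hα : 1 / 2 < α) (hα' : α < 1) : ∃ s : ℝ, 1 < s ∧
    ∫⁻ D, ENNReal.ofReal s ^ (∑ n ∈ Finset.range (depth D), off true 1 D n) ∂(layersLaw α p) < ⊤ := by
  have hK1 : 1 < 1 / (2 * (1 - α)) := by rw [lt_div_iff₀ (by linarith)]; linarith
  have hlt : (1 - α) * (1 / (2 * (1 - α))) = 1 / 2 := by
    have : (1 - α) ≠ 0 := by linarith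
    field_simp
  have hs : 1 < 1 / (4 * α * (1 - α)) := by
    rw [lt_div_iff₀ (by nlinarith)]
    nlinarith [sq_nonneg (2 * α - 1), mul_pos (sub_pos.2 hα) (sub_pos.2 hα)]
  have hlt' : (if !true then α else 1 - α) * (1 / (2 * (1 - α))) < 1 := by
    simp only [Bool.not_true, Bool.false_eq_true, if_false]
    rw [hlt]; norm_num
  refine ⟨_, hs, lt_of_le_of_lt ?_ (ENNReal.ofReal_lt_top (r := 1 / (2 * (1 - α))))⟩
  have hb := lintegral_pow_sum_off_le (p := p) (by linarith) hα' (c := true)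
    (s := ENNReal.ofReal (1 / (4 * α * (1 - α)))) (K := ENNReal.ofReal (1 / (2 * (1 - α))))
    (weight_mul_ofReal_lt (by linarith) hα' _ hlt') (by
      rw [phi_ofReal (by linarith) hα' true (by linarith) hlt', ← ENNReal.ofReal_mul (by linarith)]
      refine ENNReal.ofReal_le_ofReal (le_of_eq ?_)
      simp only [Bool.not_true, Bool.false_eq_true, if_false, if_true]
      rw [hlt]
      have : (1 - α) ≠ 0 := by linarith
      have : α ≠ 0 := by linarith
      field_simp
      norm_num)
  set s := 1 / (4 * α * (1 - α))
  set K := 1 / (2 * (1 - α))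
  have hs1 : 1 ≤ ENNReal.ofReal s := by rw [ENNReal.one_le_ofReal]; exact hs.le
  have hK1 : 1 ≤ ENNReal.ofReal K := by rw [ENNReal.one_le_ofReal]; exact hK1.le
  calc _ ≤ ∫⁻ D, ⨆ n, ENNReal.ofReal s ^ (∑ i ∈ Finset.range n, off true 1 D i) ∂(layersLaw α p) :=
        lintegral_mono fun D => le_iSup (fun n => ENNReal.ofReal s ^
          (∑ i ∈ Finset.range n, off true 1 D i)) (depth D)
    _ = ⨆ n, ∫⁻ D, ENNReal.ofReal s ^ (∑ i ∈ Finset.range n, off true 1 D i) ∂(layersLaw α p) := by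
        refine lintegral_iSup (fun n => measurable_const.pow
          (Finset.measurable_sum _ fun i _ => measurable_off true 1 i)) fun a b hab D => ?_
        exact pow_le_pow_right₀ hs1 (Finset.sum_le_sum_of_subset (Finset.range_mono hab))
    _ ≤ _ := by
        refine iSup_le fun n => (lintegral_mono fun D => ?_).trans ((hb n 1).trans_eq (pow_one _))
        exact le_mul_of_one_le_right' (one_le_pow₀ hK1)

/-- Going up, the mean offspring is `m > 1`. The extinction probability is at most the fixed point
`(1 - α) / α < 1` of `phi`, used as `K` with `s = 1`. -/
theorem measure_forall_off_pos (hα : 1 / 2 < α) (hα' : α < 1) :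
    0 < layersLaw α p {U | ∀ n, off false 1 U n ≠ 0} := by
  have hm : 0 < (1 - α) / α := div_pos (by linarith) (by linarith)
  have hm1 : (1 - α) / α < 1 := by rw [div_lt_one (by linarith)]; linarith
  have hlt : α * ((1 - α) / α) = 1 - α := by
    have : α ≠ 0 := by linarith
    field_simp
  have hlt' : (if !false then α else 1 - α) * ((1 - α) / α) < 1 := by
    simp only [Bool.not_false, if_true]
    rw [hlt]; linarith
  have hb := lintegral_pow_sum_off_le (p := p) (by linarith) hα' (c := false)
    (s := 1) (K := ENNReal.ofReal ((1 - α) / α))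
    (weight_mul_ofReal_lt (by linarith) hα' _ hlt') (by
      rw [one_mul, phi_ofReal (by linarith) hα' false hm.le hlt']
      refine ENNReal.ofReal_le_ofReal (le_of_eq ?_)
      simp only [Bool.not_false, Bool.false_eq_true, if_false, if_true]
      rw [hlt]
      norm_num)
  have hS : ∀ n, MeasurableSet {U | off false 1 U n = 0} := fun n =>
    measurable_off false 1 n (measurableSet_singleton 0)
  have hle : layersLaw α p (⋃ n, {U | off false 1 U n = 0}) ≤ ENNReal.ofReal ((1 - α) / α) := by
    rw [Monotone.measure_iUnion]
    · refine iSup_le fun n => ?_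
      rw [← lintegral_indicator_one (hS n)]
      refine (lintegral_mono fun U => ?_).trans ((hb n 1).trans_eq (pow_one _))
      by_cases h : off false 1 U n = 0 <;> simp [h]
    · exact fun a b hab U hU => off_eq_zero_of_le hU hab
  have hc : {U | ∀ n, off false 1 U n ≠ 0} = (⋃ n, {U | off false 1 U n = 0})ᶜ := by
    ext U; simp
  rw [hc, prob_compl_eq_one_sub (MeasurableSet.iUnion hS)]
  exact tsub_pos_of_lt (hle.trans_lt (ENNReal.ofReal_lt_one.2 hm1))

end

/-! ### The law of one step -/

section

variable {α p : ℝ}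

theorem bit_singleton {q : ℝ} (h0 : 0 ≤ q) (h1 : q ≤ 1) (c : Bool) : bit q {c} = weight q c := by
  rw [← lintegral_indicator_one (measurableSet_singleton c), lintegral_bit h0 h1 c]
  simp

theorem pairLaw_prod (s t : Set Bool) : pairLaw α p (s ×ˢ t) = bit α s * bit p t :=
  Measure.prod_prod s t

theorem measure_record {S : Set (Bool × Bool)} {A B : Set (ℕ → Layer)} (hA : MeasurableSet A)
    (hB : MeasurableSet B) : envLaw α p {u | u 0 0 ∈ S ∧ up u ∈ A ∧ down u ∈ B} =
      pairLaw α p S * (layersLaw α p A * layersLaw α p B) := by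
  have hS : MeasurableSet S := (Set.to_countable S).measurableSet
  have := (measurePreserving_record α p).measure_preimage (hS.prod (hA.prod hB)).nullMeasurableSet
  rw [Measure.prod_prod, Measure.prod_prod] at this
  exact this

theorem measure_isOpen1 (h0 : 0 ≤ p) (h1 : p ≤ 1) :
    envLaw α p {u | IsOpen1 u} = ENNReal.ofReal p := by
  have := measure_record (α := α) (p := p) (S := Set.univ ×ˢ {true}) .univ .univ
  rw [pairLaw_prod, bit_singleton h0 h1, measure_univ, measure_univ] at this
  simpa [IsOpen1, weight] using this

theorem measure_isBottom (hα0 : 0 ≤ α) (hα1 : α ≤ 1) (h0 : 0 ≤ p) (h1 : p ≤ 1) :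
    envLaw α p {u | IsBottom u} = ENNReal.ofReal ((1 - p) * (1 - α)) := by
  have := measure_record (α := α) (p := p) (S := {false} ×ˢ {false}) .univ .univ
  rw [pairLaw_prod, bit_singleton h0 h1, bit_singleton hα0 hα1] at this
  rw [mul_comm (1 - p), ENNReal.ofReal_mul (by linarith)]
  simpa [IsBottom, weight, and_comm, Prod.ext_iff] using this

theorem measure_renews_pos (hα : 1 / 2 < α) (hα' : α < 1) (h0 : 0 ≤ p) (h1 : p < 1) :
    0 < envLaw α p {u | Renews u} := by
  have hA : MeasurableSet {U | ∀ n, off false 1 U n ≠ 0} := by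
    simp only [Set.ofPred_forall]
    exact MeasurableSet.iInter fun n => (measurable_off false 1 n (measurableSet_singleton 0)).compl
  have := measure_record (α := α) (p := p) (S := {true} ×ˢ {false}) hA .univ
  rw [pairLaw_prod, bit_singleton h0 h1.le, bit_singleton (by linarith) hα'.le, measure_univ,
    mul_one] at this
  have e : {u : Env | Renews u} = {u | u 0 0 ∈ ({true} ×ˢ {false} : Set (Bool × Bool)) ∧
      up u ∈ {U | ∀ n, off false 1 U n ≠ 0} ∧ down u ∈ Set.univ} := by
    ext u
    simp [Renews, IsTop, Prod.ext_iff, and_comm]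
  rw [e, this]
  refine ENNReal.mul_pos (ENNReal.mul_pos ?_ ?_).ne' (measure_forall_off_pos hα hα').ne'
  · simp [weight]; linarith
  · simp [weight, h1]

theorem measurePreserving_down : MeasurePreserving down (envLaw α p) (layersLaw α p) :=
  measurePreserving_snd.comp (measurePreserving_snd.comp (measurePreserving_record α p))

theorem measurable_down : Measurable down := by unfold down; fun_prop

theorem measurable_up : Measurable up := by unfold up; fun_prop

theorem ae_good (hα : 1 / 2 < α) (hα' : α < 1) : ∀ᵐ u ∂(envLaw α p), Good u := by
  refine Filter.Eventually.and (ae_all_iff.2 fun j => ?_) ?_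
  · exact (measurePreserving_eval_infinitePi (fun _ : ℤ => layerLaw α p) j).quasiMeasurePreserving.ae
      (ae_goodLayer (by linarith) hα')
  · exact measurePreserving_down.quasiMeasurePreserving.ae (ae_exists_off_eq_zero hα hα')

open Classical in
/-- The number of levels by which a step goes down. -/
noncomputable def drop (u : Env) : ℕ := if IsBottom u then depth (down u) else 0

open Classical in
theorem dh_eq (u : Env) : dh u = (if IsOpen1 u then 1 else 0) - drop u := by
  rcases isOpen1_or u with h | h | h
  · have : ¬ IsBottom u := fun hb => hb.not_open h
    simp [dh, drop, h, this]
  · have : ¬ IsBottom u := fun hb => hb.not_top h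
    simp [dh, drop, h, h.not_open, this]
  · simp [dh, drop, h, h.not_open, h.not_top]

theorem dh_le_one (u : Env) : dh u ≤ 1 := by
  classical
  rw [dh_eq]; split_ifs <;> omega

theorem measurableSet_isOpen1 : MeasurableSet {u | IsOpen1 u} :=
  measurableSet_eq_fun (by fun_prop) measurable_const

theorem measurableSet_isTop : MeasurableSet {u | IsTop u} :=
  (measurableSet_eq_fun (by fun_prop) measurable_const).inter
    (measurableSet_eq_fun (by fun_prop) measurable_const)

theorem measurableSet_isBottom : MeasurableSet {u | IsBottom u} :=
  (measurableSet_eq_fun (by fun_prop) measurable_const).inter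
    (measurableSet_eq_fun (by fun_prop) measurable_const)

theorem measurableSet_renews : MeasurableSet {u | Renews u} := by
  refine measurableSet_isTop.inter ?_
  change MeasurableSet {u | ∀ n, off false 1 (up u) n ≠ 0}
  simp only [Set.ofPred_forall]
  exact MeasurableSet.iInter fun n =>
    (((measurable_off false 1 n).comp measurable_up) (measurableSet_singleton 0)).compl

theorem measurable_drop : Measurable drop :=
  Measurable.ite measurableSet_isBottom (measurable_depth.comp measurable_down) measurable_const

theorem measurable_dh : Measurable dh := by
  classical
  simp_rw [funext dh_eq]
  exact (Measurable.ite measurableSet_isOpen1 measurable_const measurable_const).sub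
    ((measurable_of_countable (fun n : ℕ => (n : ℤ))).comp measurable_drop)

theorem measurable_sum_off_depth :
    Measurable fun D => ∑ n ∈ Finset.range (depth D), off true 1 D n := by
  have : Measurable fun q : ℕ × (ℕ → Layer) => ∑ n ∈ Finset.range q.1, off true 1 q.2 n :=
    measurable_from_prod_countable_right fun d =>
      Finset.measurable_sum (Finset.range d) fun n _ => measurable_off true 1 n
  exact this.comp (measurable_depth.prodMk measurable_id)

theorem measurable_volume : Measurable volume := measurable_sum_off_depth.comp measurable_down

theorem exists_lintegral_pow_volume (hα : 1 / 2 < α) (hα' : α < 1) : ∃ s : ℝ, 1 < s ∧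
    ∫⁻ u, ENNReal.ofReal s ^ volume u ∂(envLaw α p) < ⊤ := by
  obtain ⟨s, hs, h⟩ := exists_lintegral_pow_lt_top (p := p) hα hα'
  refine ⟨s, hs, ?_⟩
  rw [← measurePreserving_down.lintegral_comp
    (measurable_const.pow measurable_sum_off_depth)] at h
  exact h

theorem Good.drop_le_volume {u : Env} (hu : Good u) : drop u ≤ volume u := by
  classical
  unfold drop
  split_ifs
  · calc depth (down u) = ∑ n ∈ Finset.range (depth (down u)), 1 := by simp
      _ ≤ volume u := Finset.sum_le_sum fun n hn =>
        Nat.one_le_iff_ne_zero.2 ((lt_depth_iff hu.2 n).1 (Finset.mem_range.1 hn))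
  · exact Nat.zero_le _

theorem lintegral_drop (hα : 1 / 2 < α) (hα' : α < 1) (h0 : 0 ≤ p) (h1 : p ≤ 1) :
    ∫⁻ u, (drop u : ℝ≥0∞) ∂(envLaw α p) =
      ENNReal.ofReal ((1 - p) * (1 - α) * ∑' n, depthTail α n) := by
  classical
  have hf : Measurable fun q : (Bool × Bool) × (ℕ → Layer) × (ℕ → Layer) =>
      (if q.1 = (false, false) then (1 : ℝ≥0∞) else 0) * (depth q.2.2 : ℝ≥0∞) :=
    (Measurable.ite (measurableSet_eq_fun measurable_fst measurable_const) measurable_const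
      measurable_const).mul ((measurable_of_countable (fun n : ℕ => (n : ℝ≥0∞))).comp
        (measurable_depth.comp measurable_snd.snd))
  have hd : Measurable fun q : (ℕ → Layer) × (ℕ → Layer) => (depth q.2 : ℝ≥0∞) :=
    (measurable_of_countable (fun n : ℕ => (n : ℝ≥0∞))).comp (measurable_depth.comp measurable_snd)
  have h := (measurePreserving_record α p).lintegral_comp hf
  rw [lintegral_prod_mul (f := fun b : Bool × Bool => if b = (false, false) then (1 : ℝ≥0∞) else 0)
    (g := fun q : (ℕ → Layer) × (ℕ → Layer) => (depth q.2 : ℝ≥0∞))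
    (measurable_of_countable _).aemeasurable hd.aemeasurable] at h
  have h3 := (measurePreserving_snd (μ := layersLaw α p) (ν := layersLaw α p)).lintegral_comp
    ((measurable_of_countable (fun n : ℕ => (n : ℝ≥0∞))).comp measurable_depth)
  simp only [Function.comp_def] at h3
  rw [h3, lintegral_depth hα hα'] at h
  have h2 : ∫⁻ b : Bool × Bool, (if b = (false, false) then (1 : ℝ≥0∞) else 0) ∂(pairLaw α p) =
      ENNReal.ofReal ((1 - p) * (1 - α)) := by
    have := lintegral_indicator_one (μ := pairLaw α p)
      (s := {false} ×ˢ {false}) (Set.to_countable _).measurableSet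
    rw [pairLaw_prod, bit_singleton h0 h1, bit_singleton (by linarith) hα'.le] at this
    rw [mul_comm (1 - p), ENNReal.ofReal_mul (by linarith)]
    simp only [weight, Bool.false_eq_true, if_false] at this
    rw [← this]
    refine lintegral_congr fun b => ?_
    by_cases hb : b = (false, false) <;> simp [hb, Set.indicator]
  rw [h2, ← ENNReal.ofReal_mul (mul_nonneg (by linarith) (by linarith))] at h
  rw [← h]
  refine lintegral_congr fun u => ?_
  by_cases hb : IsBottom u
  · have : u 0 0 = (false, false) := Prod.ext hb.2 hb.1
    simp [drop, hb, this]
  · have : u 0 0 ≠ (false, false) := fun h => hb ⟨by rw [h], by rw [h]⟩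
    simp [drop, hb, this]

theorem measurable_natCast_real {Ω : Type*} [MeasurableSpace Ω] {f : Ω → ℕ} (hf : Measurable f) :
    Measurable fun ω => (f ω : ℝ) :=
  (measurable_of_countable (fun n : ℕ => (n : ℝ))).comp hf

/-- Bernoulli's inequality for `√s` gives `(f * (√s - 1)) ^ 2 ≤ s ^ f`. -/
theorem memLp_two_of_lintegral_pow {Ω : Type*} [MeasurableSpace Ω] {μ : Measure Ω} {f : Ω → ℕ}
    (hf : Measurable f) {s : ℝ} (hs : 1 < s) (h : ∫⁻ ω, ENNReal.ofReal s ^ f ω ∂μ < ⊤) :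
    MemLp (fun ω => (f ω : ℝ)) 2 μ := by
  have hi : Integrable (fun ω => s ^ f ω) μ := by
    refine ⟨(measurable_const.pow hf).aestronglyMeasurable, ?_⟩
    rw [hasFiniteIntegral_iff_ofReal (ae_of_all _ fun ω => by positivity)]
    simpa only [ENNReal.ofReal_pow (zero_le_one.trans hs.le)] using h
  rw [memLp_two_iff_integrable_sq (measurable_natCast_real hf).aestronglyMeasurable]
  have h1 : 1 < √s := Real.lt_sqrt_of_sq_lt (by simpa using hs)
  refine (hi.div_const ((√s - 1) ^ 2)).mono'
    ((measurable_natCast_real hf).pow_const 2).aestronglyMeasurable (ae_of_all _ fun ω => ?_)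
  rw [Real.norm_of_nonneg (by positivity), le_div_iff₀ (pow_pos (by linarith) 2), ← mul_pow]
  have hb := one_add_mul_le_pow (a := √s - 1) (by linarith) (f ω)
  rw [add_sub_cancel] at hb
  calc ((f ω : ℝ) * (√s - 1)) ^ 2 ≤ (√s ^ f ω) ^ 2 := by
        refine pow_le_pow_left₀ (mul_nonneg (by positivity) (by linarith)) (by linarith) 2
    _ = s ^ f ω := by rw [← pow_mul, mul_comm, pow_mul, Real.sq_sqrt (by linarith)]

theorem memLp_volume (hα : 1 / 2 < α) (hα' : α < 1) :
    MemLp (fun u => (volume u : ℝ)) 2 (envLaw α p) := by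
  obtain ⟨s, hs, h⟩ := exists_lintegral_pow_volume (p := p) hα hα'
  exact memLp_two_of_lintegral_pow measurable_volume hs h

theorem memLp_drop (hα : 1 / 2 < α) (hα' : α < 1) :
    MemLp (fun u => (drop u : ℝ)) 2 (envLaw α p) := by
  refine (memLp_volume hα hα').mono (measurable_natCast_real measurable_drop).aestronglyMeasurable ?_
  filter_upwards [ae_good hα hα'] with u hu
  simpa using hu.drop_le_volume

open Classical in
theorem memLp_ite_isOpen1 :
    MemLp (fun u => if IsOpen1 u then (1 : ℝ) else 0) 2 (envLaw α p) := by
  refine MemLp.of_bound (Measurable.ite measurableSet_isOpen1 measurable_const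
    measurable_const).aestronglyMeasurable 1 (ae_of_all _ fun u => ?_)
  split_ifs <;> simp

theorem dh_eq_real (u : Env) [Decidable (IsOpen1 u)] :
    (dh u : ℝ) = (if IsOpen1 u then 1 else 0) - (drop u : ℝ) := by
  rw [dh_eq]; push_cast; congr 1

theorem memLp_dh (hα : 1 / 2 < α) (hα' : α < 1) :
    MemLp (fun u => (dh u : ℝ)) 2 (envLaw α p) := by
  classical
  simp_rw [dh_eq_real]
  exact memLp_ite_isOpen1.sub (memLp_drop hα hα')

theorem eta_eq (hα' : α < 1) : eta α = (1 - α) * ∑' n, depthTail α n := by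
  have : 1 / (offspringMean α + 1) = 1 - α := by
    have : (1 - α) ≠ 0 := by linarith
    unfold offspringMean
    field_simp
    ring
  rw [eta, this]
  rfl

theorem eta_pos (hα : 1 / 2 < α) (hα' : α < 1) : 0 < eta α := by
  rw [eta_eq hα']
  exact mul_pos (by linarith) ((summable_depthTail hα hα').tsum_pos
    (fun n => (depthTail_pos hα hα' n).le) 0 (depthTail_pos hα hα' 0))

theorem criticalParam_pos (hα : 1 / 2 < α) (hα' : α < 1) : 0 < criticalParam α := by
  have := eta_pos hα hα'
  unfold criticalParam; positivity

theorem criticalParam_lt_one (hα : 1 / 2 < α) (hα' : α < 1) : criticalParam α < 1 := by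
  have := eta_pos hα hα'
  rw [criticalParam, div_lt_one (by linarith)]; linarith

/-- The mean is `p - (1 - p) η`: the step is `1` with probability `p`, and it is `-depth` with
probability `(1 - p) (1 - α)`, independently of `depth`, whose mean is `∑ depthTail`. The definition
of `p_c` makes this vanish at `p = p_c`. -/
theorem integral_dh (hα : 1 / 2 < α) (hα' : α < 1) (h0 : 0 ≤ p) (h1 : p ≤ 1) :
    ∫ u, (dh u : ℝ) ∂(envLaw α p) = (1 + eta α) * (p - criticalParam α) := by
  classical
  have e1 : ∫ u, (if IsOpen1 u then (1 : ℝ) else 0) ∂(envLaw α p) = p := by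
    have := integral_indicator_one (μ := envLaw α p) measurableSet_isOpen1
    rw [measureReal_def, measure_isOpen1 h0 h1, ENNReal.toReal_ofReal h0] at this
    exact this
  have e2 : ∫ u, (drop u : ℝ) ∂(envLaw α p) = (1 - p) * eta α := by
    rw [integral_eq_lintegral_of_nonneg_ae (ae_of_all _ fun u => by positivity)
      (measurable_natCast_real measurable_drop).aestronglyMeasurable]
    simp_rw [ENNReal.ofReal_natCast]
    rw [lintegral_drop hα hα' h0 h1, ENNReal.toReal_ofReal, eta_eq hα', mul_assoc]
    exact mul_nonneg (mul_nonneg (by linarith) (by linarith))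
      (tsum_nonneg fun n => (depthTail_pos hα hα' n).le)
  simp_rw [dh_eq_real]
  rw [integral_sub (memLp_ite_isOpen1.integrable one_le_two)
    ((memLp_drop hα hα').integrable one_le_two), e1, e2, criticalParam]
  have := eta_pos hα hα'
  field_simp
  ring

end

/-! ### Measurability of clusters -/

section

variable {Ω : Type*} [MeasurableSpace Ω]

/-- Reachability in `n` steps, for each `n`, is a countable combination of elementary events, which
makes clusters measurable. -/
theorem mem_reach_iff {K : Vertex → Vertex → Prop} {A : Set Vertex} {v : Vertex} :
    v ∈ reach K A ↔ ∃ n, v ∈ Nat.rec (motive := fun _ => Set Vertex) A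
      (fun _ B => {w | ∃ b, b ∈ B ∧ K b w}) n := by
  constructor
  · rintro ⟨a, ha, h⟩
    induction h with
    | refl => exact ⟨0, ha⟩
    | tail _ h ih =>
      obtain ⟨n, hn⟩ := ih
      exact ⟨n + 1, _, hn, h⟩
  · rintro ⟨n, hn⟩
    induction n generalizing v with
    | zero => exact subset_reach _ _ hn
    | succ n ih =>
      obtain ⟨b, hb, h⟩ := hn
      exact reach_step (ih hb) h

theorem measurable_mem_reach {K : Ω → Vertex → Vertex → Prop} (A : Set Vertex)
    (hK : ∀ v w, Measurable fun ω => K ω v w) (v : Vertex) :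
    Measurable fun ω => v ∈ reach (K ω) A := by
  simp_rw [mem_reach_iff]
  refine Measurable.exists fun n => ?_
  induction n generalizing v with
  | zero => exact measurable_const
  | succ n ih => exact Measurable.exists fun b => (ih b).and (hK b v)

theorem measurable_encard {S : Ω → Set Vertex} (hS : ∀ v, Measurable fun ω => v ∈ S ω) :
    Measurable fun ω => (S ω).encard := by
  have key : ∀ n : ℕ, MeasurableSet {ω | (n : ℕ∞) ≤ (S ω).encard} := by
    intro n
    have : {ω | (n : ℕ∞) ≤ (S ω).encard} =
        ⋃ s : {s : Finset Vertex // s.card = n}, ⋂ v ∈ s.1, {ω | v ∈ S ω} := by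
      ext ω
      simp only [Set.mem_ofPred_eq, Set.mem_iUnion, Set.mem_iInter]
      constructor
      · intro h
        obtain ⟨t, ht, hc⟩ := Set.exists_subset_encard_eq h
        have hf : t.Finite := Set.finite_of_encard_eq_coe hc
        refine ⟨⟨hf.toFinset, ?_⟩, fun v hv => ht (by simpa using hv)⟩
        rw [hf.encard_eq_coe_toFinset_card] at hc
        exact_mod_cast hc
      · rintro ⟨⟨s, rfl⟩, hs⟩
        rw [← Set.encard_coe_eq_coe_finsetCard]
        exact Set.encard_le_encard hs
    rw [this]
    exact MeasurableSet.iUnion fun s => MeasurableSet.biInter s.1.countable_toSet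
      fun v _ => measurableSet_setOfPred.2 (hS v)
  refine measurable_to_countable' fun x => ?_
  induction x using ENat.recTopCoe with
  | top =>
    have : (fun ω => (S ω).encard) ⁻¹' {⊤} = ⋂ n : ℕ, {ω | (n : ℕ∞) ≤ (S ω).encard} := by
      ext ω
      simp only [Set.mem_preimage, Set.mem_singleton_iff, Set.mem_iInter, Set.mem_ofPred_eq]
      exact ⟨fun h n => h ▸ le_top, fun h => ENat.eq_top_iff_forall_ge.2 h⟩
    rw [this]
    exact MeasurableSet.iInter key
  | coe n =>
    have : (fun ω => (S ω).encard) ⁻¹' {(n : ℕ∞)} =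
        {ω | (n : ℕ∞) ≤ (S ω).encard} \ {ω | ((n + 1 : ℕ) : ℕ∞) ≤ (S ω).encard} := by
      ext ω
      simp only [Set.mem_preimage, Set.mem_singleton_iff, Set.mem_sdiff, Set.mem_ofPred_eq, not_le]
      rw [Nat.cast_add, Nat.cast_one, ENat.lt_add_one_iff (ENat.natCast_ne_top n)] at *
      exact ⟨fun h => ⟨h.ge, h.le⟩, fun h => le_antisymm h.2 h.1⟩
    rw [this]
    exact (key n).diff (key (n + 1))

end

/-! ### Measurability of the exploration -/

theorem measurable_step (v w : Vertex) : Measurable fun E => Step E v w := by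
  simp_rw [step_iff]
  refine Measurable.exists fun j => Measurable.exists fun t => ?_
  have h1 : ∀ c, Measurable fun E : Env => cnt c (E j) t := fun c =>
    (measurable_cnt c t).comp (measurable_pi_apply j)
  refine Measurable.and (measurableSet_setOfPred.1 (measurableSet_eq_fun (by fun_prop) measurable_const))
    (Measurable.and ?_ ?_)
  · exact measurableSet_setOfPred.1 (measurableSet_eq_fun measurable_const
      ((h1 false).prodMk measurable_const))
  · exact measurableSet_setOfPred.1 (measurableSet_eq_fun measurable_const
      ((h1 true).prodMk measurable_const))

theorem measurable_encard_stackCluster (h : ℤ) :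
    Measurable fun E => (stackCluster h E).encard :=
  measurable_encard fun v => measurable_mem_reach _ measurable_step v

theorem measurable_offs (j : ℤ) : Measurable fun u => offs u j := by
  unfold offs
  refine Measurable.ite measurableSet_isOpen1 measurable_const
    (Measurable.ite measurableSet_isTop ?_ ?_)
  · split_ifs
    · exact measurable_const
    · exact (measurable_off _ _ _).comp measurable_up
  · split_ifs
    · exact measurable_const
    · exact (measurable_off _ _ _).comp measurable_down

theorem measurable_hit_prod (c : Bool) : Measurable fun q : ℕ × Layer => hit c q.1 q.2 :=
  measurable_from_prod_countable_right fun d => measurable_hit c d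

theorem measurable_hits (j : ℤ) : Measurable fun u => hits u j := by
  unfold hits
  refine Measurable.ite (.const _) measurable_const (Measurable.ite measurableSet_isOpen1
    measurable_const (Measurable.ite measurableSet_isTop
      (Measurable.ite (.const _) measurable_const ?_)
      (Measurable.ite (.const _) measurable_const ?_)))
  · exact (measurable_hit_prod false).comp
      (((measurable_off _ _ _).comp measurable_up).prodMk (measurable_pi_apply j))
  · exact (measurable_hit_prod true).comp
      (((measurable_off _ _ _).comp measurable_down).prodMk (measurable_pi_apply j))

theorem measurable_emb : Measurable fun q : Env × Vertex => emb q.1 q.2 := by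
  have : Measurable fun q : Vertex × Env => emb q.2 q.1 := by
    refine measurable_from_prod_countable_right fun v => ?_
    have h1 : Measurable fun q : ℤ × Env => offs q.2 q.1 :=
      measurable_from_prod_countable_right measurable_offs
    have h2 : Measurable fun u : Env => v.2 + dh u := measurable_const.add measurable_dh
    exact ((h1.comp (h2.prodMk measurable_id)).const_add v.1).prodMk h2
  exact this.comp measurable_swap

theorem measurable_embN (n : ℕ) (v : Vertex) : Measurable fun u => embN n u v := by
  induction n with
  | zero => exact measurable_const
  | succ n ih => exact measurable_emb.comp ((measurable_pi_apply 0).prodMk (ih.comp measurable_shift))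

theorem measurable_explored (v w : Vertex) : Measurable fun u => Explored u v w := by
  unfold Explored
  refine Measurable.exists fun j => Measurable.exists fun t => ?_
  have h1 : ∀ c, Measurable fun E : Env => cnt c (E j) t := fun c =>
    (measurable_cnt c t).comp (measurable_pi_apply j)
  refine Measurable.and (measurableSet_setOfPred.1 (measurable_hits j measurableSet_Ioi))
    (Measurable.and (measurableSet_setOfPred.1 (measurableSet_eq_fun (by fun_prop) measurable_const))
    (Measurable.and ?_ ?_))
  · exact measurableSet_setOfPred.1 (measurableSet_eq_fun measurable_const
      ((h1 false).prodMk measurable_const))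
  · exact measurableSet_setOfPred.1 (measurableSet_eq_fun measurable_const
      ((h1 true).prodMk measurable_const))

theorem measurable_exploredN (n : ℕ) (v w : Vertex) : Measurable fun u => ExploredN n u v w := by
  induction n generalizing v w with
  | zero => exact measurable_const
  | succ n ih =>
    refine Measurable.or ((measurable_explored v w).comp (measurable_pi_apply 0)) ?_
    have h : ∀ v v', Measurable fun u : ℕ → Env => v = emb (u 0) v' := fun v v' => by
      have h0 : Measurable fun u : ℕ → Env => (u 0, v') :=
        (measurable_pi_apply 0).prodMk measurable_const
      have h1 : Measurable fun u : ℕ → Env => emb (u 0) v' := measurable_emb.comp h0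
      exact measurableSet_setOfPred.1 (measurableSet_eq_fun measurable_const h1)
    exact Measurable.exists fun v' => Measurable.exists fun w' =>
      ((ih v' w').comp measurable_shift).and ((h v v').and (h w w'))

theorem measurable_encard_found (n : ℕ) : Measurable fun u => (found n u).encard := by
  refine measurable_encard fun v => Measurable.and
    (measurable_mem_reach _ (measurable_exploredN n) v) (Measurable.not ?_)
  exact Measurable.exists fun w => measurableSet_setOfPred.1
    (measurableSet_eq_fun (measurable_embN n w) measurable_const)

theorem measurable_walk (n : ℕ) : Measurable (walk n) := by
  unfold walk
  exact Finset.measurable_sum _ fun k _ => measurable_dh.comp (measurable_pi_apply k)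

theorem measurable_volumeN (n : ℕ) : Measurable (volumeN n) := by
  unfold volumeN
  exact Finset.measurable_sum _ fun k _ => measurable_volume.comp (measurable_pi_apply k)

theorem measurable_pending (n : ℕ) : Measurable (pending n) := by
  unfold pending
  refine Finset.measurable_sum _ fun k _ => Measurable.ite ?_
    (measurable_volume.comp (measurable_pi_apply k)) measurable_const
  refine measurableSet_setOfPred.2 (Measurable.forall fun i => ?_)
  refine Measurable.imp measurable_const (Measurable.imp measurable_const (Measurable.not ?_))
  exact measurableSet_setOfPred.1 (measurableSet_renews.preimage (measurable_pi_apply i))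

theorem measurable_alive (n : ℕ) (h : ℤ) : Measurable fun u => Alive n u h := by
  simp_rw [alive_iff]
  exact Measurable.forall fun k => Measurable.imp measurable_const
    (measurableSet_setOfPred.1 ((measurable_const.add (measurable_walk k)) measurableSet_Ici))

/-! ### The annealed law -/

def split (E : Env) : Triangulation × Config :=
  (fun e => (E e.1 e.2).1, fun e => (E e.1 e.2).2)

theorem measurePreserving_split_env (α p : ℝ) :
    MeasurePreserving split (envLaw α p) (annealed α p) := by
  have h1 : MeasurePreserving (fun (E : Env) (e : ℤ × ℕ) => E e.1 e.2) (envLaw α p)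
      (Measure.infinitePi fun _ : ℤ × ℕ => pairLaw α p) :=
    ⟨by fun_prop, Measure.infinitePi_map_curry_symm fun _ _ => pairLaw α p⟩
  exact (measurePreserving_unzip (fun _ : ℤ × ℕ => bit α) (fun _ => bit p)).comp h1

theorem stack_zero : stack 0 = {origin} := by
  ext ⟨i, j⟩
  simp only [mem_stack, origin, Set.mem_singleton_iff, Prod.mk.injEq]
  omega

theorem cluster_split (E : Env) : cluster (split E).1 (split E).2 = stackCluster 0 E := by
  ext v
  simp only [stackCluster, reach, stack_zero, Set.mem_singleton_iff, exists_eq_left]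
  rfl

theorem measure_annealed_eq (α p : ℝ) (S : Set ℕ∞) :
    (annealed α p).real {x | (cluster x.1 x.2).encard ∈ S} =
      (envLaw α p).real {E | (stackCluster 0 E).encard ∈ S} := by
  have hc : Measurable fun x : Triangulation × Config => (cluster x.1 x.2).encard := by
    have hm : Measurable fun x : Triangulation × Config =>
        (fun j t => (x.1 (j, t), x.2 (j, t)) : Env) := by fun_prop
    have e : ∀ x : Triangulation × Config, cluster x.1 x.2 =
        stackCluster 0 (fun j t => (x.1 (j, t), x.2 (j, t))) := fun x =>
        cluster_split (fun j t => (x.1 (j, t), x.2 (j, t)))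
    simp_rw [e]
    exact (measurable_encard_stackCluster 0).comp hm
  have := (measurePreserving_split_env α p).measureReal_preimage
    (hc (MeasurableSet.of_discrete (s := S))).nullMeasurableSet
  refine this.symm.trans ?_
  simp only [Set.preimage, Set.mem_ofPred_eq, cluster_split]

theorem tail_eq (α p : ℝ) (n : ℕ) :
    tail α p n = (envLaw α p).real {E | (n : ℕ∞) ≤ (stackCluster 0 E).encard} :=
  measure_annealed_eq α p (Set.Ici n)

theorem percProb_eq (α p : ℝ) :
    percProb α p = (envLaw α p).real {E | (stackCluster 0 E).encard = ⊤} := by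
  have := measure_annealed_eq α p {⊤}
  simp only [Set.mem_singleton_iff, Set.encard_eq_top_iff] at this ⊢
  exact this

/-! ### Iterating the exploration -/

noncomputable def seqLaw (α p : ℝ) : Measure (ℕ → Env) := Measure.infinitePi fun _ => envLaw α p

instance (α p : ℝ) : IsProbabilityMeasure (seqLaw α p) := by unfold seqLaw; infer_instance

/-- Iterating the spatial Markov property: the steps of the exploration may be taken to be functions
of i.i.d. environments, independent of the unexplored one. -/
theorem measurePreserving_chain (α p : ℝ) (n : ℕ) :
    MeasurePreserving (fun q : (ℕ → Env) × Env => chain n q.1 q.2)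
      ((seqLaw α p).prod (envLaw α p)) (envLaw α p) := by
  induction n with
  | zero => exact measurePreserving_snd
  | succ n ih =>
    have hd : MeasurePreserving (fun u : ℕ → Env => (u 0, shift u)) (seqLaw α p)
      ((envLaw α p).prod (seqLaw α p)) := measurePreserving_headTail (envLaw α p)
    exact (measurePreserving_glue α p).comp (((MeasurePreserving.id _).prod ih).comp
      ((measurePreserving_assoc _ _ _).comp (hd.prod (MeasurePreserving.id _))))

/-! ### Random walks with steps at most one -/

section Walk

variable {E : Type*} {X : E → ℤ}

def partialSum (X : E → ℤ) (n : ℕ) (u : ℕ → E) : ℤ := ∑ k ∈ Finset.range n, X (u k)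

theorem partialSum_succ (n : ℕ) (u : ℕ → E) :
    partialSum X (n + 1) u = partialSum X n u + X (u n) := Finset.sum_range_succ _ _

theorem partialSum_succ' (n : ℕ) (u : ℕ → E) :
    partialSum X (n + 1) u = X (u 0) + partialSum X n (shift u) := by
  unfold partialSum; rw [Finset.sum_range_succ', add_comm]; rfl

/-- Remove the `n`-th term of a sequence. -/
def skipTerm (n : ℕ) (u : ℕ → E) : ℕ → E := fun k => u (if k < n then k else k + 1)

theorem partialSum_skipTerm {n k : ℕ} (hk : k ≤ n) (u : ℕ → E) :
    partialSum X k (skipTerm n u) = partialSum X k u := by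
  refine Finset.sum_congr rfl fun i hi => ?_
  rw [skipTerm, if_pos ((Finset.mem_range.1 hi).trans_le hk)]

def StaysPos (X : E → ℤ) (n : ℕ) (u : ℕ → E) : Prop := ∀ k, 1 ≤ k → k ≤ n → 0 < partialSum X k u

theorem staysPos_succ (n : ℕ) (u : ℕ → E) :
    StaysPos X (n + 1) u ↔ StaysPos X n u ∧ 0 < partialSum X (n + 1) u := by
  constructor
  · exact fun h => ⟨fun k h1 h2 => h k h1 (by omega), h _ (by omega) le_rfl⟩
  · rintro ⟨h1, h2⟩ k hk hkn
    rcases Nat.lt_succ_iff_lt_or_eq.1 (Nat.lt_succ_of_le hkn) with h | rfl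
    · exact h1 k hk (by omega)
    · exact h2

theorem staysPos_skipTerm (n : ℕ) (u : ℕ → E) : StaysPos X n (skipTerm n u) ↔ StaysPos X n u := by
  unfold StaysPos
  refine forall_congr' fun k => forall_congr' fun _ => forall_congr' fun hk => ?_
  rw [partialSum_skipTerm hk]

variable [MeasurableSpace E] {μ : Measure E} [IsProbabilityMeasure μ]

/-- The law of a sequence of independent variables of law `μ`. -/
noncomputable abbrev iid (μ : Measure E) [IsProbabilityMeasure μ] : Measure (ℕ → E) :=
  Measure.infinitePi fun _ => μ

theorem measurable_partialSum (hX : Measurable X) (n : ℕ) : Measurable (partialSum X n) :=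
  Finset.measurable_sum _ fun k _ => hX.comp (measurable_pi_apply k)

theorem measurePreserving_skipTerm (n : ℕ) :
    MeasurePreserving (fun u : ℕ → E => (skipTerm n u, u n)) (iid μ) ((iid μ).prod μ) := by
  have h1 := measurePreserving_split (fun _ : ℕ => μ) (f := fun k : ℕ => if k < n then k else k + 1)
    (g := fun _ : Unit => n) (by
      rintro (a | a) (b | b) h <;> simp only [Sum.elim_inl, Sum.elim_inr, Sum.inl.injEq] at h ⊢ <;>
        split_ifs at h <;> omega)
  exact ((MeasurePreserving.id _).prod
    (measurePreserving_eval_infinitePi (fun _ : Unit => μ) ())).comp h1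

theorem measurableSet_staysPos (hX : Measurable X) (n : ℕ) : MeasurableSet {u | StaysPos X n u} := by
  rw [measurableSet_setOfPred]
  exact Measurable.forall fun k => Measurable.imp measurable_const (Measurable.imp measurable_const
    (measurableSet_setOfPred.1 (measurable_partialSum hX k measurableSet_Ioi)))

theorem integrable_step (hi : Integrable (fun e => (X e : ℝ)) μ) (k : ℕ) :
    Integrable (fun u : ℕ → E => (X (u k) : ℝ)) (iid μ) :=
  (measurePreserving_eval_infinitePi (fun _ : ℕ => μ) k).integrable_comp_of_integrable hi

theorem integrable_partialSum (hi : Integrable (fun e => (X e : ℝ)) μ) (n : ℕ) :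
    Integrable (fun u : ℕ → E => (partialSum X n u : ℝ)) (iid μ) := by
  unfold partialSum
  push_cast
  exact integrable_finsetSum _ fun k _ => integrable_step hi k

theorem measurable_intFun {Ω : Type*} [MeasurableSpace Ω] (f : ℤ → ℝ) {g : Ω → ℤ}
    (hg : Measurable g) : Measurable fun ω => f (g ω) := (measurable_of_countable f).comp hg

/-- Exchangeability. -/
theorem integral_mul_last (hX : Measurable X) (hi : Integrable (fun e => (X e : ℝ)) μ)
    {h : ℤ → ℝ} {C : ℝ} (hC : ∀ x, |h x| ≤ C) (n : ℕ) :
    (n + 1) * ∫ u, h (partialSum X (n + 1) u) * X (u n) ∂(iid μ) =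
      ∫ u, h (partialSum X (n + 1) u) * partialSum X (n + 1) u ∂(iid μ) := by
  have hmS : Measurable fun u : ℕ → E => h (partialSum X (n + 1) u) :=
    measurable_intFun h (measurable_partialSum hX _)
  have hint : ∀ k, Integrable (fun u : ℕ → E => h (partialSum X (n + 1) u) * X (u k)) (iid μ) :=
    fun k => (integrable_step hi k).bdd_mul hmS.aestronglyMeasurable
      (ae_of_all _ fun u => (Real.norm_eq_abs _).trans_le (hC _))
  have hex : ∀ k ∈ Finset.range (n + 1), ∫ u, h (partialSum X (n + 1) u) * X (u k) ∂(iid μ) =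
      ∫ u, h (partialSum X (n + 1) u) * X (u n) ∂(iid μ) := by
    intro k hk
    -- Exchanging the terms `k` and `n` preserves both the law and the sum.
    have hp := measurePreserving_reindex (fun _ : ℕ => μ) (f := Equiv.swap k n)
      (Equiv.swap k n).injective
    have hm : Measurable fun u : ℕ → E => h (partialSum X (n + 1) u) * X (u k) :=
      hmS.mul (measurable_intFun _ (hX.comp (measurable_pi_apply k)))
    have := integral_map (μ := iid μ) hp.measurable.aemeasurable
      (f := fun u : ℕ → E => h (partialSum X (n + 1) u) * X (u k)) hm.aestronglyMeasurable
    rw [hp.map_eq] at this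
    refine this.trans (integral_congr_ae (ae_of_all _ fun u => ?_))
    have e : partialSum X (n + 1) (fun j => u (Equiv.swap k n j)) = partialSum X (n + 1) u := by
      refine Finset.sum_equiv (Equiv.swap k n) (fun i => ?_) (fun i _ => rfl)
      simp only [Finset.mem_range] at hk ⊢
      rcases eq_or_ne i k with rfl | h1
      · simp [hk]
      · rcases eq_or_ne i n with rfl | h2
        · simp [hk]
        · rw [Equiv.swap_apply_of_ne_of_ne h1 h2]
    simp only [e, Equiv.swap_apply_left]
  have : ∀ u : ℕ → E, h (partialSum X (n + 1) u) * partialSum X (n + 1) u =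
      ∑ k ∈ Finset.range (n + 1), h (partialSum X (n + 1) u) * X (u k) := fun u => by
    rw [← Finset.mul_sum]
    congr 1
    unfold partialSum
    push_cast
    rfl
  simp_rw [this]
  rw [integral_finsetSum _ fun k _ => hint k, Finset.sum_congr rfl hex]
  simp

open Classical in
/-- The ballot theorem. -/
theorem integral_staysPos (hX : Measurable X) (h1 : ∀ e, X e ≤ 1)
    (hi : Integrable (fun e => (X e : ℝ)) μ) (n : ℕ) {f : ℤ → ℝ} {C : ℝ} (hC : ∀ x, |f x| ≤ C) :
    (n + 1) * ∫ u, (if StaysPos X (n + 1) u then f (partialSum X (n + 1) u) else 0) ∂(iid μ) =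
      ∫ u, f (partialSum X (n + 1) u) * (max (partialSum X (n + 1) u) 0 : ℤ) ∂(iid μ) := by
  induction n generalizing f C with
  | zero =>
    simp only [Nat.cast_zero, zero_add, one_mul]
    refine integral_congr_ae (ae_of_all _ fun u => ?_)
    have hx := h1 (u 0)
    have e : partialSum X 1 u = X (u 0) := by simp [partialSum]
    by_cases h : 0 < X (u 0)
    · have hs : StaysPos X 1 u := fun k hk hk' => by
        obtain rfl : k = 1 := by omega
        rwa [e]
      have : X (u 0) = 1 := by omega
      simp [hs, e, this]
    · have hs : ¬ StaysPos X 1 u := fun hs => h (by have := hs 1 le_rfl le_rfl; rwa [e] at this)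
      simp [hs, e, max_eq_right (not_lt.1 h)]
  | succ n ih =>
    have hC0 : 0 ≤ C := (abs_nonneg _).trans (hC 0)
    -- The last positivity condition is moved into the test function, so that the induction
    -- hypothesis handles the other ones.
    let h : ℤ → ℝ := fun x => if 0 < x then f x else 0
    have hhC : ∀ x, |h x| ≤ C := fun x => by
      simp only [h]; split_ifs
      · exact hC x
      · simpa using hC0
    have hmp := measurePreserving_skipTerm (μ := μ) (n + 1)
    have hmS : ∀ k, Measurable (partialSum X k) := measurable_partialSum hX
    have hmS2 : Measurable fun q : (ℕ → E) × E => partialSum X (n + 1) q.1 + X q.2 :=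
      ((hmS _).comp measurable_fst).add (hX.comp measurable_snd)
    have hmp1 : ∀ g : (ℕ → E) × E → ℝ, Measurable g →
        ∫ u, g (skipTerm (n + 1) u, u (n + 1)) ∂(iid μ) = ∫ q, g q ∂((iid μ).prod μ) := by
      intro g hg
      have := integral_map (μ := iid μ) hmp.measurable.aemeasurable hg.aestronglyMeasurable
      rw [hmp.map_eq] at this
      exact this.symm
    have s1 : ∫ u, (if StaysPos X (n + 1 + 1) u then f (partialSum X (n + 1 + 1) u) else 0) ∂(iid μ) =
        ∫ q, (if StaysPos X (n + 1) q.1 then h (partialSum X (n + 1) q.1 + X q.2) else 0)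
          ∂((iid μ).prod μ) := by
      rw [← hmp1 (fun q => if StaysPos X (n + 1) q.1 then h (partialSum X (n + 1) q.1 + X q.2) else 0)]
      · refine integral_congr_ae (ae_of_all _ fun u => ?_)
        simp only [staysPos_skipTerm, partialSum_skipTerm le_rfl, ← partialSum_succ, staysPos_succ (n + 1), h]
        split_ifs <;> tauto
      · exact Measurable.ite ((measurableSet_staysPos hX _).preimage measurable_fst)
          (measurable_intFun h hmS2) measurable_const
    -- The last step is frozen, and the induction hypothesis is applied to the translated function
    -- `x ↦ h (x + X e)`.
    have s2 : (n + 1 : ℝ) * ∫ q, (if StaysPos X (n + 1) q.1 then h (partialSum X (n + 1) q.1 + X q.2)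
          else 0) ∂((iid μ).prod μ) =
        ∫ q, h (partialSum X (n + 1) q.1 + X q.2) * partialSum X (n + 1) q.1 ∂((iid μ).prod μ) := by
      have hint1 : Integrable (fun q : (ℕ → E) × E => if StaysPos X (n + 1) q.1 then
          h (partialSum X (n + 1) q.1 + X q.2) else 0) ((iid μ).prod μ) := by
        refine Integrable.of_bound (Measurable.ite ((measurableSet_staysPos hX _).preimage measurable_fst)
          (measurable_intFun h hmS2) measurable_const).aestronglyMeasurable C (ae_of_all _ fun q => ?_)
        split_ifs
        · exact (Real.norm_eq_abs _).trans_le (hhC _)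
        · simpa using hC0
      have hint2 : Integrable (fun q : (ℕ → E) × E => h (partialSum X (n + 1) q.1 + X q.2) *
          partialSum X (n + 1) q.1) ((iid μ).prod μ) :=
        ((integrable_partialSum hi (n + 1)).comp_fst μ).bdd_mul
          (measurable_intFun h hmS2).aestronglyMeasurable
          (ae_of_all _ fun q => (Real.norm_eq_abs _).trans_le (hhC _))
      rw [integral_prod_symm _ hint1, integral_prod_symm _ hint2, ← integral_const_mul]
      refine integral_congr_ae (ae_of_all _ fun e => ?_)
      simp only
      rw [ih (f := fun x => h (x + X e)) (fun x => hhC _)]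
      refine integral_congr_ae (ae_of_all _ fun u => ?_)
      simp only [h]
      split_ifs with hpos
      -- A step of at most one cannot reach a positive value from a negative one, so the positive
      -- part is superfluous.
      · have := h1 e
        rw [max_eq_left (by omega)]
      · simp
    have s3 : ∫ q, h (partialSum X (n + 1) q.1 + X q.2) * partialSum X (n + 1) q.1 ∂((iid μ).prod μ) =
        ∫ u, h (partialSum X (n + 2) u) * partialSum X (n + 2) u ∂(iid μ) -
          ∫ u, h (partialSum X (n + 2) u) * X (u (n + 1)) ∂(iid μ) := by
      rw [← hmp1 (fun q => h (partialSum X (n + 1) q.1 + X q.2) * partialSum X (n + 1) q.1)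
        ((measurable_intFun h hmS2).mul (measurable_intFun _ ((hmS _).comp measurable_fst))),
        ← integral_sub]
      · refine integral_congr_ae (ae_of_all _ fun u => ?_)
        simp only [partialSum_skipTerm le_rfl, ← partialSum_succ]
        rw [partialSum_succ (n + 1)]
        push_cast
        ring
      · exact (integrable_partialSum hi _).bdd_mul (measurable_intFun h (hmS _)).aestronglyMeasurable
          (ae_of_all _ fun q => (Real.norm_eq_abs _).trans_le (hhC _))
      · exact (integrable_step hi _).bdd_mul (measurable_intFun h (hmS _)).aestronglyMeasurable
          (ae_of_all _ fun q => (Real.norm_eq_abs _).trans_le (hhC _))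
    -- By exchangeability the last step carries a fraction `1 / (n + 2)` of the sum, which turns
    -- `S_{n+1}` into `(n + 1) / (n + 2)` times `S_{n+2}` in mean.
    have s4 := integral_mul_last (μ := μ) hX hi hhC (n + 1)
    have s5 : ∫ u, h (partialSum X (n + 1 + 1) u) * partialSum X (n + 1 + 1) u ∂(iid μ) =
        ∫ u, f (partialSum X (n + 1 + 1) u) * (max (partialSum X (n + 1 + 1) u) 0 : ℤ) ∂(iid μ) := by
      refine integral_congr_ae (ae_of_all _ fun u => ?_)
      simp only [h]
      split_ifs with hpos
      · rw [max_eq_left hpos.le]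
      · rw [max_eq_right (not_lt.1 hpos)]; simp
    rw [← s5, s1]
    rw [← s2] at s3
    push_cast at s4 ⊢
    have hn : (n + 1 : ℝ) ≠ 0 := by positivity
    generalize ∫ q, (if StaysPos X (n + 1) q.1 then h (partialSum X (n + 1) q.1 + X q.2)
          else 0) ∂((iid μ).prod μ) = a at *
    rw [show n + 1 + 1 = n + 2 from rfl] at s4 ⊢
    generalize ∫ u, h (partialSum X (n + 2) u) * partialSum X (n + 2) u ∂(iid μ) = b at *
    generalize ∫ u, h (partialSum X (n + 2) u) * X (u (n + 1)) ∂(iid μ) = d at *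
    refine mul_left_cancel₀ hn ?_
    linear_combination (n + 1 + 1 : ℝ) * s3 - s4

theorem measureReal_staysPos (hX : Measurable X) (h1 : ∀ e, X e ≤ 1)
    (hi : Integrable (fun e => (X e : ℝ)) μ) (n : ℕ) :
    (n + 1) * (iid μ).real {u | StaysPos X (n + 1) u} =
      ∫ u, max (partialSum X (n + 1) u : ℝ) 0 ∂(iid μ) := by
  classical
  have := integral_staysPos (μ := μ) hX h1 hi n (f := fun _ => 1) (C := 1) (fun _ => by simp)
  rw [← integral_indicator_one (measurableSet_staysPos hX _)]
  simpa [Set.indicator_apply] using this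

/-- A walk that stays positive makes a first step `1` and then stays nonnegative. -/
theorem measureReal_staysPos_succ (hX : Measurable X) (h1 : ∀ e, X e ≤ 1) (n : ℕ) :
    (iid μ).real {u | StaysPos X (n + 1) u} =
      μ.real {e | X e = 1} * (iid μ).real {u | ∀ k ≤ n, 0 ≤ partialSum X k u} := by
  have hS : MeasurableSet {u : ℕ → E | ∀ k ≤ n, 0 ≤ partialSum X k u} := by
    rw [measurableSet_setOfPred]
    exact Measurable.forall fun k => Measurable.imp measurable_const
      (measurableSet_setOfPred.1 (measurable_partialSum hX k measurableSet_Ici))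
  have hm := (measurePreserving_headTail μ).measureReal_preimage
    ((hX (measurableSet_singleton 1)).prod hS).nullMeasurableSet
  rw [measureReal_prod_prod] at hm
  refine Eq.trans ?_ hm
  congr 1
  ext u
  simp only [Set.mem_ofPred_eq, Set.mem_preimage, Set.mem_prod, Set.mem_singleton_iff, StaysPos]
  have hx := h1 (u 0)
  constructor
  · intro H
    have h0 := H 1 le_rfl (by omega)
    rw [partialSum_succ'] at h0
    simp only [partialSum, Finset.range_zero, Finset.sum_empty, add_zero] at h0
    refine ⟨by omega, fun k hk => ?_⟩
    have := H (k + 1) (by omega) (by omega)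
    rw [partialSum_succ'] at this
    omega
  · rintro ⟨h0, H⟩ (_ | k) hk hkn
    · omega
    · rw [partialSum_succ', h0]
      have := H k (by omega)
      omega

end Walk

/-! ### Moments of sums of i.i.d. variables -/

section Moments

variable {E : Type*} [MeasurableSpace E] {μ : Measure E} [IsProbabilityMeasure μ]

theorem lintegral_prod_iid {g : E → ℝ≥0∞} (hg : Measurable g) (n : ℕ) :
    ∫⁻ u, ∏ k ∈ Finset.range n, g (u k) ∂(iid μ) = (∫⁻ e, g e ∂μ) ^ n := by
  induction n with
  | zero => simp
  | succ n ih =>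
    have hm : Measurable fun u : ℕ → E => ∏ k ∈ Finset.range n, g (u k) :=
      Finset.measurable_prod _ fun k _ => hg.comp (measurable_pi_apply k)
    have h := (measurePreserving_headTail μ).lintegral_comp
      (f := fun q : E × (ℕ → E) => g q.1 * ∏ k ∈ Finset.range n, g (q.2 k))
      ((hg.comp measurable_fst).mul (hm.comp measurable_snd))
    rw [lintegral_prod_mul hg.aemeasurable hm.aemeasurable, ih, ← pow_succ'] at h
    rw [← h]
    refine lintegral_congr fun u => ?_
    rw [Finset.prod_range_succ', mul_comm]
    rfl

theorem memLp_eval {f : E → ℝ} (hf : MemLp f 2 μ) (k : ℕ) :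
    MemLp (fun u : ℕ → E => f (u k)) 2 (iid μ) :=
  hf.comp_measurePreserving (measurePreserving_eval_infinitePi (fun _ : ℕ => μ) k)

theorem iIndepFun_iid {f : E → ℝ} (hf : Measurable f) :
    iIndepFun (fun (k : ℕ) (u : ℕ → E) => f (u k)) (iid μ) :=
  iIndepFun_infinitePi (P := fun _ : ℕ => μ) (X := fun _ => f) fun _ => hf

theorem identDistrib_iid {f : E → ℝ} (hf : Measurable f) (k : ℕ) :
    IdentDistrib (fun u : ℕ → E => f (u k)) f (iid μ) μ where
  aemeasurable_fst := (hf.comp (measurable_pi_apply k)).aemeasurable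
  aemeasurable_snd := hf.aemeasurable
  map_eq := by
    have := (measurePreserving_eval_infinitePi (fun _ : ℕ => μ) k).map_eq
    conv_rhs => rw [← this]
    rw [Measure.map_map hf (measurable_pi_apply k)]
    rfl

theorem memLp_sum_iid {f : E → ℝ} (hf : MemLp f 2 μ) (n : ℕ) :
    MemLp (fun u : ℕ → E => ∑ k ∈ Finset.range n, f (u k)) 2 (iid μ) :=
  memLp_finsetSum _ fun k _ => memLp_eval hf k

theorem integral_sum_iid {f : E → ℝ} (hfm : Measurable f) (hf : MemLp f 2 μ) (n : ℕ) :
    ∫ u, ∑ k ∈ Finset.range n, f (u k) ∂(iid μ) = n * ∫ e, f e ∂μ := by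
  rw [integral_finsetSum _ fun k _ => (memLp_eval hf k).integrable one_le_two,
    Finset.sum_congr rfl fun k _ => (identDistrib_iid hfm k).integral_eq]
  simp

theorem variance_sum_iid {f : E → ℝ} (hfm : Measurable f) (hf : MemLp f 2 μ) (n : ℕ) :
    Var[fun u : ℕ → E => ∑ k ∈ Finset.range n, f (u k); iid μ] = n * Var[f; μ] := by
  have := IndepFun.variance_sum (μ := iid μ) (X := fun (k : ℕ) (u : ℕ → E) => f (u k))
    (s := Finset.range n) (fun k _ => memLp_eval hf k)
    (fun i _ j _ hij => (iIndepFun_iid hfm).indepFun hij)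
  rw [Finset.sum_congr rfl fun k _ => (identDistrib_iid hfm k).variance_eq] at this
  simp only [Finset.sum_const, Finset.card_range, nsmul_eq_mul] at this
  rw [← this]
  congr 1
  ext u
  simp

/-- Chebyshev's inequality. -/
theorem measureReal_abs_sum_sub_ge {f : E → ℝ} (hfm : Measurable f) (hf : MemLp f 2 μ) (n : ℕ)
    {t : ℝ} (ht : 0 < t) :
    (iid μ).real {u | t ≤ |∑ k ∈ Finset.range n, f (u k) - n * ∫ e, f e ∂μ|} ≤
      n * Var[f; μ] / t ^ 2 := by
  have := meas_ge_le_variance_div_sq (memLp_sum_iid (μ := μ) hf n) ht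
  rw [integral_sum_iid hfm hf, variance_sum_iid hfm hf] at this
  exact ENNReal.toReal_le_of_le_ofReal
    (div_nonneg (mul_nonneg (Nat.cast_nonneg _) (variance_nonneg _ _)) (by positivity)) this

/-- The square of the mean of `|Y|` is at most the mean of `Y ^ 2`, because the variance of `|Y|` is
nonnegative. -/
theorem integral_abs_sum_sub_le {f : E → ℝ} (hfm : Measurable f) (hf : MemLp f 2 μ) (n : ℕ) :
    ∫ u, |∑ k ∈ Finset.range n, f (u k) - n * ∫ e, f e ∂μ| ∂(iid μ) ≤ √(n * Var[f; μ]) := by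
  have hL : MemLp (fun u : ℕ → E => ∑ k ∈ Finset.range n, f (u k) - n * ∫ e, f e ∂μ) 2 (iid μ) :=
    (memLp_sum_iid hf n).sub (memLp_const _)
  refine Real.le_sqrt_of_sq_le ?_
  rw [← variance_sum_iid hfm hf, variance_eq_integral (memLp_sum_iid hf n).aemeasurable,
    integral_sum_iid hfm hf]
  have := variance_nonneg (fun u : ℕ → E => |∑ k ∈ Finset.range n, f (u k) - n * ∫ e, f e ∂μ|)
    (iid μ)
  rw [variance_eq_sub
    (X := fun u : ℕ → E => |∑ k ∈ Finset.range n, f (u k) - n * ∫ e, f e ∂μ|) hL.abs] at this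
  simp only [Pi.pow_apply, sq_abs] at this
  linarith

end Moments

/-! ### Asymptotics of the probability that the walk stays nonnegative -/

section Asymptotics

variable {E : Type*} {X : E → ℤ}

theorem partialSum_cast (n : ℕ) (u : ℕ → E) :
    (partialSum X n u : ℝ) = ∑ k ∈ Finset.range n, (X (u k) : ℝ) := by
  simp [partialSum]

variable [MeasurableSpace E] {μ : Measure E} [IsProbabilityMeasure μ]

/-- A first step `1` prepended to a nonnegative walk gives a positive walk, to which the ballot
theorem applies. -/
theorem measureReal_nonneg_eq (hX : Measurable X) (h1 : ∀ e, X e ≤ 1)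
    (hi : Integrable (fun e => (X e : ℝ)) μ) (hp : μ.real {e | X e = 1} ≠ 0) (n : ℕ) :
    (iid μ).real {u | ∀ k ≤ n, 0 ≤ partialSum X k u} =
      (∫ u, max (partialSum X (n + 1) u : ℝ) 0 ∂(iid μ)) / ((n + 1) * μ.real {e | X e = 1}) := by
  rw [← measureReal_staysPos hX h1 hi, measureReal_staysPos_succ hX h1,
    eq_div_iff (mul_ne_zero (by positivity) hp)]
  ring

/-- The mean of the positive part of `S_n` is `n m + O(√n)`: positive part is 1-Lipschitz and fixes
`n m ≥ 0`. -/
theorem tendsto_measureReal_nonneg_of_pos (hX : Measurable X) (h1 : ∀ e, X e ≤ 1)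
    (hL : MemLp (fun e => (X e : ℝ)) 2 μ) (hp : μ.real {e | X e = 1} ≠ 0)
    (hpos : 0 ≤ ∫ e, (X e : ℝ) ∂μ) :
    Tendsto (fun n => (iid μ).real {u | ∀ k ≤ n, 0 ≤ partialSum X k u}) atTop
      (𝓝 ((∫ e, (X e : ℝ) ∂μ) / μ.real {e | X e = 1})) := by
  have hfm : Measurable fun e => (X e : ℝ) := measurable_intFun (fun x => (x : ℝ)) hX
  have hi := hL.integrable one_le_two
  set m := ∫ e, (X e : ℝ) ∂μ
  have key : Tendsto (fun n : ℕ => (∫ u, max (partialSum X n u : ℝ) 0 ∂(iid μ)) / n) atTop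
      (𝓝 m) := by
    rw [tendsto_iff_norm_sub_tendsto_zero]
    have hlim : Tendsto (fun n : ℕ => √(Var[fun e => (X e : ℝ); μ]) / √n) atTop (𝓝 0) :=
      tendsto_const_nhds.div_atTop (Real.tendsto_sqrt_atTop.comp tendsto_natCast_atTop_atTop)
    refine squeeze_zero' (Eventually.of_forall fun _ => norm_nonneg _) ?_ hlim
    filter_upwards [eventually_gt_atTop 0] with n hn
    have hn' : (0 : ℝ) < n := Nat.cast_pos.2 hn
    have hb := integral_abs_sum_sub_le (μ := μ) hfm hL n
    have hle : |(∫ u, max (partialSum X n u : ℝ) 0 ∂(iid μ)) - n * m| ≤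
        √(n * Var[fun e => (X e : ℝ); μ]) := by
      refine le_trans ?_ hb
      have hmi := (integrable_partialSum (μ := μ) hi n)
      have : (∫ u, max (partialSum X n u : ℝ) 0 ∂(iid μ)) - n * m =
          ∫ u, (max (partialSum X n u : ℝ) 0 - n * m) ∂(iid μ) := by
        rw [integral_sub hmi.pos_part (integrable_const _)]
        simp
      rw [this]
      refine (abs_integral_le_integral_abs).trans (integral_mono
        (hmi.pos_part.sub (integrable_const _)).abs ?_ fun u => ?_)
      · simp_rw [← partialSum_cast]
        exact (hmi.sub (integrable_const _)).abs
      · simp only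
        rw [← partialSum_cast]
        have : (n : ℝ) * m = max (n * m) 0 := (max_eq_left (by positivity)).symm
        conv_lhs => rw [this]
        exact abs_max_sub_max_le_abs _ _ _
    rw [Real.norm_eq_abs, div_sub' hn'.ne', abs_div, abs_of_pos hn']
    calc _ ≤ √(n * Var[fun e => (X e : ℝ); μ]) / n := by gcongr
      _ = _ := by
        rw [Real.sqrt_mul hn'.le]
        nth_rewrite 2 [← Real.mul_self_sqrt hn'.le]
        have := Real.sqrt_pos.2 hn'
        field_simp
  have := (key.comp (tendsto_add_atTop_nat 1)).div_const (μ.real {e | X e = 1})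
  refine this.congr fun n => ?_
  rw [measureReal_nonneg_eq hX h1 hi hp, Function.comp_apply, div_div]
  push_cast
  rfl

theorem exp_le_one_add_add_sq {x : ℝ} (hx : x ≤ 1) : Real.exp x ≤ 1 + x + x ^ 2 := by
  rcases le_total (-1) x with h | h
  · have := (abs_le.1 (Real.abs_exp_sub_one_sub_id_le (abs_le.2 ⟨h, hx⟩))).2
    linarith
  · have := Real.exp_le_one_iff.2 (show x ≤ 0 by linarith)
    nlinarith

/-- Chernoff's bound. Since the steps are bounded above, a second moment is enough to control the
mean of `exp (t X)` for `0 < t ≤ 1`. -/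
theorem exists_measureReal_nonneg_le (hX : Measurable X) (h1 : ∀ e, X e ≤ 1)
    (hL : MemLp (fun e => (X e : ℝ)) 2 μ) (hneg : ∫ e, (X e : ℝ) ∂μ < 0) :
    ∃ c : ℝ, 0 < c ∧ c < 1 ∧ ∀ n, (iid μ).real {u | 0 ≤ partialSum X n u} ≤ c ^ n := by
  have hi := hL.integrable one_le_two
  have hsq := hL.integrable_sq
  set m := ∫ e, (X e : ℝ) ∂μ with hm
  set v := ∫ e, (X e : ℝ) ^ 2 ∂μ with hv
  have hv0 : 0 ≤ v := integral_nonneg fun e => sq_nonneg _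
  obtain ⟨t, ht0, ht1, htlt⟩ : ∃ t : ℝ, 0 < t ∧ t ≤ 1 ∧ t * m + t ^ 2 * v < 0 := by
    -- This `t` satisfies `t v < -m / 2`, so the linear term dominates, and `t ≤ 1` gives `t X ≤ 1`.
    refine ⟨min 1 (-m / (2 * (v + 1))), ?_, min_le_left _ _, ?_⟩
    · have : 0 < -m / (2 * (v + 1)) := div_pos (by linarith) (by linarith)
      exact lt_min one_pos this
    · have h0 : 0 < -m / (2 * (v + 1)) := div_pos (by linarith) (by linarith)
      have h2 : 0 < min 1 (-m / (2 * (v + 1))) := lt_min one_pos h0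
      have h3 : min 1 (-m / (2 * (v + 1))) * (2 * (v + 1)) ≤ -m := by
        rw [← le_div_iff₀ (by linarith)]; exact min_le_right _ _
      nlinarith
  set g : E → ℝ≥0∞ := fun e => ENNReal.ofReal (Real.exp (t * X e)) with hg
  have hgm : Measurable g := ENNReal.measurable_ofReal.comp
    (measurable_intFun (fun x => Real.exp (t * x)) hX)
  have hint : Integrable (fun e => 1 + t * (X e : ℝ) + t ^ 2 * (X e : ℝ) ^ 2) μ :=
    ((integrable_const 1).add (hi.const_mul t)).add (hsq.const_mul _)
  have hgle : ∫⁻ e, g e ∂μ ≤ ENNReal.ofReal (1 + t * m + t ^ 2 * v) := by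
    have hle : ∀ e, Real.exp (t * X e) ≤ 1 + t * (X e : ℝ) + t ^ 2 * (X e : ℝ) ^ 2 := fun e => by
      have hx : (X e : ℝ) ≤ 1 := by exact_mod_cast h1 e
      have := exp_le_one_add_add_sq (x := t * X e) (by nlinarith)
      rwa [mul_pow] at this
    have e1 : 1 + t * m + t ^ 2 * v = ∫ e, (1 + t * (X e : ℝ) + t ^ 2 * (X e : ℝ) ^ 2) ∂μ := by
      rw [integral_add (f := fun e => 1 + t * (X e : ℝ)) ((integrable_const 1).add (hi.const_mul t))
        (hsq.const_mul _),
        integral_add (integrable_const 1) (hi.const_mul t), integral_const_mul, integral_const_mul]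
      simp
      rfl
    rw [e1, ofReal_integral_eq_lintegral_ofReal hint
      (ae_of_all _ fun e => (Real.exp_pos _).le.trans (hle e))]
    exact lintegral_mono fun e => ENNReal.ofReal_le_ofReal (hle e)
  have hc0 : 0 ≤ 1 + t * m + t ^ 2 * v := by
    by_contra hlt
    rw [ENNReal.ofReal_of_nonpos (not_le.1 hlt).le, nonpos_iff_eq_zero, lintegral_eq_zero_iff hgm] at hgle
    obtain ⟨e, he⟩ := hgle.exists
    simp only [hg, Pi.zero_apply, ENNReal.ofReal_eq_zero] at he
    exact absurd he (not_le.2 (Real.exp_pos _))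
  refine ⟨max (1 + t * m + t ^ 2 * v) (1 / 2), by positivity, max_lt (by linarith) (by norm_num),
    fun n => ?_⟩
  refine le_trans ?_ (pow_le_pow_left₀ hc0 (le_max_left _ (1 / 2)) n)
  refine ENNReal.toReal_le_of_le_ofReal (pow_nonneg hc0 n) ?_
  rw [ENNReal.ofReal_pow hc0]
  refine le_trans ?_ (pow_le_pow_left' hgle n)
  rw [← lintegral_prod_iid hgm]
  have hS : MeasurableSet {u : ℕ → E | 0 ≤ partialSum X n u} :=
    measurable_partialSum hX n measurableSet_Ici
  rw [← lintegral_indicator_one hS]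
  refine lintegral_mono fun u => ?_
  by_cases hu : u ∈ {u : ℕ → E | 0 ≤ partialSum X n u}
  swap
  · rw [Set.indicator_of_notMem hu]
    exact zero_le
  rw [Set.indicator_of_mem hu]
  simp only [hg, Pi.one_apply]
  rw [← ENNReal.ofReal_prod_of_nonneg (fun k _ => (Real.exp_pos _).le), ← Real.exp_sum,
    ← Finset.mul_sum, ← partialSum_cast, ENNReal.one_le_ofReal, Real.one_le_exp_iff]
  have : (0 : ℝ) ≤ partialSum X n u := by exact_mod_cast (show 0 ≤ partialSum X n u from hu)
  positivity

/-- The excess of `y` over `K` is at most `y ^ 2 / K`. -/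
theorem abs_integral_pos_part_sub_le {Ω : Type*} [MeasurableSpace Ω] {P : Measure Ω}
    [IsProbabilityMeasure P] {Y : Ω → ℝ} (hY : MemLp Y 2 P) {C : ℝ} (hC : ∫ ω, Y ω ^ 2 ∂P ≤ C)
    {K : ℝ} (hK : 0 < K) :
    |∫ ω, max (Y ω) 0 ∂P - ∫ ω, min (max (Y ω) 0) K ∂P| ≤ C / K := by
  have hi := (hY.integrable one_le_two).pos_part
  have hi2 : Integrable (fun ω => min (max (Y ω) 0) K) P := hi.inf (integrable_const K)
  rw [← integral_sub hi hi2]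
  refine abs_integral_le_integral_abs.trans ?_
  calc _ ≤ ∫ ω, Y ω ^ 2 / K ∂P := by
        refine integral_mono (hi.sub hi2).abs (hY.integrable_sq.div_const K) fun ω => ?_
        simp only
        rw [le_div_iff₀ hK]
        rcases le_total (max (Y ω) 0) K with h | h
        · rw [min_eq_left h]; simp; positivity
        · rw [min_eq_right h, abs_of_nonneg (by linarith)]
          rcases le_total (Y ω) 0 with h0 | h0
          · rw [max_eq_right h0] at *; nlinarith
          · rw [max_eq_left h0] at *; nlinarith
    _ ≤ C / K := by rw [integral_div]; gcongr

/-- Convergence in law and a second moment bound imply the convergence of the mean of the positive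
part. -/
theorem tendsto_integral_pos_part {Ω : Type*} [MeasurableSpace Ω] {P : Measure Ω}
    [IsProbabilityMeasure P] {γ : Measure ℝ} [IsProbabilityMeasure γ] {Y : ℕ → Ω → ℝ} {C : ℝ}
    (hY : ∀ n, MemLp (Y n) 2 P) (hC : ∀ n, ∫ ω, Y n ω ^ 2 ∂P ≤ C) (hγ : MemLp id 2 γ)
    (hCγ : ∫ x, x ^ 2 ∂γ ≤ C)
    (hlim : ∀ g : BoundedContinuousFunction ℝ ℝ,
      Tendsto (fun n => ∫ ω, g (Y n ω) ∂P) atTop (𝓝 (∫ x, g x ∂γ))) :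
    Tendsto (fun n => ∫ ω, max (Y n ω) 0 ∂P) atTop (𝓝 (∫ x, max x 0 ∂γ)) := by
  have hC0 : 0 ≤ C := (integral_nonneg fun x => sq_nonneg x).trans hCγ
  rw [Metric.tendsto_atTop]
  intro ε hε
  set K := 3 * (C + 1) / ε with hKdef
  have hK : 0 < K := by positivity
  have hCK : C / K < ε / 3 := by
    rw [hKdef, div_div_eq_mul_div, div_lt_iff₀ (by positivity)]
    nlinarith
  let g : BoundedContinuousFunction ℝ ℝ := BoundedContinuousFunction.ofNormedAddCommGroup
    (fun x => min (max x 0) K) (by fun_prop) K (fun x => by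
      rw [Real.norm_of_nonneg (le_min (le_max_right _ _) hK.le)]
      exact min_le_right _ _)
  obtain ⟨N, hN⟩ := Metric.tendsto_atTop.1 (hlim g) (ε / 3) (by positivity)
  refine ⟨N, fun n hn => ?_⟩
  have h1 := abs_integral_pos_part_sub_le (hY n) (hC n) hK
  have h2 := abs_integral_pos_part_sub_le hγ hCγ hK
  have h3 := hN n hn
  rw [Real.dist_eq] at h3 ⊢
  change |∫ ω, min (max (Y n ω) 0) K ∂P - ∫ x, min (max x 0) K ∂γ| < ε / 3 at h3
  simp only [id] at h2
  rw [abs_lt] at *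
  rw [abs_le] at h1 h2
  constructor <;> linarith

/-- By the central limit theorem and uniform integrability, the mean of the positive part of `S_n /
√n` tends to that of a centred Gaussian variable, which is positive as the variance is not zero. The
ballot formula then gives the order `n ^ (-1/2)`. -/
theorem exists_tendsto_sqrt_mul_measureReal_nonneg (hX : Measurable X) (h1 : ∀ e, X e ≤ 1)
    (hL : MemLp (fun e => (X e : ℝ)) 2 μ) (hp : 0 < μ.real {e | X e = 1})
    (h0 : ∫ e, (X e : ℝ) ∂μ = 0) :
    ∃ c : ℝ, 0 < c ∧ Tendsto (fun n : ℕ => √n * (iid μ).real {u | ∀ k ≤ n, 0 ≤ partialSum X k u})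
      atTop (𝓝 c) := by
  have hfm : Measurable fun e => (X e : ℝ) := measurable_intFun (fun x => (x : ℝ)) hX
  have hi := hL.integrable one_le_two
  set v := Var[fun e => (X e : ℝ); μ] with hv
  -- With zero variance the steps would vanish almost surely, whereas they equal `1` with positive
  -- probability.
  have hv0 : 0 < v := by
    refine lt_of_le_of_ne (variance_nonneg _ _) fun h => ?_
    have := ae_eq_integral_of_variance_eq_zero hL h.symm
    rw [h0] at this
    have h2 : μ {e | X e = 1} = 0 := by
      refine measure_mono_null (fun e he => ?_) (ae_iff.1 this)
      simp only [Set.mem_ofPred_eq] at he ⊢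
      simp [he]
    simp [measureReal_def, h2] at hp
  have hvn : v.toNNReal ≠ 0 := by simpa using hv0
  have hid := fun k => (identDistrib_iid (μ := μ) hfm k).trans (identDistrib_iid (μ := μ) hfm 0).symm
  have hvar0 : Var[fun u : ℕ → E => (X (u 0) : ℝ); iid μ] = v :=
    (identDistrib_iid (μ := μ) hfm 0).variance_eq
  have hm0 : ∫ u : ℕ → E, (X (u 0) : ℝ) ∂(iid μ) = 0 :=
    (identDistrib_iid (μ := μ) hfm 0).integral_eq.trans h0
  have hclt := tendstoInDistribution_inv_sqrt_mul_sum_sub (P := iid μ)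
    (X := fun (k : ℕ) (u : ℕ → E) => (X (u k) : ℝ)) (P' := gaussianReal 0 v.toNNReal) (Y := id)
    (by rw [hvar0]; exact ⟨by fun_prop, Measure.map_id⟩) (memLp_eval hL 0) (iIndepFun_iid hfm) hid
  simp only [hm0, mul_zero, sub_zero, ← partialSum_cast] at hclt
  have hmS : ∀ n : ℕ, Measurable fun u : ℕ → E => (√n)⁻¹ * (partialSum X n u : ℝ) := fun n =>
    (measurable_intFun (fun x => (x : ℝ)) (measurable_partialSum hX n)).const_mul _
  have hsq : ∀ n : ℕ, ∫ u, ((√n)⁻¹ * (partialSum X n u : ℝ)) ^ 2 ∂(iid μ) ≤ v := fun n => by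
    simp_rw [mul_pow]
    rw [integral_const_mul]
    have e := variance_sum_iid (μ := μ) hfm hL n
    rw [variance_eq_integral (memLp_sum_iid hL n).aemeasurable, integral_sum_iid hfm hL, h0] at e
    simp only [mul_zero, sub_zero, ← partialSum_cast] at e
    rw [e, inv_pow, Real.sq_sqrt (Nat.cast_nonneg n), ← mul_assoc]
    refine mul_le_of_le_one_left hv0.le ?_
    exact inv_mul_le_one
  have hγ2 : ∫ x, x ^ 2 ∂(gaussianReal 0 v.toNNReal) ≤ v := by
    have := variance_id_gaussianReal (μ := 0) (v := v.toNNReal)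
    rw [variance_of_integral_eq_zero (by fun_prop) (by simp)] at this
    simp only [id] at this
    rw [this, Real.coe_toNNReal _ hv0.le]
  have hlim := tendsto_integral_pos_part (P := iid μ) (γ := gaussianReal 0 v.toNNReal)
    (Y := fun n u => (√n)⁻¹ * (partialSum X n u : ℝ)) (C := v)
    (fun n => by
      simp_rw [partialSum_cast]
      exact (memLp_sum_iid hL n).const_mul _) hsq (memLp_id_gaussianReal' 2 (by simp)) hγ2
    (fun g => by
      have := ProbabilityMeasure.tendsto_iff_forall_integral_tendsto.1 hclt.tendsto g
      simp only [ProbabilityMeasure.coe_mk, Measure.map_id] at this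
      refine this.congr fun n => ?_
      exact integral_map (hmS n).aemeasurable g.continuous.measurable.aestronglyMeasurable)
  have hpos : 0 < ∫ x, max x 0 ∂(gaussianReal 0 v.toNNReal) := by
    have hint : Integrable (fun x : ℝ => max x 0) (gaussianReal 0 v.toNNReal) :=
      ((memLp_id_gaussianReal' 2 (by simp)).integrable one_le_two).pos_part
    refine (integral_pos_iff_support_of_nonneg (f := fun x : ℝ => max x 0)
      (fun x => le_max_right _ _) hint).2 ?_
    have hsub : Set.Ioi (0 : ℝ) ⊆ Function.support fun x : ℝ => max x 0 := fun x hx => by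
      have hx' : (0 : ℝ) < x := hx
      simp only [Function.mem_support, max_eq_left hx'.le]
      exact hx'.ne'
    refine lt_of_lt_of_le (pos_iff_ne_zero.2 fun h => ?_) (measure_mono hsub)
    have := gaussianReal_absolutelyContinuous' 0 hvn h
    simp at this
  refine ⟨_, div_pos hpos hp, ?_⟩
  have hratio : Tendsto (fun n : ℕ => √((n : ℝ) / (n + 1))) atTop (𝓝 1) := by
    have := (Real.continuous_sqrt.tendsto 1).comp (tendsto_natCast_div_add_atTop (1 : ℝ))
    rw [Real.sqrt_one] at this
    exact this
  have := (hratio.mul (hlim.comp (tendsto_add_atTop_nat 1))).div_const (μ.real {e | X e = 1})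
  rw [one_mul] at this
  refine this.congr fun n => ?_
  rw [measureReal_nonneg_eq hX h1 hi hp.ne', Function.comp_apply]
  have e : ∀ u : ℕ → E, max ((√((n + 1 : ℕ) : ℝ))⁻¹ * (partialSum X (n + 1) u : ℝ)) 0 =
      (√((n + 1 : ℕ) : ℝ))⁻¹ * max (partialSum X (n + 1) u : ℝ) 0 := fun u => by
    rw [mul_max_of_nonneg _ _ (by positivity), mul_zero]
  simp_rw [e]
  rw [integral_const_mul, Real.sqrt_div (Nat.cast_nonneg n)]
  push_cast
  have hs : (0 : ℝ) < n + 1 := by positivity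
  have hs2 := Real.sqrt_pos.2 hs
  have hs3 := Real.mul_self_sqrt hs.le
  generalize ∫ u, max (partialSum X (n + 1) u : ℝ) 0 ∂(iid μ) = I
  nth_rewrite 3 [← hs3]
  field_simp

end Asymptotics

/-! ### Exploring by blocks of steps -/

section Block

variable {l : ℕ} {v : ℕ → ℕ → Env} {h : ℤ} {E : Env}

noncomputable def foundCount (l : ℕ) (u : ℕ → Env) : ℕ := (found l u).encard.toNat

theorem foundCount_eq {u : ℕ → Env} (hu : ∀ k, Good (u k)) :
    (foundCount l u : ℕ∞) = (found l u).encard :=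
  ENat.natCast_toNat ((encard_found_le (n := l) hu).trans_lt (ENat.natCast_lt_top _)).ne

theorem foundCount_le {u : ℕ → Env} (hu : ∀ k, Good (u k)) : foundCount l u ≤ volumeN l u := by
  have := encard_found_le (n := l) hu
  rw [← foundCount_eq hu] at this
  exact_mod_cast this

theorem pending_le (l : ℕ) (u : ℕ → Env) : pending l u ≤ volumeN l u := by
  classical
  refine Finset.sum_le_sum fun k _ => ?_
  split_ifs
  · exact le_rfl
  · exact Nat.zero_le _

/-- The environment made of `J` blocks of `l` steps, followed by `E`. -/
noncomputable def chainBlocks (l : ℕ) : ℕ → (ℕ → ℕ → Env) → Env → Env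
  | 0, _, E => E
  | J + 1, v, E => chain l (v 0) (chainBlocks l J (shift v) E)

def AliveBlocks (l : ℕ) : ℕ → (ℕ → ℕ → Env) → ℤ → Prop
  | 0, _, h => 0 ≤ h
  | J + 1, v, h => Alive l (v 0) h ∧ AliveBlocks l J (shift v) (h + walk l (v 0))

theorem sum_le_encard_stackCluster (hv : ∀ j k, Good (v j k)) {J : ℕ} (ha : AliveBlocks l J v h) :
    ((∑ j ∈ Finset.range J, foundCount l (v j) : ℕ) : ℕ∞) ≤
      (stackCluster h (chainBlocks l J v E)).encard := by
  induction J generalizing v h with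
  | zero => simp
  | succ J ih =>
    refine le_trans ?_ (le_encard_stackCluster (hv 0) ha.1)
    rw [Finset.sum_range_succ', Nat.cast_add, foundCount_eq (hv 0)]
    gcongr
    exact ih (v := shift v) (fun j => hv (j + 1)) ha.2

theorem Alive.nonneg_end {n : ℕ} {u : ℕ → Env} (ha : Alive n u h) : 0 ≤ h + walk n u :=
  alive_iff.1 ha n le_rfl

/-- Each block survived contributes its found and pending vertices. The block in which the
exploration dies is charged its full volume, at most `W`. -/
theorem encard_stackCluster_le_sum (hv : ∀ j k, Good (v j k)) {J : ℕ} (hh : 0 ≤ h)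
    (ha : ¬ AliveBlocks l J v h) {W : ℕ} (hW : ∀ j < J, volumeN l (v j) ≤ W) :
    (stackCluster h (chainBlocks l J v E)).encard ≤
      ((∑ j ∈ Finset.range J, (foundCount l (v j) + pending l (v j)) + W : ℕ) : ℕ∞) := by
  induction J generalizing v h with
  | zero => exact absurd hh ha
  | succ J ih =>
    by_cases h1 : Alive l (v 0) h
    · refine (encard_stackCluster_le_found_add_pending (hv 0) h1).trans ?_
      rw [Finset.sum_range_succ', Nat.add_right_comm, Nat.cast_add, Nat.cast_add (foundCount l (v 0)),
        foundCount_eq (hv 0)]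
      gcongr
      exact ih (v := shift v) (fun j => hv (j + 1)) h1.nonneg_end (fun h2 => ha ⟨h1, h2⟩)
        fun j hj => hW (j + 1) (by omega)
    · refine (encard_stackCluster_le_of_not_alive (hv 0) hh h1).trans ?_
      exact_mod_cast (hW 0 (by omega)).trans (Nat.le_add_left _ _)

/-- The sequence of the successive blocks of length `l`. -/
def flatten (l : ℕ) (v : ℕ → ℕ → Env) : ℕ → Env := fun k => v (k / l) (k % l)

theorem shiftN_flatten (hl : 0 < l) (v : ℕ → ℕ → Env) :
    shiftN l (flatten l v) = flatten l (shift v) := by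
  ext1 k
  simp [shiftN, flatten, shift, Nat.add_div_right k hl]

theorem walk_flatten {k : ℕ} (hk : k ≤ l) (v : ℕ → ℕ → Env) :
    walk k (flatten l v) = walk k (v 0) := by
  refine Finset.sum_congr rfl fun i hi => ?_
  have := (Finset.mem_range.1 hi).trans_le hk
  rw [flatten, Nat.div_eq_of_lt this, Nat.mod_eq_of_lt this]

theorem aliveBlocks_iff (hl : 0 < l) {J : ℕ} :
    AliveBlocks l J v h ↔ Alive (l * J) (flatten l v) h := by
  induction J generalizing v h with
  | zero => rfl
  | succ J ih =>
    rw [Nat.mul_succ, add_comm (l * J), alive_add, shiftN_flatten hl, ← ih, walk_flatten le_rfl]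
    refine and_congr ?_ Iff.rfl
    simp only [alive_iff]
    exact forall_congr' fun k => forall_congr' fun hk => by rw [walk_flatten hk]

/-! ### Laws and moments of blocks, and comparison of duration with volume -/

variable {α p : ℝ}

theorem measurePreserving_flatten (l : ℕ) :
    MeasurePreserving (flatten l) (iid (seqLaw α p)) (seqLaw α p) := by
  have h1 : MeasurePreserving (fun (v : ℕ → ℕ → Env) (e : ℕ × ℕ) => v e.1 e.2) (iid (seqLaw α p))
      (Measure.infinitePi fun _ : ℕ × ℕ => envLaw α p) :=
    ⟨by fun_prop, Measure.infinitePi_map_curry_symm fun _ _ => envLaw α p⟩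
  have h2 := measurePreserving_reindex (fun _ : ℕ × ℕ => envLaw α p)
    (f := fun k : ℕ => (k / l, k % l)) (fun a b hab => by
      simp only [Prod.mk.injEq] at hab
      rw [← Nat.div_add_mod a l, ← Nat.div_add_mod b l, hab.1, hab.2])
  exact h2.comp h1

theorem measurePreserving_chainBlocks (α p : ℝ) (l J : ℕ) :
    MeasurePreserving (fun q : (ℕ → ℕ → Env) × Env => chainBlocks l J q.1 q.2)
      ((iid (seqLaw α p)).prod (envLaw α p)) (envLaw α p) := by
  induction J with
  | zero => exact measurePreserving_snd
  | succ n ih =>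
    have hd := measurePreserving_headTail (seqLaw α p)
    exact (measurePreserving_chain α p l).comp (((MeasurePreserving.id _).prod ih).comp
      ((measurePreserving_assoc _ _ _).comp (hd.prod (MeasurePreserving.id _))))

/-- The probability that the exploration lasts for at least `n` steps. -/
noncomputable def survival (α p : ℝ) (n : ℕ) : ℝ := (seqLaw α p).real {u | Alive n u 0}

theorem measurableSet_alive (n : ℕ) (h : ℤ) : MeasurableSet {u | Alive n u h} :=
  measurableSet_setOfPred.2 (measurable_alive n h)

theorem measureReal_aliveBlocks (hl : 0 < l) (J : ℕ) :
    (iid (seqLaw α p)).real {v | AliveBlocks l J v 0} = survival α p (l * J) := by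
  rw [survival, ← (measurePreserving_flatten l).measureReal_preimage
    (measurableSet_alive _ _).nullMeasurableSet]
  simp only [aliveBlocks_iff hl]
  rfl

theorem survival_eq (n : ℕ) :
    survival α p n = (iid (envLaw α p)).real {u | ∀ k ≤ n, 0 ≤ partialSum dh k u} := by
  unfold survival
  simp only [alive_iff, zero_add]
  rfl

theorem ae_good_seq (hα : 1 / 2 < α) (hα' : α < 1) :
    ∀ᵐ u ∂(seqLaw α p), ∀ k, Good (u k) :=
  ae_all_iff.2 fun k => (measurePreserving_eval_infinitePi
    (fun _ : ℕ => envLaw α p) k).quasiMeasurePreserving.ae (ae_good hα hα')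

theorem ae_good_blocks (hα : 1 / 2 < α) (hα' : α < 1) :
    ∀ᵐ v ∂(iid (seqLaw α p)), ∀ j k, Good (v j k) :=
  ae_all_iff.2 fun j => (measurePreserving_eval_infinitePi
    (fun _ : ℕ => seqLaw α p) j).quasiMeasurePreserving.ae (ae_good_seq hα hα')

theorem measureReal_le_add_of_ae {Ω : Type*} [MeasurableSpace Ω] {μ : Measure Ω}
    [IsProbabilityMeasure μ] {S T R : Set Ω} (h : ∀ᵐ ω ∂μ, ω ∈ S → ω ∈ T ∨ ω ∈ R) :
    μ.real S ≤ μ.real T + μ.real R := by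
  refine le_trans ?_ (measureReal_union_le T R)
  exact ENNReal.toReal_mono (measure_ne_top _ _) (measure_mono_ae h)

theorem measureReal_fst {A B : Type*} [MeasurableSpace A] [MeasurableSpace B] {μ : Measure A}
    {ν : Measure B} [IsProbabilityMeasure μ] [IsProbabilityMeasure ν] (S : Set A) :
    (μ.prod ν).real {q | q.1 ∈ S} = μ.real S := by
  have : {q : A × B | q.1 ∈ S} = S ×ˢ Set.univ := by ext; simp
  rw [this, measureReal_prod_prod]
  simp

theorem tail_eq_blocks (l J n : ℕ) : tail α p n = ((iid (seqLaw α p)).prod (envLaw α p)).real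
    {q | (n : ℕ∞) ≤ (stackCluster 0 (chainBlocks l J q.1 q.2)).encard} := by
  rw [tail_eq]
  exact ((measurePreserving_chainBlocks α p l J).measureReal_preimage
    ((measurable_encard_stackCluster 0)
      (MeasurableSet.of_discrete (s := Set.Ici (n : ℕ∞)))).nullMeasurableSet).symm

theorem ae_prod_fst {A B : Type*} [MeasurableSpace A] [MeasurableSpace B] {μ : Measure A}
    {ν : Measure B} [IsProbabilityMeasure μ] [IsProbabilityMeasure ν] {P : A → Prop}
    (h : ∀ᵐ a ∂μ, P a) : ∀ᵐ q ∂(μ.prod ν), P q.1 :=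
  (measurePreserving_fst (μ := μ) (ν := ν)).quasiMeasurePreserving.ae h

theorem memLp_volumeN (hα : 1 / 2 < α) (hα' : α < 1) (l : ℕ) :
    MemLp (fun u => (volumeN l u : ℝ)) 2 (seqLaw α p) := by
  have := memLp_sum_iid (μ := envLaw α p) (memLp_volume hα hα') l
  refine this.ae_eq (ae_of_all _ fun u => ?_)
  simp [volumeN]

theorem measurable_foundCount (l : ℕ) : Measurable (foundCount l) :=
  (measurable_of_countable ENat.toNat).comp (measurable_encard_found l)

theorem memLp_foundCount (hα : 1 / 2 < α) (hα' : α < 1) (l : ℕ) :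
    MemLp (fun u => (foundCount l u : ℝ)) 2 (seqLaw α p) := by
  refine (memLp_volumeN hα hα' l).mono
    (measurable_natCast_real (measurable_foundCount l)).aestronglyMeasurable ?_
  filter_upwards [ae_good_seq hα hα'] with u hu
  simpa using foundCount_le hu

theorem memLp_pending (hα : 1 / 2 < α) (hα' : α < 1) (l : ℕ) :
    MemLp (fun u => (pending l u : ℝ)) 2 (seqLaw α p) := by
  refine (memLp_volumeN hα hα' l).mono
    (measurable_natCast_real (measurable_pending l)).aestronglyMeasurable (ae_of_all _ fun u => ?_)
  simpa using pending_le l u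

/-- The mean number of vertices found during `l` steps. -/
noncomputable def meanFound (α p : ℝ) (l : ℕ) : ℝ := ∫ u, (foundCount l u : ℝ) ∂(seqLaw α p)

/-- The mean volume left undecided after `l` steps. -/
noncomputable def meanPending (α p : ℝ) (l : ℕ) : ℝ := ∫ u, (pending l u : ℝ) ∂(seqLaw α p)

/-- A long exploration finds many vertices. -/
theorem survival_le (hα : 1 / 2 < α) (hα' : α < 1) (hl : 0 < l) {n J : ℕ}
    (hn : (n : ℝ) < J * meanFound α p l) : survival α p (l * J) ≤ tail α p n +
      J * Var[fun u => (foundCount l u : ℝ); seqLaw α p] / (J * meanFound α p l - n) ^ 2 := by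
  have hm := measurable_natCast_real (measurable_foundCount l)
  have hcheb := measureReal_abs_sum_sub_ge (μ := seqLaw α p) hm
    (memLp_foundCount hα hα' l) J (sub_pos.2 hn)
  refine le_trans ?_ (add_le_add le_rfl hcheb)
  rw [tail_eq_blocks l J, ← measureReal_aliveBlocks hl,
    ← measureReal_fst (ν := envLaw α p) {v | AliveBlocks l J v 0},
    ← measureReal_fst (ν := envLaw α p) {u | _ ≤ |_|}]
  refine measureReal_le_add_of_ae ?_
  filter_upwards [ae_prod_fst (ae_good_blocks hα hα')] with q hq ha
  have hle := sum_le_encard_stackCluster (E := q.2) hq ha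
  -- Either the vertices found are already numerous enough, or their sum deviates from its mean by
  -- at least `J * meanFound α p l - n`.
  by_cases h1 : n ≤ ∑ j ∈ Finset.range J, foundCount l (q.1 j)
  · exact .inl ((Nat.cast_le.2 h1).trans hle)
  · right
    have : (∑ j ∈ Finset.range J, (foundCount l (q.1 j) : ℝ)) ≤ n := by
      exact_mod_cast (not_le.1 h1).le
    refine le_trans ?_ (neg_le_abs _)
    unfold meanFound
    linarith

/-- A short exploration finds few vertices. -/
theorem tail_le (hα : 1 / 2 < α) (hα' : α < 1) (hl : 0 < l) {n J : ℕ} {δ : ℝ} (hδ : 0 < δ)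
    (hn : 0 < n) (hJ : J * (meanFound α p l + meanPending α p l) ≤ (1 - δ) * n) :
    tail α p n ≤ survival α p (l * J) + J / n ^ 2 *
      ((Var[fun u => (foundCount l u : ℝ) + pending l u; seqLaw α p] +
        ∫ u, (volumeN l u : ℝ) ^ 2 ∂(seqLaw α p)) / (δ / 2) ^ 2) := by
  have hm : Measurable fun u => (foundCount l u : ℝ) + pending l u :=
    (measurable_natCast_real (measurable_foundCount l)).add
      (measurable_natCast_real (measurable_pending l))
  have hL := (memLp_foundCount (p := p) hα hα' l).add (memLp_pending hα hα' l)
  have hmean : ∫ u, ((foundCount l u : ℝ) + pending l u) ∂(seqLaw α p) =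
      meanFound α p l + meanPending α p l :=
    integral_add ((memLp_foundCount hα hα' l).integrable one_le_two)
      ((memLp_pending hα hα' l).integrable one_le_two)
  have hn' : (0 : ℝ) < n := Nat.cast_pos.2 hn
  -- The margin `δ n` is divided in two: one half for the deviation of the sum over the blocks, the
  -- other for the volume of the block in which the exploration dies.
  have ht : 0 < δ / 2 * n := by positivity
  have hcheb := measureReal_abs_sum_sub_ge (μ := seqLaw α p) hm hL J ht
  have hvol : (iid (seqLaw α p)).real (⋃ j ∈ Finset.range J,
      {v : ℕ → ℕ → Env | δ / 2 * n ≤ volumeN l (v j)}) ≤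
        J * ((∫ u, (volumeN l u : ℝ) ^ 2 ∂(seqLaw α p)) / (δ / 2 * n) ^ 2) := by
    refine (measureReal_biUnion_finset_le _ _).trans ?_
    have hj : ∀ j ∈ Finset.range J, (iid (seqLaw α p)).real
        {v : ℕ → ℕ → Env | δ / 2 * n ≤ volumeN l (v j)} ≤
          (∫ u, (volumeN l u : ℝ) ^ 2 ∂(seqLaw α p)) / (δ / 2 * n) ^ 2 := by
      intro j _
      have hS : MeasurableSet {u : ℕ → Env | δ / 2 * n ≤ (volumeN l u : ℝ)} :=
        measurable_natCast_real (measurable_volumeN l) measurableSet_Ici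
      have e := (measurePreserving_eval_infinitePi
        (fun _ : ℕ => seqLaw α p) j).measureReal_preimage hS.nullMeasurableSet
      refine e.trans_le ?_
      rw [le_div_iff₀ (by positivity), mul_comm]
      refine le_trans ?_ (mul_meas_ge_le_integral_of_nonneg (ae_of_all _ fun u => sq_nonneg _)
        (memLp_volumeN hα hα' l).integrable_sq ((δ / 2 * n) ^ 2))
      refine mul_le_mul_of_nonneg_left (measureReal_mono fun u hu => ?_) (by positivity)
      exact pow_le_pow_left₀ ht.le hu 2
    refine (Finset.sum_le_sum hj).trans ?_
    simp
  set R : Set (ℕ → ℕ → Env) := ⋃ j ∈ Finset.range J, {v | δ / 2 * n ≤ volumeN l (v j)} with hR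
  set R' : Set (ℕ → ℕ → Env) := {v | δ / 2 * n ≤ |∑ k ∈ Finset.range J,
    ((foundCount l (v k) : ℝ) + pending l (v k)) -
      J * ∫ u, ((foundCount l u : ℝ) + pending l u) ∂(seqLaw α p)|} with hR'
  have hmain : tail α p n ≤ survival α p (l * J) + (iid (seqLaw α p)).real (R' ∪ R) := by
    rw [tail_eq_blocks l J, ← measureReal_aliveBlocks hl,
      ← measureReal_fst (ν := envLaw α p) {v | AliveBlocks l J v 0},
      ← measureReal_fst (ν := envLaw α p) (R' ∪ R)]
    refine measureReal_le_add_of_ae ?_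
    filter_upwards [ae_prod_fst (ae_good_blocks hα hα')] with q hq hle
    by_cases ha : AliveBlocks l J q.1 0
    · exact .inl ha
    right
    by_cases hq2 : q.1 ∈ R
    · exact .inr hq2
    left
    simp only [hR, Set.mem_iUnion, Set.mem_ofPred_eq, not_exists, not_le, Finset.mem_range] at hq2
    have hW : ∀ j < J, volumeN l (q.1 j) ≤ ⌊δ / 2 * n⌋₊ := fun j hj =>
      Nat.le_floor (hq2 j hj).le
    have hup := encard_stackCluster_le_sum (E := q.2) hq le_rfl ha hW
    have h3 : n ≤ ∑ j ∈ Finset.range J, (foundCount l (q.1 j) + pending l (q.1 j)) + ⌊δ / 2 * n⌋₊ := by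
      have h4 : (n : ℕ∞) ≤ _ := le_trans hle hup
      exact_mod_cast h4
    have h5 : (n : ℝ) ≤ ∑ j ∈ Finset.range J, ((foundCount l (q.1 j) : ℝ) + pending l (q.1 j)) +
        (⌊δ / 2 * n⌋₊ : ℝ) := by exact_mod_cast h3
    have h6 := Nat.floor_le ht.le
    simp only [hR', Set.mem_ofPred_eq]
    refine le_trans ?_ (le_abs_self _)
    rw [hmean]
    linarith
  refine hmain.trans (add_le_add le_rfl ((measureReal_union_le _ _).trans
    ((add_le_add hcheb hvol).trans (le_of_eq ?_))))
  field_simp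

end Block

/-! ### Means of the pending volume and of the number of found vertices -/

section

variable {α p : ℝ}

open Classical in
theorem pending_succ (l : ℕ) (u : ℕ → Env) :
    pending (l + 1) u = if Renews (u l) then 0 else pending l u + volume (u l) := by
  unfold pending
  rw [Finset.sum_range_succ]
  split_ifs with h1 h2 h2
  · exact absurd h2 (h1 l le_rfl (by omega))
  · congr 1
    refine Finset.sum_congr rfl fun k hk => ?_
    congr 1
    refine propext ⟨fun h i hi hil => h i hi (by omega), fun h i hi hil => ?_⟩
    rcases Nat.lt_succ_iff_lt_or_eq.1 hil with h3 | rfl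
    · exact h i hi h3
    · exact h2
  · rw [add_zero]
    refine Finset.sum_eq_zero fun k hk => if_neg fun h => h l ?_ (by omega) h2
    exact (Finset.mem_range.1 hk).le
  · refine absurd (fun i hi hil => ?_) h1
    obtain rfl : i = l := by omega
    exact h2

theorem pending_skipTerm (l : ℕ) (u : ℕ → Env) : pending l (skipTerm l u) = pending l u := by
  classical
  have h : ∀ k < l, skipTerm l u k = u k := fun k hk => by rw [skipTerm, if_pos hk]
  refine Finset.sum_congr rfl fun k hk => ?_
  rw [h k (Finset.mem_range.1 hk)]
  congr 1
  refine propext (forall_congr' fun i => forall_congr' fun _ => forall_congr' fun hi => ?_)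
  rw [h i hi]

/-- A renewal resets the pending volume to zero independently of the past. So the mean satisfies
`x_{l+1} ≤ (1 - g) x_l + V`, and `V / g` is the fixed point of this recursion. -/
theorem meanPending_le (hα : 1 / 2 < α) (hα' : α < 1) (h0 : 0 ≤ p) (h1 : p < 1) (l : ℕ) :
    meanPending α p l ≤ (∫ u, (volume u : ℝ) ∂(envLaw α p)) / (envLaw α p).real {u | Renews u} := by
  classical
  set g := (envLaw α p).real {u | Renews u} with hg
  set V := ∫ u, (volume u : ℝ) ∂(envLaw α p) with hV
  have hg0 : 0 < g := ENNReal.toReal_pos (measure_renews_pos hα hα' h0 h1).ne' (measure_ne_top _ _)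
  have hV0 : 0 ≤ V := integral_nonneg fun u => Nat.cast_nonneg _
  induction l with
  | zero =>
    have : meanPending α p 0 = 0 := by simp [meanPending, pending]
    rw [this]; positivity
  | succ l ih =>
    have hpi := (memLp_pending (p := p) hα hα' l).integrable one_le_two
    have hvi := (memLp_volume (p := p) hα hα').integrable one_le_two
    have hc : MeasurableSet {u : Env | ¬ Renews u} := measurableSet_renews.compl
    have hmp := measurePreserving_skipTerm (μ := envLaw α p) l
    have hprod : ∫ u, (pending l u : ℝ) * (if Renews (u l) then 0 else 1) ∂(seqLaw α p) =
        meanPending α p l * (1 - g) := by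
      have e := integral_map (μ := seqLaw α p) hmp.measurable.aemeasurable
        (f := fun q : (ℕ → Env) × Env => (pending l q.1 : ℝ) * (if Renews q.2 then 0 else 1))
        (((measurable_natCast_real (measurable_pending l)).comp measurable_fst).mul
          (Measurable.ite (measurableSet_renews.preimage measurable_snd) measurable_const
            measurable_const)).aestronglyMeasurable
      rw [show seqLaw α p = iid (envLaw α p) from rfl, hmp.map_eq,
        integral_prod_mul (fun u => (pending l u : ℝ))
        (fun u : Env => if Renews u then (0 : ℝ) else 1)] at e
      simp only [pending_skipTerm] at e
      have e2 : ∫ u : Env, (if Renews u then (0 : ℝ) else 1) ∂(envLaw α p) = 1 - g := by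
        rw [hg, ← probReal_compl_eq_one_sub measurableSet_renews]
        have := integral_indicator_one (μ := envLaw α p) hc
        rw [show {u | Renews u}ᶜ = {u : Env | ¬ Renews u} from rfl, ← this]
        refine integral_congr_ae (ae_of_all _ fun u => ?_)
        by_cases h : Renews u <;> simp [h]
      rw [e2] at e
      exact e.symm
    have hstep : meanPending α p (l + 1) ≤ meanPending α p l * (1 - g) + V := by
      have hVl : ∫ u : ℕ → Env, (volume (u l) : ℝ) ∂(seqLaw α p) = V :=
        (identDistrib_iid (μ := envLaw α p) (measurable_natCast_real measurable_volume) l).integral_eq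
      have hvil : Integrable (fun u : ℕ → Env => (volume (u l) : ℝ)) (seqLaw α p) :=
        (memLp_eval (memLp_volume hα hα') l).integrable one_le_two
      have hb : Integrable (fun u : ℕ → Env => (pending l u : ℝ) * (if Renews (u l) then 0 else 1))
          (seqLaw α p) := by
        refine hpi.mono' (((measurable_natCast_real (measurable_pending l))).mul
          (Measurable.ite (measurableSet_renews.preimage (measurable_pi_apply l)) measurable_const
            measurable_const)).aestronglyMeasurable (ae_of_all _ fun u => ?_)
        split_ifs <;> simp
      rw [← hprod, ← hVl, ← integral_add hb hvil]
      refine integral_mono ((memLp_pending hα hα' (l + 1)).integrable one_le_two) (hb.add hvil)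
        fun u => ?_
      simp only
      rw [pending_succ]
      split_ifs
      · simp
      · simp
    have hg1 : g ≤ 1 := measureReal_le_one
    calc meanPending α p (l + 1) ≤ V / g * (1 - g) + V := hstep.trans (by
          have : 0 ≤ 1 - g := by linarith
          gcongr)
      _ = V / g := by field_simp; ring

/-- A bottom step at the start finds the origin, and what is found is never lost. -/
theorem meanFound_pos (hα : 1 / 2 < α) (hα' : α < 1) (h0 : 0 ≤ p) (h1 : p < 1) {l : ℕ}
    (hl : 0 < l) : 0 < meanFound α p l := by
  have hb : 0 < (envLaw α p).real {u | IsBottom u} := by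
    rw [measureReal_def, measure_isBottom (by linarith) hα'.le h0 h1.le, ENNReal.toReal_ofReal
      (mul_nonneg (by linarith) (by linarith))]
    exact mul_pos (by linarith) (by linarith)
  have hS : MeasurableSet {u : ℕ → Env | IsBottom (u 0)} :=
    measurableSet_isBottom.preimage (measurable_pi_apply 0)
  have e : (seqLaw α p).real {u : ℕ → Env | IsBottom (u 0)} = (envLaw α p).real {u | IsBottom u} :=
    (measurePreserving_eval_infinitePi
      (fun _ : ℕ => envLaw α p) 0).measureReal_preimage measurableSet_isBottom.nullMeasurableSet
  rw [← e] at hb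
  refine hb.trans_le ?_
  rw [meanFound, ← integral_indicator_one (μ := seqLaw α p) hS]
  refine integral_mono_ae ((integrable_const (1 : ℝ)).indicator hS)
    ((memLp_foundCount hα hα' l).integrable one_le_two) ?_
  filter_upwards [ae_good_seq hα hα'] with u hu
  refine Set.indicator_apply_le' (fun hb => ?_) (fun _ => Nat.cast_nonneg _)
  have h1 : (1 : ℕ∞) ≤ (foundCount l u : ℕ∞) := by
    rw [foundCount_eq hu]
    exact (one_le_encard_found hb).trans (Set.encard_le_encard (found_mono hl))
  simp only [Pi.one_apply]
  exact_mod_cast h1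

/-! ### The law of the walk -/

theorem measureReal_dh_eq_one (h0 : 0 ≤ p) (h1 : p ≤ 1) : (envLaw α p).real {u | dh u = 1} = p := by
  classical
  have : {u | dh u = 1} = {u | IsOpen1 u} := by
    ext u
    simp only [Set.mem_ofPred_eq]
    rw [dh_eq]
    constructor
    · intro h
      by_contra hn
      simp only [hn, if_false] at h
      omega
    · exact fun h => by rw [← dh_eq, h.dh_eq]
  rw [this, measureReal_def, measure_isOpen1 h0 h1, ENNReal.toReal_ofReal h0]

theorem exists_survival_le (hα : 1 / 2 < α) (hα' : α < 1) (h0 : 0 ≤ p) (h1 : p < criticalParam α) :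
    ∃ c : ℝ, 0 < c ∧ c < 1 ∧ ∀ n, survival α p n ≤ c ^ n := by
  have hη := eta_pos hα hα'
  have hneg : ∫ u, (dh u : ℝ) ∂(envLaw α p) < 0 := by
    rw [integral_dh hα hα' h0 (h1.le.trans (criticalParam_lt_one hα hα').le)]
    exact mul_neg_of_pos_of_neg (by linarith) (by linarith)
  obtain ⟨c, hc0, hc1, hc⟩ := exists_measureReal_nonneg_le measurable_dh dh_le_one
    (memLp_dh hα hα') hneg
  refine ⟨c, hc0, hc1, fun n => le_trans ?_ (hc n)⟩
  rw [survival_eq]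
  exact measureReal_mono fun u hu => hu n le_rfl

theorem tendsto_sqrt_mul_survival (hα : 1 / 2 < α) (hα' : α < 1) : ∃ c : ℝ, 0 < c ∧
    Tendsto (fun n : ℕ => √n * survival α (criticalParam α) n) atTop (𝓝 c) := by
  have h0 := criticalParam_pos hα hα'
  have h1 := criticalParam_lt_one hα hα'
  simp_rw [survival_eq]
  refine exists_tendsto_sqrt_mul_measureReal_nonneg measurable_dh dh_le_one (memLp_dh hα hα') ?_ ?_
  · rwa [measureReal_dh_eq_one h0.le h1.le]
  · rw [integral_dh hα hα' h0.le h1.le, sub_self, mul_zero]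

theorem tendsto_survival (hα : 1 / 2 < α) (hα' : α < 1) (h0 : criticalParam α < p) (h1 : p ≤ 1) :
    Tendsto (survival α p) atTop (𝓝 ((1 + eta α) * (p - criticalParam α) / p)) := by
  have hp0 := (criticalParam_pos hα hα').trans h0
  have hη := eta_pos hα hα'
  have hpos : 0 ≤ ∫ u, (dh u : ℝ) ∂(envLaw α p) := by
    rw [integral_dh hα hα' hp0.le h1]
    exact mul_nonneg (by linarith) (by linarith)
  have := tendsto_measureReal_nonneg_of_pos measurable_dh dh_le_one (memLp_dh (p := p) hα hα')
    (by rw [measureReal_dh_eq_one hp0.le h1]; exact hp0.ne') hpos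
  rw [measureReal_dh_eq_one hp0.le h1, integral_dh hα hα' hp0.le h1] at this
  exact this.congr fun n => (survival_eq n).symm

/-! ### The subcritical regime -/

theorem tail_eq_chain (N n : ℕ) : tail α p n = ((seqLaw α p).prod (envLaw α p)).real
    {q | (n : ℕ∞) ≤ (stackCluster 0 (chain N q.1 q.2)).encard} := by
  rw [tail_eq]
  exact ((measurePreserving_chain α p N).measureReal_preimage
    ((measurable_encard_stackCluster 0)
      (MeasurableSet.of_discrete (s := Set.Ici (n : ℕ∞)))).nullMeasurableSet).symm

/-- If the exploration dies within `N` steps, the whole cluster has been swallowed in these steps.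
-/
theorem tail_le_survival_add (hα : 1 / 2 < α) (hα' : α < 1) (N n : ℕ) :
    tail α p n ≤ survival α p N + (seqLaw α p).real {u | n ≤ volumeN N u} := by
  rw [tail_eq_chain N, survival, ← measureReal_fst (ν := envLaw α p) {u | Alive N u 0},
    ← measureReal_fst (ν := envLaw α p) {u | n ≤ volumeN N u}]
  refine measureReal_le_add_of_ae ?_
  filter_upwards [ae_prod_fst (ae_good_seq hα hα')] with q hq hle
  by_cases ha : Alive N q.1 0
  · exact .inl ha
  · right
    have h : (n : ℕ∞) ≤ _ := hle.trans (encard_stackCluster_le_of_not_alive hq le_rfl ha)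
    exact_mod_cast h

theorem measureReal_volumeN_le {s M : ℝ} (hs : 1 ≤ s)
    (hM : ∫⁻ u, ENNReal.ofReal s ^ volume u ∂(envLaw α p) ≤ ENNReal.ofReal M) (hM0 : 0 ≤ M)
    (N n : ℕ) : (seqLaw α p).real {u | n ≤ volumeN N u} ≤ M ^ N / s ^ n := by
  have hs0 : 0 < s := by linarith
  rw [le_div_iff₀ (by positivity), mul_comm]
  have hm : Measurable fun u => ENNReal.ofReal s ^ volume u := measurable_const.pow measurable_volume
  have h1 := lintegral_prod_iid (μ := envLaw α p) hm N
  have h2 := mul_meas_ge_le_lintegral₀ (μ := seqLaw α p)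
    (f := fun u => ENNReal.ofReal s ^ volumeN N u)
    (measurable_const.pow (measurable_volumeN N)).aemeasurable (ENNReal.ofReal s ^ n)
  have e : ∀ u : ℕ → Env, ENNReal.ofReal s ^ volumeN N u =
      ∏ k ∈ Finset.range N, ENNReal.ofReal s ^ volume (u k) := fun u =>
    (Finset.prod_pow_eq_pow_sum _ _ _).symm
  simp_rw [e] at h2
  rw [show seqLaw α p = iid (envLaw α p) from rfl, h1] at h2
  have h3 := h2.trans (pow_le_pow_left' hM N)
  rw [← ENNReal.ofReal_pow hM0] at h3
  have h4 := ENNReal.toReal_le_of_le_ofReal (pow_nonneg hM0 N) h3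
  rw [ENNReal.toReal_mul, ← ENNReal.ofReal_pow hs0.le, ENNReal.toReal_ofReal (by positivity)] at h4
  refine le_trans (mul_le_mul_of_nonneg_left ?_ (by positivity)) h4
  refine ENNReal.toReal_mono (measure_ne_top _ _) (measure_mono fun u hu => ?_)
  simp only [Set.mem_ofPred_eq] at hu ⊢
  rw [← e]
  rw [← ENNReal.ofReal_pow hs0.le]
  exact ENNReal.ofReal_le_ofReal (pow_le_pow_right₀ hs hu)

theorem exists_tail_isBigO (hα : 1 / 2 < α) (hα' : α < 1) (h0 : 0 ≤ p) (h1 : p < criticalParam α) :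
    ∃ c : ℝ, 0 < c ∧ c < 1 ∧ (fun n : ℕ => tail α p n) =O[atTop] (fun n : ℕ => c ^ n) := by
  obtain ⟨c, hc0, hc1, hc⟩ := exists_survival_le hα hα' h0 h1
  obtain ⟨s, hs, hsv⟩ := exists_lintegral_pow_volume (p := p) hα hα'
  set M := (∫⁻ u, ENNReal.ofReal s ^ volume u ∂(envLaw α p)).toReal
  have hM : ∫⁻ u, ENNReal.ofReal s ^ volume u ∂(envLaw α p) ≤ ENNReal.ofReal M :=
    (ENNReal.ofReal_toReal hsv.ne).ge
  have hM0 : 0 ≤ M := ENNReal.toReal_nonneg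
  -- With `n / L` steps, `M ^ (n / L) / s ^ n` is at most `(M / s ^ L) ^ (n / L)`, and `s ^ L > 2 M`
  -- makes it at most `2 ^ (-(n / L))`.
  obtain ⟨L, hL⟩ := pow_unbounded_of_one_lt (2 * M + 1) hs
  have hL0 : 0 < L := by
    rcases Nat.eq_zero_or_pos L with rfl | h
    · simp at hL; linarith
    · exact h
  set d := max c (1 / 2) with hd
  have hd0 : 0 < d := lt_max_of_lt_left hc0
  have hd1 : d < 1 := max_lt hc1 (by norm_num)
  have hbound : ∀ n : ℕ, tail α p n ≤ 2 * d ^ (n / L) := by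
    intro n
    have h2 := measureReal_volumeN_le hs.le hM hM0 (n / L) n
    have h3 : M ^ (n / L) / s ^ n ≤ d ^ (n / L) := by
      rw [div_le_iff₀ (by positivity)]
      calc M ^ (n / L) ≤ (d * s ^ L) ^ (n / L) := by
            refine pow_le_pow_left₀ hM0 ?_ _
            have : (1 / 2 : ℝ) ≤ d := le_max_right _ _
            nlinarith
        _ = d ^ (n / L) * s ^ (L * (n / L)) := by rw [mul_pow, ← pow_mul]
        _ ≤ d ^ (n / L) * s ^ n := by
            gcongr
            · exact hs.le
            · exact Nat.mul_div_le n L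
    have h4 : survival α p (n / L) ≤ d ^ (n / L) :=
      (hc _).trans (pow_le_pow_left₀ hc0.le (le_max_left _ _) _)
    have := tail_le_survival_add (p := p) hα hα' (n / L) n
    linarith
  have hL' : (0 : ℝ) < L := Nat.cast_pos.2 hL0
  refine ⟨d ^ (1 / L : ℝ), Real.rpow_pos_of_pos hd0 _,
    Real.rpow_lt_one hd0.le hd1 (by positivity), ?_⟩
  -- The factor `1 / d` pays for the integer part in `n / L`.
  refine IsBigO.of_bound (2 / d) (Eventually.of_forall fun n => ?_)
  have hlt : (n : ℝ) / L ≤ (n / L : ℕ) + 1 := by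
    rw [div_le_iff₀ hL']
    have := (Nat.lt_div_mul_add (a := n) hL0).le
    have h5 : (n : ℝ) ≤ (n / L : ℕ) * L + L := by exact_mod_cast this
    linarith
  have h6 : d ^ (n / L) ≤ (d ^ (1 / L : ℝ)) ^ n / d := by
    rw [le_div_iff₀ hd0, ← pow_succ, ← Real.rpow_natCast, ← Real.rpow_natCast, ← Real.rpow_mul hd0.le]
    refine Real.rpow_le_rpow_of_exponent_ge hd0 hd1.le ?_
    push_cast
    rw [one_div_mul_eq_div]
    exact hlt
  rw [Real.norm_of_nonneg (show 0 ≤ tail α p n from measureReal_nonneg), Real.norm_of_nonneg (by positivity)]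
  calc tail α p n ≤ 2 * d ^ (n / L) := hbound n
    _ ≤ 2 * ((d ^ (1 / L : ℝ)) ^ n / d) := by gcongr
    _ = _ := by ring

/-! ### The supercritical regime -/

theorem percProb_le_survival (hα : 1 / 2 < α) (hα' : α < 1) (N : ℕ) :
    percProb α p ≤ survival α p N := by
  have e : percProb α p = ((seqLaw α p).prod (envLaw α p)).real
      {q | (stackCluster 0 (chain N q.1 q.2)).encard = ⊤} := by
    rw [percProb_eq]
    exact ((measurePreserving_chain α p N).measureReal_preimage
      ((measurable_encard_stackCluster 0)
        (MeasurableSet.of_discrete (s := {(⊤ : ℕ∞)}))).nullMeasurableSet).symm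
  rw [e, survival, ← measureReal_fst (ν := envLaw α p) {u | Alive N u 0}]
  have := measureReal_le_add_of_ae (μ := (seqLaw α p).prod (envLaw α p))
    (S := {q | (stackCluster 0 (chain N q.1 q.2)).encard = ⊤}) (T := {q | q.1 ∈ {u | Alive N u 0}})
    (R := ∅) ?_
  · simpa using this
  · filter_upwards [ae_prod_fst (ae_good_seq hα hα')] with q hq htop
    by_cases ha : Alive N q.1 0
    · exact .inl ha
    · have h := encard_stackCluster_le_of_not_alive (E := q.2) hq le_rfl ha
      rw [show (stackCluster 0 (chain N q.1 q.2)).encard = ⊤ from htop, top_le_iff] at h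
      exact absurd h (ENat.natCast_ne_top _)

theorem tendsto_tail (α p : ℝ) : Tendsto (tail α p) atTop (𝓝 (percProb α p)) := by
  have e : {E | (stackCluster 0 E).encard = ⊤} = ⋂ n : ℕ, {E | (n : ℕ∞) ≤ (stackCluster 0 E).encard} := by
    ext E
    simp only [Set.mem_iInter, Set.mem_ofPred_eq]
    exact ⟨fun h n => h ▸ le_top, fun h => ENat.eq_top_iff_forall_ge.2 h⟩
  have := tendsto_measure_iInter_atTop (μ := envLaw α p)
    (s := fun n : ℕ => {E | (n : ℕ∞) ≤ (stackCluster 0 E).encard})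
    (fun n => ((measurable_encard_stackCluster 0)
      (MeasurableSet.of_discrete (s := Set.Ici (n : ℕ∞)))).nullMeasurableSet)
    (fun a b hab E (hE : (b : ℕ∞) ≤ _) =>
      show (a : ℕ∞) ≤ _ from (Nat.cast_le.2 hab).trans hE) ⟨0, measure_ne_top _ _⟩
  rw [← e] at this
  have h2 := (ENNReal.tendsto_toReal (measure_ne_top _ _)).comp this
  rw [percProb_eq]
  exact h2.congr fun n => (tail_eq α p n).symm

/-- An infinite cluster forces survival at all times. Conversely, on survival the number of found
vertices grows linearly, so with `n` fixed and the number of blocks tending to infinity, the limit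
of `survival` is at most `tail α p n`. -/
theorem percProb_eq_of_gt (hα : 1 / 2 < α) (hα' : α < 1) (h0 : criticalParam α < p) (h1 : p < 1) :
    percProb α p = (1 + eta α) * (p - criticalParam α) / p := by
  have hp0 := (criticalParam_pos hα hα').trans h0
  have hs := tendsto_survival hα hα' h0 h1.le
  refine le_antisymm (ge_of_tendsto' hs fun N => percProb_le_survival hα hα' N) ?_
  refine ge_of_tendsto' (tendsto_tail α p) fun n => ?_
  have hb := meanFound_pos hα hα' hp0.le h1 one_pos
  set b := meanFound α p 1
  set V := Var[fun u => (foundCount 1 u : ℝ); seqLaw α p]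
  have hlim : Tendsto (fun J : ℕ => tail α p n + (V * (1 / J)) / (b - n * (1 / J)) ^ 2) atTop
      (𝓝 (tail α p n + (V * 0) / (b - n * 0) ^ 2)) := by
    have := tendsto_one_div_atTop_nhds_zero_nat (𝕜 := ℝ)
    refine tendsto_const_nhds.add (Tendsto.div (tendsto_const_nhds.mul this)
      ((tendsto_const_nhds.sub (tendsto_const_nhds.mul this)).pow 2) ?_)
    simp [hb.ne']
  rw [mul_zero, zero_div, add_zero] at hlim
  refine le_of_tendsto_of_tendsto hs hlim ?_
  have hev : ∀ᶠ J : ℕ in atTop, (n : ℝ) / b < J :=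
    tendsto_natCast_atTop_atTop.eventually_gt_atTop _
  filter_upwards [hev, eventually_gt_atTop 0] with J hJ hJ0
  have hJ0' : (0 : ℝ) < J := Nat.cast_pos.2 hJ0
  rw [div_lt_iff₀ hb] at hJ
  have : survival α p (1 * J) ≤ tail α p n + J * V / (J * b - n) ^ 2 :=
    survival_le (p := p) hα hα' one_pos hJ
  rw [one_mul] at this
  refine this.trans (le_of_eq ?_)
  congr 1
  have h3 : b - n * (1 / J) = (J * b - n) / J := by field_simp
  have h4 : (J * b - n : ℝ) ≠ 0 := by linarith
  rw [h3]
  field_simp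

end

section

variable {α p : ℝ}

/-! ### The critical regime -/

/-- With `J n` of order `n`, the Chebyshev error `J n / n ^ 2` is `O(1 / n)`, negligible with
respect to `n ^ (-1/2)`. -/
theorem tendsto_sqrt_mul_comp_add {q : ℕ → ℝ} {c r K : ℝ} {l : ℕ} {J : ℕ → ℕ} (hl : 0 < l)
    (hr : 0 < r) (hq : Tendsto (fun n : ℕ => √n * q n) atTop (𝓝 c))
    (hJ : Tendsto (fun n : ℕ => (J n : ℝ) / n) atTop (𝓝 r)) :
    Tendsto (fun n : ℕ => √n * (q (l * J n) + J n / n ^ 2 * K)) atTop (𝓝 (c / √(l * r))) := by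
  have hl' : (0 : ℝ) < l := Nat.cast_pos.2 hl
  have hn := tendsto_natCast_atTop_atTop (R := ℝ)
  have hJtop : Tendsto J atTop atTop := by
    have h := hJ.pos_mul_atTop hr hn
    refine tendsto_natCast_atTop_iff.1 (h.congr' ?_)
    filter_upwards [eventually_gt_atTop 0] with n hn0
    have : (n : ℝ) ≠ 0 := by positivity
    field_simp
  have h1 : Tendsto (fun n => √((l * J n : ℕ) : ℝ) * q (l * J n)) atTop (𝓝 c) :=
    hq.comp (hJtop.const_mul_atTop' hl)
  have h2 : Tendsto (fun n : ℕ => √(l * ((J n : ℝ) / n))) atTop (𝓝 √(l * r)) :=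
    (hJ.const_mul _).sqrt
  have h3 : Tendsto (fun n : ℕ => (J n : ℝ) / n * (√n)⁻¹ * K) atTop (𝓝 (r * 0 * K)) :=
    (hJ.mul (tendsto_inv_atTop_zero.comp (Real.tendsto_sqrt_atTop.comp hn))).mul_const K
  have h4 := (h1.div h2 (by positivity)).add h3
  rw [mul_zero, zero_mul, add_zero] at h4
  refine h4.congr' ?_
  filter_upwards [eventually_gt_atTop 0, hJtop.eventually_gt_atTop 0] with n hn0 hJ0
  have hn' : (0 : ℝ) < n := Nat.cast_pos.2 hn0
  have hJ' : (0 : ℝ) < J n := Nat.cast_pos.2 hJ0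
  simp only [Pi.div_apply]
  have e : √((l * J n : ℕ) : ℝ) = √(l * ((J n : ℝ) / n)) * √n := by
    rw [← Real.sqrt_mul (by positivity)]
    congr 1
    push_cast
    field_simp
  have e2 : (0 : ℝ) < √(l * ((J n : ℝ) / n)) := by positivity
  rw [e, mul_add]
  congr 1
  · field_simp
  · rw [show (√(n : ℝ))⁻¹ = √n / n from Real.sqrt_div_self.symm]
    field_simp

theorem eventually_sqrt_mul_tail_lt (hα : 1 / 2 < α) (hα' : α < 1) {c : ℝ}
    (hc : Tendsto (fun n : ℕ => √n * survival α p n) atTop (𝓝 c)) {l : ℕ} (hl : 0 < l)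
    (ha : 0 < meanFound α p l + meanPending α p l) {δ y : ℝ} (hδ : 0 < δ) (hδ1 : δ < 1)
    (hy : c / √(l * ((1 - δ) / (meanFound α p l + meanPending α p l))) < y) :
    ∀ᶠ n : ℕ in atTop, √n * tail α p n < y := by
  set a := meanFound α p l + meanPending α p l
  have hr : 0 < (1 - δ) / a := div_pos (by linarith) ha
  have hJ : Tendsto (fun n : ℕ => ((⌊(1 - δ) / a * n⌋₊ : ℕ) : ℝ) / n) atTop (𝓝 ((1 - δ) / a)) :=
    (tendsto_nat_floor_mul_div_atTop hr.le).comp tendsto_natCast_atTop_atTop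
  have h := tendsto_sqrt_mul_comp_add (K := (Var[fun u => (foundCount l u : ℝ) + pending l u;
    seqLaw α p] + ∫ u, (volumeN l u : ℝ) ^ 2 ∂(seqLaw α p)) / (δ / 2) ^ 2) hl hr hc hJ
  filter_upwards [h.eventually_lt_const hy, eventually_gt_atTop 0] with n hn hn0
  refine lt_of_le_of_lt (mul_le_mul_of_nonneg_left ?_ (Real.sqrt_nonneg _)) hn
  refine tail_le hα hα' hl hδ hn0 ?_
  have := Nat.floor_le (a := (1 - δ) / a * n) (by positivity)
  calc _ ≤ (1 - δ) / a * n * a := mul_le_mul_of_nonneg_right this ha.le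
    _ = _ := by field_simp

theorem eventually_lt_sqrt_mul_tail (hα : 1 / 2 < α) (hα' : α < 1) {c : ℝ}
    (hc : Tendsto (fun n : ℕ => √n * survival α p n) atTop (𝓝 c)) {l : ℕ} (hl : 0 < l)
    (hb : 0 < meanFound α p l) {δ y : ℝ} (hδ : 0 < δ)
    (hy : y < c / √(l * ((1 + δ) / meanFound α p l))) :
    ∀ᶠ n : ℕ in atTop, y < √n * tail α p n := by
  set b := meanFound α p l
  have hr : 0 < (1 + δ) / b := div_pos (by linarith) hb
  have hJ : Tendsto (fun n : ℕ => ((⌈(1 + δ) / b * n⌉₊ : ℕ) : ℝ) / n) atTop (𝓝 ((1 + δ) / b)) :=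
    (tendsto_nat_ceil_mul_div_atTop hr.le).comp tendsto_natCast_atTop_atTop
  set V := Var[fun u => (foundCount l u : ℝ); seqLaw α p]
  have hV : 0 ≤ V := variance_nonneg _ _
  have h := tendsto_sqrt_mul_comp_add (K := -(V / δ ^ 2)) hl hr hc hJ
  filter_upwards [h.eventually_const_lt hy, eventually_gt_atTop 0] with n hn hn0
  refine lt_of_lt_of_le hn (mul_le_mul_of_nonneg_left ?_ (Real.sqrt_nonneg _))
  have hn' : (0 : ℝ) < n := Nat.cast_pos.2 hn0
  set J := ⌈(1 + δ) / b * n⌉₊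
  have h1 : δ * n ≤ J * b - n := by
    have := mul_le_mul_of_nonneg_right (Nat.le_ceil ((1 + δ) / b * n)) hb.le
    rw [show (1 + δ) / b * n * b = (1 + δ) * n by field_simp] at this
    linarith
  have h2 : survival α p (l * J) ≤ tail α p n + J * V / (J * b - n) ^ 2 :=
    survival_le hα hα' hl (by have := mul_pos hδ hn'; linarith)
  have h3 : J * V / (J * b - n) ^ 2 ≤ J * V / (δ * n) ^ 2 := by gcongr
  have h4 : J / (n : ℝ) ^ 2 * -(V / δ ^ 2) = - (J * V / (δ * n) ^ 2) := by field_simp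
  rw [h4]
  linarith

/-- The square of the upper limit is at most `a l / l`, that of the lower limit at least `b l / l`,
and these differ by at most `D / l`. Letting `l` tend to infinity identifies the two limits without
computing either. -/
theorem exists_tendsto_of_forall_sqrt_div {t a b : ℕ → ℝ} {D : ℝ} (ht : ∀ n, 0 ≤ t n)
    (hb : ∀ l, 0 < l → 0 < b l) (hab : ∀ l, a l ≤ b l + D)
    (hup : ∀ l, 0 < l → ∀ y, √(a l / l) < y → ∀ᶠ n in atTop, t n < y)
    (hlow : ∀ l, 0 < l → ∀ y, y < √(b l / l) → ∀ᶠ n in atTop, y < t n) :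
    ∃ A, 0 < A ∧ Tendsto t atTop (𝓝 A) := by
  have hbdd : IsBoundedUnder (· ≤ ·) atTop t :=
    ⟨√(a 1 / (1 : ℕ)) + 1, eventually_map.2 ((hup 1 one_pos _ (lt_add_one _)).mono fun _ h => h.le)⟩
  have hbdd' : IsBoundedUnder (· ≥ ·) atTop t := ⟨0, eventually_map.2 (Eventually.of_forall ht)⟩
  have h1 : ∀ l, 0 < l → limsup t atTop ≤ √(a l / l) := fun l hl =>
    le_of_forall_gt_imp_ge_of_dense fun y hy =>
      limsup_le_of_le hbdd'.isCoboundedUnder_le ((hup l hl y hy).mono fun _ h => h.le)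
  have h2 : ∀ l, 0 < l → √(b l / l) ≤ liminf t atTop := fun l hl =>
    le_of_forall_lt_imp_le_of_dense fun y hy =>
      le_liminf_of_le hbdd.isCoboundedUnder_ge ((hlow l hl y hy).mono fun _ h => h.le)
  have hlow0 : 0 < liminf t atTop :=
    (Real.sqrt_pos.2 (div_pos (hb 1 one_pos) (by norm_num))).trans_le (h2 1 one_pos)
  refine ⟨liminf t atTop, hlow0, tendsto_of_le_liminf_of_limsup_le le_rfl ?_ hbdd hbdd'⟩
  have hle := liminf_le_limsup hbdd hbdd'
  refine le_of_sq_le_sq ?_ hlow0.le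
  have hD : Tendsto (fun l : ℕ => liminf t atTop ^ 2 + D / l) atTop
      (𝓝 (liminf t atTop ^ 2 + 0)) :=
    tendsto_const_nhds.add (tendsto_const_div_atTop_nhds_zero_nat D)
  rw [add_zero] at hD
  refine ge_of_tendsto hD ?_
  filter_upwards [eventually_gt_atTop 0] with l hl
  have hl' : (0 : ℝ) < l := Nat.cast_pos.2 hl
  have h3 := Real.sqrt_pos.1 (hlow0.trans_le (hle.trans (h1 l hl)))
  have h4 : limsup t atTop ^ 2 ≤ a l / l := by
    rw [← Real.sq_sqrt h3.le]
    exact pow_le_pow_left₀ (hlow0.le.trans hle) (h1 l hl) 2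
  have h5 : b l / l ≤ liminf t atTop ^ 2 := by
    rw [← Real.sq_sqrt (div_pos (hb l hl) hl').le]
    exact pow_le_pow_left₀ (Real.sqrt_nonneg _) (h2 l hl) 2
  have h6 : a l / l ≤ b l / l + D / l := by
    rw [← add_div]
    exact div_le_div_of_nonneg_right (hab l) hl'.le
  linarith

theorem exists_tendsto_sqrt_mul_tail (hα : 1 / 2 < α) (hα' : α < 1) : ∃ A : ℝ, 0 < A ∧
    Tendsto (fun n : ℕ => √n * tail α (criticalParam α) n) atTop (𝓝 A) := by
  obtain ⟨c, hc0, hc⟩ := tendsto_sqrt_mul_survival hα hα'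
  have hp0 := (criticalParam_pos hα hα').le
  have hp1 := criticalParam_lt_one hα hα'
  set p := criticalParam α
  set D := (∫ u, (volume u : ℝ) ∂(envLaw α p)) / (envLaw α p).real {u | Renews u}
  have hpend : ∀ l, 0 ≤ meanPending α p l := fun l => integral_nonneg fun u => Nat.cast_nonneg _
  have hb : ∀ l, 0 < l → 0 < meanFound α p l := fun l hl => meanFound_pos hα hα' hp0 hp1 hl
  have hsqrt : ∀ {l : ℕ} {x : ℝ}, 0 < l → 0 < x → c / √(l * ((1 + 0) / x)) = √(c ^ 2 * x / l) := by
    intro l x hl hx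
    have hl' : (0 : ℝ) < l := Nat.cast_pos.2 hl
    rw [← Real.sqrt_sq hc0.le, ← Real.sqrt_div (by positivity), Real.sqrt_sq hc0.le]
    congr 1
    field_simp
    ring
  have hcont : ∀ {l : ℕ} {x : ℝ}, 0 < l → 0 < x →
      Tendsto (fun δ : ℝ => c / √(l * ((1 + δ) / x))) (𝓝 0) (𝓝 √(c ^ 2 * x / l)) := by
    intro l x hl hx
    have hl' : (0 : ℝ) < l := Nat.cast_pos.2 hl
    rw [← hsqrt hl hx]
    have : ContinuousAt (fun δ : ℝ => c / √(l * ((1 + δ) / x))) 0 := by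
      refine ContinuousAt.div continuousAt_const (by fun_prop) ?_
      rw [add_zero]
      positivity
    exact this
  refine exists_tendsto_of_forall_sqrt_div (D := c ^ 2 * D)
    (a := fun l => c ^ 2 * (meanFound α p l + meanPending α p l))
    (b := fun l => c ^ 2 * meanFound α p l)
    (fun n => mul_nonneg (Real.sqrt_nonneg _) measureReal_nonneg)
    (fun l hl => mul_pos (by positivity) (hb l hl)) (fun l => ?_) (fun l hl y hy => ?_)
    (fun l hl y hy => ?_)
  · rw [← mul_add]
    have := meanPending_le hα hα' hp0 hp1 l
    gcongr
  · have ha : 0 < meanFound α p l + meanPending α p l := add_pos_of_pos_of_nonneg (hb l hl) (hpend l)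
    -- The margin is absorbed by continuity at zero; here it is taken negative, to match the factor
    -- `1 - δ` of the upper bound.
    have h1 := ((hcont hl ha).eventually_lt_const hy).filter_mono
      (nhdsWithin_le_nhds (s := Set.Iio 0))
    obtain ⟨δ, hδ, hδ1, hδ0⟩ := (h1.and ((eventually_gt_nhds (show (-1 : ℝ) < 0 by norm_num)
      |>.filter_mono nhdsWithin_le_nhds).and self_mem_nhdsWithin)).exists
    have hδ0 : δ < 0 := hδ0
    refine eventually_sqrt_mul_tail_lt hα hα' hc hl ha (δ := -δ) (by linarith) (by linarith) ?_
    rwa [sub_neg_eq_add]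
  · have h1 := ((hcont hl (hb l hl)).eventually_const_lt hy).filter_mono
      (nhdsWithin_le_nhds (s := Set.Ioi 0))
    obtain ⟨δ, hδ, hδ0⟩ := (h1.and self_mem_nhdsWithin).exists
    exact eventually_lt_sqrt_mul_tail hα hα' hc hl (hb l hl) hδ0 hδ

theorem exists_tail_isEquivalent (hα : 1 / 2 < α) (hα' : α < 1) : ∃ A : ℝ, 0 < A ∧
    (fun n : ℕ => tail α (criticalParam α) n) ~[atTop]
      (fun n : ℕ => A * (n : ℝ) ^ (-(1 / 2) : ℝ)) := by
  obtain ⟨A, hA, h⟩ := exists_tendsto_sqrt_mul_tail hα hα'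
  refine ⟨A, hA, isEquivalent_of_tendsto_one ?_⟩
  have h1 := h.div_const A
  rw [div_self hA.ne'] at h1
  refine h1.congr' ?_
  filter_upwards [eventually_gt_atTop 0] with n hn
  have hn' : (0 : ℝ) < n := Nat.cast_pos.2 hn
  have hs : 0 < √(n : ℝ) := by positivity
  rw [Pi.div_apply, Real.rpow_neg hn'.le, ← Real.sqrt_eq_rpow]
  field_simp

theorem exists_percProb_isEquivalent (hα : 1 / 2 < α) (hα' : α < 1) : ∃ a : ℝ, 0 < a ∧
    (fun p : ℝ => percProb α p) ~[𝓝[>] (criticalParam α)]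
      (fun p : ℝ => a * (p - criticalParam α)) := by
  have hp0 := criticalParam_pos hα hα'
  have hp1 := criticalParam_lt_one hα hα'
  have hη := eta_pos hα hα'
  refine ⟨(1 + eta α) / criticalParam α, by positivity, isEquivalent_of_tendsto_one ?_⟩
  have h1 : Tendsto (fun p => criticalParam α / p) (𝓝[>] (criticalParam α)) (𝓝 1) := by
    have : ContinuousAt (fun p => criticalParam α / p) (criticalParam α) :=
      continuousAt_const.div continuousAt_id hp0.ne'
    have h := this.tendsto
    rw [div_self hp0.ne'] at h
    exact h.mono_left nhdsWithin_le_nhds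
  refine h1.congr' ?_
  filter_upwards [self_mem_nhdsWithin, (eventually_lt_nhds hp1).filter_mono nhdsWithin_le_nhds]
    with p hp hp'
  have hp : criticalParam α < p := hp
  have h2 : p - criticalParam α ≠ 0 := (sub_pos.2 hp).ne'
  have h3 : p ≠ 0 := (hp0.trans hp).ne'
  have h4 : 1 + eta α ≠ 0 := by positivity
  rw [Pi.div_apply, percProb_eq_of_gt hα hα' hp hp']
  field_simp

end

end SCTHP

theorem mainTheorem5 (α : ℝ) (hα : 1 / 2 < α) (hα' : α < 1) :
    (∀ p : ℝ, 0 ≤ p → p < SCTHP.criticalParam α →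
      ∃ c : ℝ, 0 < c ∧ c < 1 ∧
        (fun n : ℕ => SCTHP.tail α p n) =O[atTop] (fun n : ℕ => c ^ n)) ∧
    (∃ A : ℝ, 0 < A ∧
      (fun n : ℕ => SCTHP.tail α (SCTHP.criticalParam α) n) ~[atTop]
        (fun n : ℕ => A * (n : ℝ) ^ (-(1 / 2) : ℝ))) ∧
    (∃ a : ℝ, 0 < a ∧
      (fun p : ℝ => SCTHP.percProb α p) ~[𝓝[>] (SCTHP.criticalParam α)]
        (fun p : ℝ => a * (p - SCTHP.criticalParam α))) :=
  ⟨fun _ h0 h1 => SCTHP.exists_tail_isBigO hα hα' h0 h1, SCTHP.exists_tail_isEquivalent hα hα',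
    SCTHP.exists_percProb_isEquivalent hα hα'⟩
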